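/- Let $(M,g)$ be a closed oriented smooth Riemannian surface with Gaussian curvature $K_g$, let $\pi:SM\to M$ be its unit tangent bundle, let $J$ be the rotation of the tangent planes of $M$ by $+\pi/2$, and let $X,H,V$ be the vector fields on $SM$ given at $(x,v)$ by the horizontal lift of $v$ (the geodesic vector field), the horizontal lift of $Jv$ (horizontal with respect to the Levi-Civita connection), and the generator of the rotation $t\mapsto(x,\cos t\,v+\sin t\,Jv)$ of the fibre. For $\lambda\in C^\infty(SM)$ put $$F=X+\lambda V,\qquad \kappa=K_g\circ\pi-H\lambda+\lambda^2,\qquad \mathbb K=\kappa+F(V\lambda).$$ A vector field $F$ on $SM$ is said to generate an Anosov flow if it vanishes nowhere, has a complete flow $\phi$ by differentiable maps, and there is a $d\phi_t$-invariant splitting $TSM=\mathbb RF\oplus E^s\oplus E^u$ with continuous line bundles $E^s,E^u$ such that for every continuous Riemannian metric on $SM$ there are constants $C,\mu>0$ with $\|d\phi_t\xi\|\le Ce^{-\mu t}\|\xi\|$ for $\xi\in E^s$ and $\|d\phi_{-t}\xi\|\le Ce^{-\mu t}\|\xi\|$ for $\xi\in E^u$, for all $t\ge0$. (1) If $\mathbb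 K<0$ everywhere on $SM$, then the thermostat vector field $F=X+\lambda V$ generates an Anosov flow. (2) Let $\theta$ be a smooth $1$-form on $M$, viewed as the function $(x,v)\mapsto\theta_x(v)$ on $SM$, and let $\lambda=-V\theta$ (so that $F=X-(V\theta)V$ generates the W-flow of $\theta$). Then $\mathbb K=(K_g-\delta_g\theta)\circ\pi$, where $\delta_g\theta=-\operatorname{tr}_g\nabla\theta$ is the co-differential. Consequently, if $K_g-\delta_g\theta<0$ everywhere on $M$, then the W-flow of $\theta$ is Anosov. -/

import Mathlib

open Bundle Manifold Filter
open scoped ContDiff Topology Manifold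

noncomputable section

/-- The Euclidean plane, the model space of surfaces. -/
abbrev E2 : Type := EuclideanSpace ℝ (Fin 2)

/-- Smooth Riemannian metrics on the surface `M`. -/
abbrev SurfaceMetric (M : Type*) [TopologicalSpace M] [ChartedSpace E2 M]
    [IsManifold 𝓘(ℝ, E2) ∞ M] : Type _ :=
  ContMDiffRiemannianMetric 𝓘(ℝ, E2) ∞ E2 (fun x : M => TangentSpace 𝓘(ℝ, E2) x)

namespace Thermostat

section UnitTangent

variable {M : Type*} [TopologicalSpace M] [ChartedSpace E2 M] [IsManifold 𝓘(ℝ, E2) ∞ M]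

/-- The function `(x, v) ↦ g_x(v, v)` on `TM`. -/
def normSq (g : SurfaceMetric M) (q : TangentBundle 𝓘(ℝ, E2) M) : ℝ := g.inner q.1 q.2 q.2

/-- The unit tangent bundle `SM` of `(M, g)`; the field `incl` is the inclusion `SM → TM`. -/
@[ext]
structure UnitTangentBundle (g : SurfaceMetric M) : Type _ where
  incl : TangentBundle 𝓘(ℝ, E2) M
  normSq_incl : normSq g incl = 1

/-- `SM` carries the subspace topology of `TM`. -/
instance (g : SurfaceMetric M) : TopologicalSpace (UnitTangentBundle g) :=
  TopologicalSpace.induced UnitTangentBundle.incl inferInstance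

/-- The radial projection `(x, v) ↦ (x, v / |v|)`. -/
def radialProj (g : SurfaceMetric M) (q : TangentBundle 𝓘(ℝ, E2) M) : TangentBundle 𝓘(ℝ, E2) M :=
  ⟨q.1, (Real.sqrt (normSq g q))⁻¹ • q.2⟩

/-- The rotation by `+π/2` of the coordinate plane. -/
def rot (w : E2) : E2 := !₂[-w 1, w 0]

/-- The natural coordinates on `TM` induced by the preferred chart of `M` at `q.1`. -/
def tmChart (q : TangentBundle 𝓘(ℝ, E2) M) :
    OpenPartialHomeomorph (TangentBundle 𝓘(ℝ, E2) M) (E2 × E2) :=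
  chartAt (ModelProd E2 E2) q

theorem contMDiff_normSq (g : SurfaceMetric M) :
    ContMDiff (𝓘(ℝ, E2).prod 𝓘(ℝ, E2)) 𝓘(ℝ, ℝ) ∞ (normSq g) := by
  let _ : RiemannianBundle (fun x : M => TangentSpace 𝓘(ℝ, E2) x) := ⟨g.toRiemannianMetric⟩
  exact ContMDiff.inner_bundle (IB := 𝓘(ℝ, E2)) (n := ∞) (F := E2)
    (E := fun x : M => TangentSpace 𝓘(ℝ, E2) x)
    (IM := 𝓘(ℝ, E2).prod 𝓘(ℝ, E2)) (M := TangentBundle 𝓘(ℝ, E2) M) (b := fun p => p.1)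
    (v := fun p => p.2) (w := fun p => p.2) contMDiff_id contMDiff_id

theorem mem_tmChart_source (p q : TangentBundle 𝓘(ℝ, E2) M) :
    p ∈ (tmChart q).source ↔ p.1 ∈ (chartAt E2 q.1).source :=
  TangentBundle.mem_chart_source_iff p q

theorem mem_tmChart_target (q : TangentBundle 𝓘(ℝ, E2) M) (z : E2 × E2) :
    z ∈ (tmChart q).target ↔ z.1 ∈ (chartAt E2 q.1).target :=
  TangentBundle.mem_chart_target_iff (H := E2) (E := E2) z q

theorem tmChart_fst (p q : TangentBundle 𝓘(ℝ, E2) M) :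
    (tmChart q p).1 = chartAt E2 q.1 p.1 := rfl

theorem tmChart_snd (p q : TangentBundle 𝓘(ℝ, E2) M) :
    (tmChart q p).2 = (trivializationAt E2 (TangentSpace 𝓘(ℝ, E2)) q.1 p).2 := rfl

/-- The natural coordinates are linear on the fibres. -/
theorem tmChart_smul (q : TangentBundle 𝓘(ℝ, E2) M) (x : M) (v : TangentSpace 𝓘(ℝ, E2) x)
    (c : ℝ) : tmChart q ⟨x, c • v⟩ = ((tmChart q ⟨x, v⟩).1, c • (tmChart q ⟨x, v⟩).2) := by
  refine Prod.ext rfl ?_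
  simp only [tmChart_snd, TangentBundle.trivializationAt_apply]
  exact map_smul _ c v

theorem tmChart_radialProj (g : SurfaceMetric M) (q p : TangentBundle 𝓘(ℝ, E2) M) :
    tmChart q (radialProj g p) =
      ((tmChart q p).1, (Real.sqrt (normSq g p))⁻¹ • (tmChart q p).2) :=
  tmChart_smul q p.1 p.2 _

theorem normSq_pos (g : SurfaceMetric M) (p q : TangentBundle 𝓘(ℝ, E2) M)
    (hp : (tmChart q p).2 ≠ 0) : 0 < normSq g p := by
  refine g.pos _ _ fun h => hp ?_
  have h2 := tmChart_smul q p.1 p.2 0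
  rw [zero_smul, zero_smul] at h2
  have h3 : (⟨p.1, 0⟩ : TangentBundle 𝓘(ℝ, E2) M) = p := by
    rw [← h]
  rw [h3] at h2
  exact congrArg Prod.snd h2

theorem tmChart_snd_ne (g : SurfaceMetric M) (p q : TangentBundle 𝓘(ℝ, E2) M)
    (h : p ∈ (tmChart q).source) (hp : 0 < normSq g p) : (tmChart q p).2 ≠ 0 := by
  intro h0
  have h2 := tmChart_smul q p.1 p.2 0
  rw [zero_smul, zero_smul] at h2
  have h3 : tmChart q ⟨p.1, 0⟩ = tmChart q p := by
    rw [h2]; exact Prod.ext rfl h0.symm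
  have h4 := (tmChart q).injOn (x₁ := ⟨p.1, 0⟩) (x₂ := p) ((mem_tmChart_source _ _).2
    ((mem_tmChart_source _ _).1 h)) h h3
  rw [← h4] at hp
  simp [normSq] at hp

theorem normSq_radialProj (g : SurfaceMetric M) (p : TangentBundle 𝓘(ℝ, E2) M)
    (hp : 0 < normSq g p) : normSq g (radialProj g p) = 1 := by
  have h : normSq g (radialProj g p) =
      (Real.sqrt (normSq g p))⁻¹ * ((Real.sqrt (normSq g p))⁻¹ * normSq g p) := by
    change g.inner p.1 ((Real.sqrt (normSq g p))⁻¹ • p.2) ((Real.sqrt (normSq g p))⁻¹ • p.2) = _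
    rw [map_smul]
    rw [map_smul (g.inner p.1)]
    rfl
  have h1 : Real.sqrt (normSq g p) ≠ 0 := (Real.sqrt_pos.2 hp).ne'
  rw [h]
  field_simp
  exact (Real.sq_sqrt hp.le).symm

theorem radialProj_of_unit (g : SurfaceMetric M) (p : TangentBundle 𝓘(ℝ, E2) M)
    (hp : normSq g p = 1) : radialProj g p = p := by
  unfold radialProj
  rw [hp]
  simp

theorem contMDiffAt_radialProj (g : SurfaceMetric M) (p : TangentBundle 𝓘(ℝ, E2) M)
    (hp : 0 < normSq g p) : ContMDiffAt (𝓘(ℝ, E2).prod 𝓘(ℝ, E2)) (𝓘(ℝ, E2).prod 𝓘(ℝ, E2)) ∞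
      (radialProj g) p := by
  have hid := (contMDiffAt_totalSpace (IM := 𝓘(ℝ, E2).prod 𝓘(ℝ, E2)) (IB := 𝓘(ℝ, E2))
    (f := fun q : TangentBundle 𝓘(ℝ, E2) M => q) (x₀ := p) (n := ∞)).1 contMDiffAt_id
  refine contMDiffAt_totalSpace.2 ⟨hid.1, ?_⟩
  have hs : ContMDiffAt (𝓘(ℝ, E2).prod 𝓘(ℝ, E2)) 𝓘(ℝ, ℝ) ∞
      (fun q => (Real.sqrt (normSq g q))⁻¹) p := by
    have h1 : ContDiffAt ℝ ∞ (fun r : ℝ => (Real.sqrt r)⁻¹) (normSq g p) :=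
      (Real.contDiffAt_sqrt hp.ne').inv (Real.sqrt_pos.2 hp).ne'
    exact h1.contMDiffAt.comp p (contMDiff_normSq g).contMDiffAt
  have h2 := hs.smul hid.2
  refine h2.congr_of_eventuallyEq (Eventually.of_forall fun q => ?_)
  exact congrArg Prod.snd (tmChart_radialProj g p q)

/-- The slope coordinate: `(y, w) ↦ (y, ⟪w, Ju⟫ / ⟪w, u⟫)`. -/
def slope (u : E2) (z : E2 × E2) : E2 × ℝ := (z.1, inner ℝ z.2 (rot u) / inner ℝ z.2 u)

/-- The affine line of slope coordinates: `(y, s) ↦ (y, u + s Ju)`. -/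
def affineLine (u : E2) (z : E2 × ℝ) : E2 × E2 := (z.1, u + z.2 • rot u)

theorem inner_E2 (v w : E2) : inner ℝ v w = v 0 * w 0 + v 1 * w 1 := by
  rw [PiLp.inner_apply, Fin.sum_univ_two]
  simp [mul_comm]

theorem inner_affineLine (u : E2) (z : E2 × ℝ) :
    inner ℝ (affineLine u z).2 u = inner ℝ u u := by
  simp only [inner_E2, affineLine, rot, PiLp.add_apply, PiLp.smul_apply, smul_eq_mul]
  simp
  ring

theorem slope_affineLine (u : E2) (hu : u ≠ 0) (z : E2 × ℝ) : slope u (affineLine u z) = z := by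
  have h : inner ℝ u u ≠ (0 : ℝ) := inner_self_ne_zero.2 hu
  refine Prod.ext rfl ?_
  simp only [slope, inner_affineLine]
  rw [div_eq_iff h]
  simp only [inner_E2, affineLine, rot, PiLp.add_apply, PiLp.smul_apply, smul_eq_mul]
  simp
  ring

theorem slope_smul (u y w : E2) (c : ℝ) (hc : c ≠ 0) : slope u (y, c • w) = slope u (y, w) := by
  refine Prod.ext rfl ?_
  simp only [slope, inner_smul_left]
  exact mul_div_mul_left _ _ hc

theorem affineLine_slope (u : E2) (z : E2 × E2) (hz : 0 < inner ℝ z.2 u) :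
    affineLine u (slope u z) = (z.1, (inner ℝ u u / inner ℝ z.2 u) • z.2) := by
  refine Prod.ext rfl ?_
  rw [inner_E2] at hz
  have key : ∀ a b c d : ℝ, 0 < c * a + d * b →
      a + (c * -b + d * a) / (c * a + d * b) * -b = (a * a + b * b) / (c * a + d * b) * c ∧
      b + (c * -b + d * a) / (c * a + d * b) * a = (a * a + b * b) / (c * a + d * b) * d := by
    intro a b c d h
    have h' := h.ne'
    constructor <;> rw [div_mul_eq_mul_div, div_mul_eq_mul_div, eq_div_iff h', add_mul,
      div_mul_cancel₀ _ h'] <;> ring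
  have k := key _ _ _ _ hz
  ext i
  fin_cases i <;> simp only [slope, affineLine, inner_E2, PiLp.add_apply, PiLp.smul_apply]
  · exact k.1
  · exact k.2

theorem contDiff_affineLine (u : E2) : ContDiff ℝ ∞ (affineLine u) := by
  unfold affineLine
  fun_prop

theorem contDiffAt_slope (u : E2) (z : E2 × E2) (hz : inner ℝ z.2 u ≠ 0) :
    ContDiffAt ℝ ∞ (slope u) z := by
  unfold slope
  exact contDiffAt_fst.prodMk (ContDiffAt.div (contDiffAt_snd.inner ℝ contDiffAt_const)
    (contDiffAt_snd.inner ℝ contDiffAt_const) hz)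

namespace UnitTangentBundle

variable {g : SurfaceMetric M}

/-- The coordinates of the unit vector `p` in the natural chart at `p`. -/
def dir (p : UnitTangentBundle g) : E2 := (tmChart p.incl p.incl).2

theorem dir_ne (p : UnitTangentBundle g) : p.dir ≠ 0 :=
  tmChart_snd_ne g p.incl p.incl ((mem_tmChart_source _ _).2 (mem_chart_source E2 _))
    (by rw [normSq_incl]; exact one_pos)

theorem continuous_incl : Continuous (incl (g := g)) := continuous_induced_dom

theorem incl_injective : Function.Injective (incl (g := g)) := fun _ _ h => UnitTangentBundle.ext h

/-- The vector of `TM` with natural coordinates `(y, u + s Ju)`, before normalisation. -/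
def preInv (p : UnitTangentBundle g) (z : E2 × ℝ) : TangentBundle 𝓘(ℝ, E2) M :=
  (tmChart p.incl).symm (affineLine p.dir z)

theorem tmChart_preInv (p : UnitTangentBundle g) (z : E2 × ℝ)
    (hz : z.1 ∈ (chartAt E2 p.incl.1).target) :
    tmChart p.incl (preInv p z) = affineLine p.dir z :=
  (tmChart p.incl).right_inv ((mem_tmChart_target _ _).2 hz)

theorem normSq_preInv (p : UnitTangentBundle g) (z : E2 × ℝ)
    (hz : z.1 ∈ (chartAt E2 p.incl.1).target) : 0 < normSq g (preInv p z) := by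
  refine normSq_pos g _ p.incl ?_
  rw [tmChart_preInv p z hz]
  intro h
  have h1 := inner_affineLine p.dir z
  rw [h, inner_zero_left] at h1
  exact p.dir_ne (inner_self_eq_zero.1 h1.symm)

open Classical in
/-- The inverse of the chart of `SM` at `p`: the unit vector in the direction `u + s Ju`. -/
def chartInv (p : UnitTangentBundle g) (z : E2 × ℝ) : UnitTangentBundle g :=
  if hz : z.1 ∈ (chartAt E2 p.incl.1).target then
    ⟨radialProj g (preInv p z), normSq_radialProj g _ (normSq_preInv p z hz)⟩
  else p

theorem incl_chartInv (p : UnitTangentBundle g) (z : E2 × ℝ)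
    (hz : z.1 ∈ (chartAt E2 p.incl.1).target) :
    (chartInv p z).incl = radialProj g (preInv p z) := by
  unfold chartInv
  rw [dif_pos hz]

theorem tmChart_chartInv (p : UnitTangentBundle g) (z : E2 × ℝ)
    (hz : z.1 ∈ (chartAt E2 p.incl.1).target) : ∃ c : ℝ, 0 < c ∧
    tmChart p.incl (chartInv p z).incl = (z.1, c • (affineLine p.dir z).2) := by
  refine ⟨_, inv_pos.2 (Real.sqrt_pos.2 (normSq_preInv p z hz)), ?_⟩
  rw [incl_chartInv p z hz, tmChart_radialProj, tmChart_preInv p z hz]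
  rfl

/-- The chart of `SM` at the unit vector `p`, with `u` the coordinates of `p`: a unit vector with
natural coordinates `(y, w)`, where `⟪w, u⟫ > 0`, is sent to `(y, ⟪w, Ju⟫ / ⟪w, u⟫)`. -/
def chart (p : UnitTangentBundle g) : OpenPartialHomeomorph (UnitTangentBundle g) (E2 × ℝ) where
  toFun q := slope p.dir (tmChart p.incl q.incl)
  invFun := chartInv p
  source := {q | q.incl ∈ (tmChart p.incl).source ∧ 0 < inner ℝ (tmChart p.incl q.incl).2 p.dir}
  target := (chartAt E2 p.incl.1).target ×ˢ Set.univ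
  map_source' := by
    rintro q ⟨hq, -⟩
    exact ⟨(mem_tmChart_target _ _).1 ((tmChart p.incl).map_source hq), Set.mem_univ _⟩
  map_target' := by
    rintro z ⟨hz, -⟩
    obtain ⟨c, hc, h⟩ := tmChart_chartInv p z hz
    refine ⟨?_, ?_⟩
    · rw [mem_tmChart_source, incl_chartInv p z hz]
      exact (mem_tmChart_source _ _).1
        ((tmChart p.incl).map_target ((mem_tmChart_target _ _).2 hz))
    · rw [h]
      change 0 < inner ℝ (c • (affineLine p.dir z).2) p.dir
      rw [inner_smul_left, inner_affineLine]
      exact mul_pos hc (real_inner_self_pos.2 p.dir_ne)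
  left_inv' := by
    rintro q ⟨hq, hq'⟩
    have hz : (slope p.dir (tmChart p.incl q.incl)).1 ∈ (chartAt E2 p.incl.1).target :=
      (mem_tmChart_target _ _).1 ((tmChart p.incl).map_source hq)
    refine incl_injective ?_
    have hs : (preInv p (slope p.dir (tmChart p.incl q.incl))) ∈ (tmChart p.incl).source :=
      (tmChart p.incl).map_target ((mem_tmChart_target _ _).2 hz)
    have h0 := tmChart_preInv p _ hz
    rw [affineLine_slope _ _ hq'] at h0
    set c := inner ℝ p.dir p.dir / inner ℝ (tmChart p.incl q.incl).2 p.dir with hcdef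
    have hc : 0 < c := div_pos (real_inner_self_pos.2 p.dir_ne) hq'
    have h1 : preInv p (slope p.dir (tmChart p.incl q.incl)) = ⟨q.incl.1, c • q.incl.2⟩ := by
      refine (tmChart p.incl).injOn hs ((mem_tmChart_source _ _).2
        ((mem_tmChart_source _ _).1 hq)) ?_
      rw [h0, tmChart_smul]
    have h2 : normSq g (⟨q.incl.1, c • q.incl.2⟩ : TangentBundle 𝓘(ℝ, E2) M) = c * c := by
      have := q.normSq_incl
      simp only [normSq] at this
      simp [normSq, this]
    rw [incl_chartInv p _ hz, h1]
    unfold radialProj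
    rw [h2, Real.sqrt_mul_self hc.le]
    simp only [smul_smul, inv_mul_cancel₀ hc.ne', one_smul]
  right_inv' := by
    rintro z ⟨hz, -⟩
    obtain ⟨c, hc, h⟩ := tmChart_chartInv p z hz
    rw [h, slope_smul _ _ _ _ hc.ne']
    exact slope_affineLine _ p.dir_ne z
  open_source := by
    have h1 : ContinuousOn (fun q : UnitTangentBundle g =>
        (inner ℝ (tmChart p.incl q.incl).2 p.dir : ℝ)) (incl ⁻¹' (tmChart p.incl).source) :=
      ((continuous_snd.comp_continuousOn ((tmChart p.incl).continuousOn.comp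
        continuous_incl.continuousOn fun _ h => h)).inner continuousOn_const)
    exact h1.isOpen_inter_preimage ((tmChart p.incl).open_source.preimage continuous_incl)
      isOpen_Ioi
  open_target := (chartAt E2 p.incl.1).open_target.prod isOpen_univ
  continuousOn_toFun := by
    rintro q ⟨hq, hq'⟩
    refine ContinuousAt.continuousWithinAt ?_
    exact ContinuousAt.comp (f := fun q : UnitTangentBundle g => tmChart p.incl q.incl)
      (contDiffAt_slope _ _ hq'.ne').continuousAt
      (ContinuousAt.comp (f := incl) ((tmChart p.incl).continuousAt hq)
        continuous_incl.continuousAt)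
  continuousOn_invFun := by
    rw [(Topology.IsInducing.mk rfl : Topology.IsInducing (incl (g := g))).continuousOn_iff]
    refine ContinuousOn.congr (f := fun z => radialProj g (preInv p z)) ?_
      fun z hz => incl_chartInv p z hz.1
    intro z hz
    refine ContinuousAt.continuousWithinAt ?_
    refine (contMDiffAt_radialProj g _ (normSq_preInv p z hz.1)).continuousAt.comp ?_
    exact ((tmChart p.incl).symm.continuousAt ((mem_tmChart_target _ _).2 hz.1)).comp
      (contDiff_affineLine _).continuous.continuousAt

theorem mem_chart_source (p : UnitTangentBundle g) : p ∈ p.chart.source :=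
  ⟨(mem_tmChart_source _ _).2 (ChartedSpace.mem_chart_source _),
    real_inner_self_pos.2 p.dir_ne⟩

instance : ChartedSpace (E2 × ℝ) (UnitTangentBundle g) where
  atlas := Set.range chart
  chartAt := chart
  mem_chart_source := mem_chart_source
  chart_mem_atlas p := ⟨p, rfl⟩

theorem contDiffOn_tmChart_trans (p q : TangentBundle 𝓘(ℝ, E2) M) :
    ContDiffOn ℝ ∞ (fun z => tmChart q ((tmChart p).symm z))
      ((tmChart p).symm.trans (tmChart q)).source := by
  have h := (𝓘(ℝ, E2).prod 𝓘(ℝ, E2)).contDiffOn_extendCoordChange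
    (IsManifold.chart_mem_maximalAtlas (n := ∞) p) (IsManifold.chart_mem_maximalAtlas (n := ∞) q)
  refine h.mono ?_
  rw [ModelWithCorners.extendCoordChange_source]
  intro z hz
  exact ⟨z, hz, rfl⟩

instance : IsManifold 𝓘(ℝ, E2 × ℝ) ∞ (UnitTangentBundle g) := by
  refine isManifold_of_contDiffOn _ _ _ ?_
  rintro _ _ ⟨p, rfl⟩ ⟨q, rfl⟩
  rintro z ⟨hz, -⟩
  obtain ⟨⟨hz1, -⟩, hz2, hz3⟩ := hz
  change z.1 ∈ (chartAt E2 p.incl.1).target at hz1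
  change (chartInv p z).incl ∈ (tmChart q.incl).source at hz2
  change 0 < inner ℝ (tmChart q.incl (chartInv p z).incl).2 q.dir at hz3
  refine ContDiffAt.contDiffWithinAt ?_
  change ContDiffAt ℝ ∞ (fun z => slope q.dir (tmChart q.incl (chartInv p z).incl)) z
  have hnear : ∀ᶠ z' : E2 × ℝ in 𝓝 z, z'.1 ∈ (chartAt E2 p.incl.1).target :=
    continuous_fst.continuousAt.preimage_mem_nhds ((chartAt E2 p.incl.1).open_target.mem_nhds hz1)
  have key : ∀ z' : E2 × ℝ, z'.1 ∈ (chartAt E2 p.incl.1).target →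
      tmChart q.incl (chartInv p z').incl = ((tmChart q.incl (preInv p z')).1,
        (Real.sqrt (normSq g (preInv p z')))⁻¹ • (tmChart q.incl (preInv p z')).2) := fun z' h => by
    rw [incl_chartInv p z' h, tmChart_radialProj]
  have hne : ∀ z' : E2 × ℝ, z'.1 ∈ (chartAt E2 p.incl.1).target →
      (Real.sqrt (normSq g (preInv p z')))⁻¹ ≠ 0 := fun z' h =>
    inv_ne_zero (Real.sqrt_pos.2 (normSq_preInv p z' h)).ne'
  have hev : (fun z => slope q.dir (tmChart q.incl (chartInv p z).incl)) =ᶠ[𝓝 z]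
      fun z => slope q.dir (tmChart q.incl ((tmChart p.incl).symm (affineLine p.dir z))) := by
    filter_upwards [hnear] with z' h
    rw [key z' h, slope_smul _ _ _ _ (hne z' h)]
    rfl
  refine ContDiffAt.congr_of_eventuallyEq ?_ hev
  have hsrc : affineLine p.dir z ∈ ((tmChart p.incl).symm.trans (tmChart q.incl)).source := by
    refine ⟨(mem_tmChart_target _ _).2 hz1, ?_⟩
    rw [incl_chartInv p z hz1] at hz2
    exact (mem_tmChart_source _ _).2 ((mem_tmChart_source _ _).1 hz2)
  have h1 : ContDiffAt ℝ ∞ (fun z => tmChart q.incl ((tmChart p.incl).symm z))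
      (affineLine p.dir z) := (contDiffOn_tmChart_trans _ _).contDiffAt
    (((tmChart p.incl).symm.trans (tmChart q.incl)).open_source.mem_nhds hsrc)
  have h2 : inner ℝ (tmChart q.incl ((tmChart p.incl).symm (affineLine p.dir z))).2 q.dir
      ≠ (0 : ℝ) := by
    rw [key z hz1] at hz3
    change 0 < inner ℝ (_ • (tmChart q.incl (preInv p z)).2) q.dir at hz3
    rw [inner_smul_left] at hz3
    exact right_ne_zero_of_mul hz3.ne'
  exact (contDiffAt_slope q.dir _ h2).comp z (h1.comp z (contDiff_affineLine _).contDiffAt)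

open Classical in
/-- The radial retraction `TM → SM`, `(x, v) ↦ (x, v / |v|)` (with the arbitrary value `p` on the
zero section). -/
def retract (p : UnitTangentBundle g) (q : TangentBundle 𝓘(ℝ, E2) M) : UnitTangentBundle g :=
  if h : 0 < normSq g q then ⟨radialProj g q, normSq_radialProj g q h⟩ else p

/-- The retraction restricts to the identity on `SM`. -/
theorem retract_incl (p q : UnitTangentBundle g) : retract p q.incl = q := by
  unfold retract
  rw [dif_pos (by rw [q.normSq_incl]; exact one_pos)]
  exact incl_injective (radialProj_of_unit g _ q.normSq_incl)

/-- The derivative of the retraction in the natural coordinates of `TM` and `SM` at `p`. -/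
theorem hasMFDerivAt_retract (p : UnitTangentBundle g) :
    HasMFDerivAt (𝓘(ℝ, E2).prod 𝓘(ℝ, E2)) 𝓘(ℝ, E2 × ℝ) (retract p) p.incl
      (fderiv ℝ (slope p.dir) (tmChart p.incl p.incl)) := by
  have hself : 0 < normSq g p.incl := by rw [p.normSq_incl]; exact one_pos
  have hnear : ∀ᶠ q in 𝓝 p.incl, 0 < normSq g q :=
    (contMDiff_normSq g).continuous.continuousAt.eventually (lt_mem_nhds hself)
  have hs : p.incl ∈ (tmChart p.incl).source :=
    (mem_tmChart_source _ _).2 (ChartedSpace.mem_chart_source _)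
  refine ⟨?_, ?_⟩
  · rw [(Topology.IsInducing.mk rfl : Topology.IsInducing (incl (g := g))).continuousAt_iff]
    refine (contMDiffAt_radialProj g _ hself).continuousAt.congr ?_
    filter_upwards [hnear] with q hq
    simp only [Function.comp, retract, dif_pos hq]
  · have hd : DifferentiableAt ℝ (slope p.dir) (tmChart p.incl p.incl) :=
      (contDiffAt_slope _ _ (real_inner_self_pos.2 p.dir_ne).ne').differentiableAt (by simp)
    have hpt : ∀ z ∈ (tmChart p.incl).target, 0 < normSq g ((tmChart p.incl).symm z) →
        chart (retract p p.incl) (retract p ((tmChart p.incl).symm z)) = slope p.dir z := by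
      intro z hz' hz
      rw [retract_incl]
      change slope p.dir (tmChart p.incl (retract p ((tmChart p.incl).symm z)).incl) = _
      unfold retract
      rw [dif_pos hz, tmChart_radialProj, slope_smul _ _ _ _ (inv_ne_zero (Real.sqrt_pos.2 hz).ne'),
        (tmChart p.incl).right_inv hz']
    have hc : ContinuousAt (tmChart p.incl).symm (tmChart p.incl p.incl) :=
      (tmChart p.incl).symm.continuousAt ((tmChart p.incl).map_source hs)
    have h2 : ∀ᶠ z in 𝓝 (tmChart p.incl p.incl), 0 < normSq g ((tmChart p.incl).symm z) := by
      refine hc.eventually (p := fun q => 0 < normSq g q) ?_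
      rw [(tmChart p.incl).left_inv hs]
      exact hnear
    refine HasFDerivWithinAt.congr_of_eventuallyEq
      (hd.hasFDerivAt.hasFDerivWithinAt (s := Set.range (𝓘(ℝ, E2).prod 𝓘(ℝ, E2)))) ?_ ?_
    · refine Filter.Eventually.filter_mono nhdsWithin_le_nhds ?_
      filter_upwards [h2, (tmChart p.incl).open_target.mem_nhds ((tmChart p.incl).map_source hs)]
        with z hz hz'
      exact hpt z hz' hz
    · exact hpt _ ((tmChart p.incl).map_source hs) (h2.self_of_nhds)

/-- The vector of `T_p SM` given by a vector `ζ ∈ T_p TM` tangent to `SM`. Since `retract p` is the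
identity on `SM`, it is the image of `ζ` under the derivative of `retract p`. -/
def ofTangent (p : UnitTangentBundle g)
    (ζ : TangentSpace (𝓘(ℝ, E2).prod 𝓘(ℝ, E2)) p.incl) : TangentSpace 𝓘(ℝ, E2 × ℝ) p :=
  mfderiv (𝓘(ℝ, E2).prod 𝓘(ℝ, E2)) 𝓘(ℝ, E2 × ℝ) (retract p) p.incl ζ

theorem ofTangent_eq (p : UnitTangentBundle g) (ζ : E2 × E2) :
    p.ofTangent ζ = fderiv ℝ (slope p.dir) (tmChart p.incl p.incl) ζ := by
  unfold ofTangent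
  rw [(hasMFDerivAt_retract p).mfderiv]
  rfl

/-- The foot point in `M` of a unit tangent vector. -/
def base (p : UnitTangentBundle g) : M := p.incl.1

/-- The unit tangent vector itself, an element of `T_x M`. -/
def vec (p : UnitTangentBundle g) : TangentSpace 𝓘(ℝ, E2) p.base := p.incl.2

end UnitTangentBundle

end UnitTangent

section LocalGeometry

variable {M : Type*} [TopologicalSpace M] [ChartedSpace E2 M] [IsManifold 𝓘(ℝ, E2) ∞ M]

/-- The standard basis of the plane. -/
def stdVec (i : Fin 2) : E2 := EuclideanSpace.single i 1

/-- The vector of `T_x M` with components `w` in the preferred chart at `x₀`. -/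
def frameVec (x₀ x : M) (w : E2) : TangentSpace 𝓘(ℝ, E2) x :=
  (trivializationAt E2 (fun x : M => TangentSpace 𝓘(ℝ, E2) x) x₀).symm x w

/-- Partial derivatives in the coordinate plane. -/
def pd (i : Fin 2) (f : E2 → ℝ) (y : E2) : ℝ := fderiv ℝ f y (stdVec i)

/-- The components `g_ij` of the metric in the preferred chart at `x₀`. -/
def gram (g : SurfaceMetric M) (x₀ : M) (y : E2) : Matrix (Fin 2) (Fin 2) ℝ :=
  Matrix.of fun i j => g.inner ((chartAt E2 x₀).symm y)
    (frameVec x₀ _ (stdVec i)) (frameVec x₀ _ (stdVec j))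

/-- The Christoffel symbols `Γ^k_ij` of the Levi-Civita connection in the preferred chart at
`x₀`. -/
def christoffel (g : SurfaceMetric M) (x₀ : M) (k i j : Fin 2) (y : E2) : ℝ :=
  (1 / 2) * ∑ l, (gram g x₀ y)⁻¹ k l *
    (pd i (fun z => gram g x₀ z j l) y + pd j (fun z => gram g x₀ z i l) y
      - pd l (fun z => gram g x₀ z i j) y)

/-- The components of `R(∂₀, ∂₁) ∂₁`, where `R(a, b) c = ∇_a ∇_b c - ∇_b ∇_a c - ∇_[a, b] c`. -/
def curvatureComp (g : SurfaceMetric M) (x₀ : M) (l : Fin 2) (y : E2) : ℝ :=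
  pd 0 (christoffel g x₀ l 1 1) y - pd 1 (christoffel g x₀ l 0 1) y
    + ∑ m, (christoffel g x₀ l 0 m y * christoffel g x₀ m 1 1 y
      - christoffel g x₀ l 1 m y * christoffel g x₀ m 0 1 y)

/-- The Gaussian curvature `K_g = g(R(∂₀, ∂₁) ∂₁, ∂₀) / det (g_ij)`. -/
def gaussCurvature (g : SurfaceMetric M) (x : M) : ℝ :=
  (∑ l, gram g x (chartAt E2 x x) l 0 * curvatureComp g x l (chartAt E2 x x))
    / (gram g x (chartAt E2 x x)).det

/-- Smoothness of a `1`-form on `M`. -/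
def SmoothOneForm (θ : ∀ x : M, TangentSpace 𝓘(ℝ, E2) x →L[ℝ] ℝ) : Prop :=
  ContMDiff 𝓘(ℝ, E2) (𝓘(ℝ, E2).prod 𝓘(ℝ, E2 →L[ℝ] ℝ)) ∞
    (fun x => TotalSpace.mk' (E2 →L[ℝ] ℝ)
      (E := fun x : M => TangentSpace 𝓘(ℝ, E2) x →L[ℝ] ℝ) x (θ x))

/-- The components `θ_j` of a `1`-form in the preferred chart at `x₀`. -/
def formComp (θ : ∀ x : M, TangentSpace 𝓘(ℝ, E2) x →L[ℝ] ℝ) (x₀ : M) (j : Fin 2) (y : E2) : ℝ :=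
  θ ((chartAt E2 x₀).symm y) (frameVec x₀ _ (stdVec j))

/-- The co-differential of a `1`-form, `δ_g θ = - g^ij (∇_i θ)_j`. -/
def codifferential (g : SurfaceMetric M) (θ : ∀ x : M, TangentSpace 𝓘(ℝ, E2) x →L[ℝ] ℝ)
    (x : M) : ℝ :=
  -∑ i, ∑ j, (gram g x (chartAt E2 x x))⁻¹ i j *
    (pd i (formComp θ x j) (chartAt E2 x x)
      - ∑ k, christoffel g x k i j (chartAt E2 x x) * formComp θ x k (chartAt E2 x x))

variable (M) in
/-- An orientation of the surface `M`: an orientation of every tangent plane which is locally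
constant in the natural trivialisations of the tangent bundle. -/
structure SurfaceOrientation where
  orient (x : M) : Orientation ℝ (TangentSpace 𝓘(ℝ, E2) x) (Fin 2)
  locallyConstant (x₀ : M) : ∃ o₀ : Orientation ℝ E2 (Fin 2), ∀ᶠ x in 𝓝 x₀,
    ∀ hx : x ∈ (trivializationAt E2 (fun x : M => TangentSpace 𝓘(ℝ, E2) x) x₀).baseSet,
      Orientation.map (Fin 2)
        ((trivializationAt E2 (fun x : M => TangentSpace 𝓘(ℝ, E2) x) x₀).linearEquivAt ℝ x hx)
        (orient x) = o₀

/-- The rotation `J` by `+π/2` of the oriented Euclidean plane `(T_x M, g_x)`. -/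
def quarterTurn (g : SurfaceMetric M) (o : SurfaceOrientation M) (x : M)
    (v : TangentSpace 𝓘(ℝ, E2) x) : TangentSpace 𝓘(ℝ, E2) x :=
  letI : RiemannianBundle (fun x : M => TangentSpace 𝓘(ℝ, E2) x) := ⟨g.toRiemannianMetric⟩
  haveI : Fact (Module.finrank ℝ (TangentSpace 𝓘(ℝ, E2) x) = 2) :=
    ⟨finrank_euclideanSpace_fin⟩
  (o.orient x).rightAngleRotation v

end LocalGeometry

section Thermostats

variable {M : Type*} [TopologicalSpace M] [ChartedSpace E2 M] [IsManifold 𝓘(ℝ, E2) ∞ M]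
variable (g : SurfaceMetric M) (o : SurfaceOrientation M)

/-- The vector of `T_p TM` with components `(a, b)` in the natural coordinates. -/
def natVec (p : UnitTangentBundle g) (a b : TangentSpace 𝓘(ℝ, E2) p.base) :
    TangentSpace (𝓘(ℝ, E2).prod 𝓘(ℝ, E2)) p.incl :=
  ((a, b) : E2 × E2)

/-- `Γ(a, b) = Γ^k_ij a^i b^j ∂_k` in the preferred chart at `x`, at the point `x`. -/
def christoffelVec (x : M) (a b : TangentSpace 𝓘(ℝ, E2) x) : TangentSpace 𝓘(ℝ, E2) x :=
  (WithLp.toLp 2 fun k => ∑ i, ∑ j,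
    christoffel g x k i j (chartAt E2 x x) * (show E2 from a) i * (show E2 from b) j : E2)

/-- The horizontal lift of `a ∈ T_x M` to the point `(x, v)` of `SM`: the velocity of the curve of
vectors which is parallel along a curve with velocity `a`. -/
def horizontalLift (p : UnitTangentBundle g) (a : TangentSpace 𝓘(ℝ, E2) p.base) :
    TangentSpace 𝓘(ℝ, E2 × ℝ) p :=
  p.ofTangent (natVec g p a (-christoffelVec g p.base a p.vec))

/-- The geodesic vector field `X` on `SM`. -/
def geodesicField (p : UnitTangentBundle g) : TangentSpace 𝓘(ℝ, E2 × ℝ) p :=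
  horizontalLift g p p.vec

/-- The vector field `H` on `SM`: the horizontal lift of `Jv`. -/
def horizontalField (p : UnitTangentBundle g) : TangentSpace 𝓘(ℝ, E2 × ℝ) p :=
  horizontalLift g p (quarterTurn g o p.base p.vec)

/-- The vertical vector field `V` on `SM`, the generator of the rotation
`t ↦ (x, cos t v + sin t Jv)` of the fibres. -/
def verticalField (p : UnitTangentBundle g) : TangentSpace 𝓘(ℝ, E2 × ℝ) p :=
  p.ofTangent (natVec g p 0 (quarterTurn g o p.base p.vec))

variable {g} in
/-- The derivative `F f` of a function `f` on `SM` along a vector field `F`. -/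
def lieDeriv (F : ∀ p : UnitTangentBundle g, TangentSpace 𝓘(ℝ, E2 × ℝ) p)
    (f : UnitTangentBundle g → ℝ) (p : UnitTangentBundle g) : ℝ :=
  mfderiv 𝓘(ℝ, E2 × ℝ) 𝓘(ℝ, ℝ) f p (F p)

/-- The generator `F = X + lam V` of the thermostat flow of `lam`. -/
def thermostat (lam : UnitTangentBundle g → ℝ) (p : UnitTangentBundle g) :
    TangentSpace 𝓘(ℝ, E2 × ℝ) p :=
  geodesicField g p + lam p • verticalField g o p

/-- `κ = K_g - H lam + lam²`. -/
def kappa (lam : UnitTangentBundle g → ℝ) (p : UnitTangentBundle g) : ℝ :=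
  gaussCurvature g p.base - lieDeriv (horizontalField g o) lam p + lam p ^ 2

/-- `𝕂 = κ + F V lam`. -/
def bbK (lam : UnitTangentBundle g → ℝ) (p : UnitTangentBundle g) : ℝ :=
  kappa g o lam p + lieDeriv (thermostat g o lam) (lieDeriv (verticalField g o) lam) p

/-- A `1`-form on `M`, thought of as a function on `SM`. -/
def formFun (θ : ∀ x : M, TangentSpace 𝓘(ℝ, E2) x →L[ℝ] ℝ) (p : UnitTangentBundle g) : ℝ :=
  θ p.base p.vec

/-- The function `lam = - V θ`, which defines the W-flow of `θ`. -/
def wFun (θ : ∀ x : M, TangentSpace 𝓘(ℝ, E2) x →L[ℝ] ℝ) (p : UnitTangentBundle g) : ℝ :=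
  -lieDeriv (verticalField g o) (formFun g θ) p

end Thermostats

section Anosov

variable {E : Type*} [NormedAddCommGroup E] [NormedSpace ℝ E] {H : Type*} [TopologicalSpace H]
  (I : ModelWithCorners ℝ E H) {N : Type*} [TopologicalSpace N] [ChartedSpace H N]

/-- `φ` is the (complete, differentiable) flow of the vector field `F`. -/
structure IsFlowOf (F : ∀ p : N, TangentSpace I p) (φ : ℝ → N → N) : Prop where
  map_zero : ∀ p, φ 0 p = p
  isMIntegralCurve : ∀ p, IsMIntegralCurve (I := I) (fun t => φ t p) F
  mdifferentiable : ∀ t, MDifferentiable I I (φ t)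

/-- A continuous line subbundle of `TN`: locally it is spanned by a nowhere vanishing continuous
vector field. -/
def IsContinuousLineField [IsManifold I 1 N] (L : ∀ p : N, Submodule ℝ (TangentSpace I p)) :
    Prop :=
  ∀ p₀ : N, ∃ U ∈ 𝓝 p₀, ∃ σ : ∀ p : N, TangentSpace I p,
    ContinuousOn (fun p => (⟨p, σ p⟩ : TangentBundle I N)) U ∧
      ∀ p ∈ U, σ p ≠ 0 ∧ L p = Submodule.span ℝ {σ p}

/-- The nowhere vanishing vector field `F` on the closed `3`-manifold `N` generates an Anosov flow:
there is a flow-invariant continuous splitting `TN = ℝF ⊕ E^s ⊕ E^u`, with `E^s` and `E^u` line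
bundles, such that `dφ_t` contracts `E^s` exponentially as `t → ∞` and `E^u` exponentially as
`t → -∞`. As `N` is compact, the metric which measures the contraction does not matter. -/
def IsAnosov [IsManifold I 1 N] (F : ∀ p : N, TangentSpace I p) : Prop :=
  ∃ φ : ℝ → N → N, IsFlowOf I F φ ∧
  ∃ Es Eu : ∀ p : N, Submodule ℝ (TangentSpace I p),
    IsContinuousLineField I Es ∧ IsContinuousLineField I Eu ∧
    (∀ p, F p ≠ 0) ∧
    (∀ p, DirectSum.IsInternal
      (![Submodule.span ℝ {F p}, Es p, Eu p] : Fin 3 → Submodule ℝ (TangentSpace I p))) ∧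
    (∀ t p, (Es p).map (mfderiv I I (φ t) p).toLinearMap = Es (φ t p)) ∧
    (∀ t p, (Eu p).map (mfderiv I I (φ t) p).toLinearMap = Eu (φ t p)) ∧
    ∀ h : ContinuousRiemannianMetric E (fun p : N => TangentSpace I p),
      ∃ C > 0, ∃ μ > 0, ∀ t ≥ 0, ∀ p,
        (∀ ξ ∈ Es p, Real.sqrt (h.inner _ (mfderiv I I (φ t) p ξ) (mfderiv I I (φ t) p ξ)) ≤
          C * Real.exp (-μ * t) * Real.sqrt (h.inner p ξ ξ)) ∧
        (∀ ξ ∈ Eu p, Real.sqrt (h.inner _ (mfderiv I I (φ (-t)) p ξ) (mfderiv I I (φ (-t)) p ξ)) ≤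
          C * Real.exp (-μ * t) * Real.sqrt (h.inner p ξ ξ))

end Anosov

end Thermostat
end

open Thermostat

set_option linter.unusedSectionVars false
set_option maxSynthPendingDepth 3

/-! Everything rests on one linear system. Write the image of a tangent vector under the derivative
of the flow in the frame F, B = H + (Vλ)V, V, with components x, y, w. The structure of the
Levi-Civita connection on a surface gives x' = λ y, y' = (Vλ) y + w, w' = -𝕂 y along the orbit. The
frame is adapted to F, so the plane of (y, w) carries the flow on the quotient TSM/ℝF, and the only
zeroth-order quantity in the last equation is 𝕂.

Put b = -𝕂 > 0. A line w = u y is invariant exactly if u' = b - (Vλ) u - u². For positive u the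
logarithm L = log u satisfies an equation L' = f(L) with f strictly decreasing in L and of opposite
signs at the two ends of a large interval. Such an equation contracts the strip, so over a flow on a
compact space it has a continuous invariant section, the fixed point of a contraction given by an
exponentially weighted average over the past (`exists_continuous_invariant_section`,
`exists_riccati_section`). A second equation of this kind, linear this time, lifts the line from the
quotient to TSM. On the resulting line w' = (b/u) w, and b/u is bounded below by compactness: this
is E^u. Reversing time and replacing V by -V reproduces a system of the same form, with w = -u y for
another positive u, which gives E^s. The two lines lie on opposite sides of w = 0 and are
independent modulo F. This is the abstract criterion `IsFrame.isAnosov`.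

The system itself comes from the Jacobi equation. In natural coordinates of TM the connection is a
bilinear form Γ, the rotation J is parallel, and differentiating the components of a variation along
v, Jv and the fibre gives `LeviCivita.variation`, in which the only curvature term is the Gaussian
curvature. Its transfer to SM needs the flow to be differentiable with derivative solving the
linearised equation (`exists_isSmoothFlow`), and the frame X, H, V to be independent of the chart in
which it is computed (`natVel_ofTangent`, `Adapted.comp_eq`). The change of frame from X, H, V to F,
B, V then turns the Gaussian curvature into 𝕂 (`isAnosov_thermostat`).

For λ = -Vθ one has λ(v) = -θ(Jv) and V²θ = -θ, so Vλ = θ. As J is parallel, Hλ = -(∇θ)(Jv, Jv),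
while F(Vλ) = Fθ = (∇θ)(v, v) - λ². The squares of λ cancel in 𝕂, and what remains is K_g plus the
trace of ∇θ in the orthonormal frame v, Jv (`bbK_wFun`). -/

noncomputable section
namespace Thermostat

/-! ### Local flows in Banach spaces and their derivative in the initial value. -/

section LocalFlow

variable {E : Type*} [NormedAddCommGroup E] [NormedSpace ℝ E]

/-- Two-sided Grönwall inequality. -/
theorem norm_le_gronwallBound_abs {y y' : ℝ → E} {δ K ε T : ℝ}
    (hy : ∀ t, |t| < T → HasDerivAt y (y' t) t) (h0 : ‖y 0‖ ≤ δ)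
    (hb : ∀ t, |t| < T → ‖y' t‖ ≤ K * ‖y t‖ + ε) (t : ℝ) (ht : |t| < T) :
    ‖y t‖ ≤ gronwallBound δ K ε |t| := by
  have key : ∀ (y y' : ℝ → E), (∀ t, |t| < T → HasDerivAt y (y' t) t) → ‖y 0‖ ≤ δ →
      (∀ t, |t| < T → ‖y' t‖ ≤ K * ‖y t‖ + ε) → ∀ t, 0 ≤ t → t < T →
      ‖y t‖ ≤ gronwallBound δ K ε t := by
    intro y y' hy h0 hb t ht0 htT
    have hm : ∀ s ∈ Set.Icc 0 t, |s| < T := fun s hs => by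
      rw [abs_of_nonneg hs.1]; exact hs.2.trans_lt htT
    have := norm_le_gronwallBound_of_norm_deriv_right_le (f := y) (f' := y') (a := 0) (b := t)
      (fun s hs => (hy s (hm s hs)).continuousAt.continuousWithinAt)
      (fun s hs => (hy s (hm s ⟨hs.1, hs.2.le⟩)).hasDerivWithinAt) h0
      (fun s hs => hb s (hm s ⟨hs.1, hs.2.le⟩)) t ⟨ht0, le_rfl⟩
    simpa using this
  rcases le_total 0 t with h | h
  · rw [abs_of_nonneg h] at ht ⊢
    exact key y y' hy h0 hb t h ht
  · rw [abs_of_nonpos h] at ht ⊢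
    have := key (fun s => y (-s)) (fun s => -y' (-s)) (fun s hs => by
      have := (hy (-s) (by rwa [abs_neg])).scomp s (hasDerivAt_neg s)
      simpa [Function.comp_def] using this) (by simpa using h0)
      (fun s hs => by simpa using hb (-s) (by rwa [abs_neg])) (-t) (by linarith) ht
    simpa using this

/-- Along the segment the derivative differs from its value at `x` by at most `K * ‖y - x‖`, so the
mean value inequality yields a quadratic Taylor remainder. -/
theorem norm_image_sub_sub_le_sq {F : Type*} [NormedAddCommGroup F] [NormedSpace ℝ F]
    {f : E → F} {s : Set E} (hs : Convex ℝ s) (hd : ∀ x ∈ s, DifferentiableAt ℝ f x)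
    {K : NNReal} (hl : LipschitzOnWith K (fderiv ℝ f) s) {x y : E} (hx : x ∈ s) (hy : y ∈ s) :
    ‖f y - f x - fderiv ℝ f x (y - x)‖ ≤ K * ‖y - x‖ ^ 2 := by
  have hseg := hs.segment_subset hx hy
  have := (convex_segment (𝕜 := ℝ) x y).norm_image_sub_le_of_norm_hasFDerivWithin_le' (f := f)
    (f' := fderiv ℝ f) (φ := fderiv ℝ f x) (C := K * ‖y - x‖)
    (fun z hz => (hd z (hseg hz)).hasFDerivAt.hasFDerivWithinAt)
    (fun z hz => by
      refine (hl.norm_sub_le (hseg hz) hx).trans ?_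
      gcongr
      obtain ⟨t, ht, rfl⟩ := (segment_eq_image' ℝ x y) ▸ hz
      rw [add_sub_cancel_left, norm_smul, Real.norm_of_nonneg ht.1]
      exact mul_le_of_le_one_left (norm_nonneg _) ht.2)
    (left_mem_segment ℝ x y) (right_mem_segment ℝ x y)
  rw [sq, ← mul_assoc]
  exact this

/-- Solutions of an ODE depend differentiably on the initial value, with the derivative given by
the solution of the linearised equation. -/
theorem hasFDerivAt_of_linearized {f : E → E} {B V : Set E} (hB : Convex ℝ B)
    (hd : ∀ x ∈ B, DifferentiableAt ℝ f x) {K K₁ : NNReal} (hK : 0 < K)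
    (hf : ∀ x ∈ B, ‖fderiv ℝ f x‖ ≤ K) (hl : LipschitzOnWith K₁ (fderiv ℝ f) B)
    {ε : ℝ} {ψ : ℝ → E → E} {A : ℝ → E → E →L[ℝ] E} (h0 : ∀ x ∈ V, ψ 0 x = x)
    (hB' : ∀ x ∈ V, ∀ t, |t| < ε → ψ t x ∈ B)
    (hψ : ∀ x ∈ V, ∀ t, |t| < ε → HasDerivAt (fun t => ψ t x) (f (ψ t x)) t)
    {x : E} (hx : V ∈ 𝓝 x) (hA0 : A 0 x = ContinuousLinearMap.id ℝ E)
    (hA : ∀ t, |t| < ε → HasDerivAt (fun t => A t x) ((fderiv ℝ f (ψ t x)).comp (A t x)) t)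
    {t : ℝ} (ht : |t| < ε) : HasFDerivAt (ψ t) (A t x) x := by
  have hxV := mem_of_mem_nhds hx
  have hlip : ∀ a ∈ B, ∀ b ∈ B, ‖f a - f b‖ ≤ K * ‖a - b‖ := fun a ha b hb =>
    hB.norm_image_sub_le_of_norm_fderiv_le hd hf hb ha
  -- Nearby solutions separate at most exponentially, so the Taylor remainder of `f` along the flow
  -- is quadratic in `‖z - x‖`.
  have hΔ : ∀ z ∈ V, ∀ s, |s| < ε → ‖ψ s z - ψ s x‖ ≤ ‖z - x‖ * Real.exp (K * ε) := by
    intro z hz s hs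
    have := norm_le_gronwallBound_abs (y := fun s => ψ s z - ψ s x)
      (y' := fun s => f (ψ s z) - f (ψ s x)) (δ := ‖z - x‖) (K := K) (ε := 0) (T := ε)
      (fun s hs => (hψ z hz s hs).sub (hψ x hxV s hs)) (by rw [h0 z hz, h0 x hxV])
      (fun s hs => by
        rw [add_zero]; exact hlip _ (hB' z hz s hs) _ (hB' x hxV s hs)) s hs
    rw [gronwallBound_ε0] at this
    refine this.trans ?_
    gcongr
  set C := K₁ * Real.exp (K * ε) ^ 2 * ((K : ℝ)⁻¹ * (Real.exp (K * |t|) - 1)) with hC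
  -- The error of the linear approximation starts at zero and solves the linearised equation up to a
  -- quadratic forcing term, so Grönwall keeps it quadratic.
  have hR : ∀ z ∈ V, ‖ψ t z - ψ t x - A t x (z - x)‖ ≤ C * ‖z - x‖ ^ 2 := by
    intro z hz
    have := norm_le_gronwallBound_abs (y := fun s => ψ s z - ψ s x - A s x (z - x))
      (y' := fun s => f (ψ s z) - f (ψ s x) - ((fderiv ℝ f (ψ s x)).comp (A s x)) (z - x))
      (δ := 0) (K := K) (ε := K₁ * (‖z - x‖ * Real.exp (K * ε)) ^ 2) (T := ε)
      (fun s hs => ((hψ z hz s hs).sub (hψ x hxV s hs)).sub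
        ((hA s hs).clm_apply (hasDerivAt_const s (z - x)) |>.congr_deriv (by simp)))
      (by simp [h0 z hz, h0 x hxV, hA0])
      (fun s hs => by
        have e : f (ψ s z) - f (ψ s x) - ((fderiv ℝ f (ψ s x)).comp (A s x)) (z - x) =
            fderiv ℝ f (ψ s x) (ψ s z - ψ s x - A s x (z - x)) +
            (f (ψ s z) - f (ψ s x) - fderiv ℝ f (ψ s x) (ψ s z - ψ s x)) := by
          simp only [map_sub, ContinuousLinearMap.comp_apply]; abel
        rw [e]
        refine (norm_add_le _ _).trans (add_le_add ?_ ?_)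
        · exact (ContinuousLinearMap.le_opNorm _ _).trans
            (mul_le_mul_of_nonneg_right (hf _ (hB' x hxV s hs)) (norm_nonneg _))
        · refine (norm_image_sub_sub_le_sq hB hd hl (hB' x hxV s hs) (hB' z hz s hs)).trans ?_
          gcongr
          exact hΔ z hz s hs) t ht
    rw [gronwallBound_of_K_ne_0 (by exact_mod_cast hK.ne')] at this
    refine this.trans (le_of_eq ?_)
    rw [hC]
    ring
  refine HasFDerivAt.of_isLittleO ?_
  have h1 : (fun z => ψ t z - ψ t x - A t x (z - x)) =O[𝓝 x] fun z => ‖z - x‖ ^ 2 := by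
    refine Asymptotics.IsBigO.of_bound C ?_
    filter_upwards [hx] with z hz
    simpa using hR z hz
  refine h1.trans_isLittleO ?_
  exact Asymptotics.isLittleO_pow_sub_sub x one_lt_two

/-- The local flow of a `C²` vector field, together with its derivative. -/
theorem exists_local_flow [CompleteSpace E] {f : E → E} {x₀ : E} (hf : ContDiffAt ℝ 2 f x₀)
    {U : Set E} (hU : U ∈ 𝓝 x₀) :
    ∃ ε > 0, ∃ V ∈ 𝓝 x₀, ∃ ψ : ℝ → E → E, ∃ A : ℝ → E → E →L[ℝ] E,
      IsOpen V ∧ (∀ x ∈ V, ψ 0 x = x ∧ A 0 x = ContinuousLinearMap.id ℝ E) ∧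
      ContinuousOn (fun z : ℝ × E => ψ z.1 z.2) (Set.Ioo (-ε) ε ×ˢ V) ∧
      ∀ x ∈ V, ∀ t, |t| < ε → ψ t x ∈ U ∧ HasDerivAt (fun t => ψ t x) (f (ψ t x)) t ∧
        HasFDerivAt (ψ t) (A t x) x ∧
        HasDerivAt (fun t => A t x) ((fderiv ℝ f (ψ t x)).comp (A t x)) t := by
  have hf' : ContDiffAt ℝ 1 (fderiv ℝ f) x₀ := hf.fderiv_right (by norm_num)
  -- The vector field is coupled with its linearisation: one application of Picard–Lindelöf, with
  -- initial value `(x, id)`, produces both the solution and the candidate for its derivative. This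
  -- is where two derivatives of `f` are spent.
  set F : E × (E →L[ℝ] E) → E × (E →L[ℝ] E) := fun z => (f z.1, (fderiv ℝ f z.1).comp z.2)
  have hF : ContDiffAt ℝ 1 F (x₀, ContinuousLinearMap.id ℝ E) := by
    refine ContDiffAt.prodMk ((hf.of_le (by norm_num)).comp _ contDiffAt_fst) ?_
    exact (hf'.comp (x₀, ContinuousLinearMap.id ℝ E) contDiffAt_fst).clm_comp contDiffAt_snd
  obtain ⟨ε, hε, a, r, L, K, hr, hpl⟩ := IsPicardLindelof.of_contDiffAt_one hF
  obtain ⟨α, hα, hαc⟩ := (hpl 0).exists_forall_mem_closedBall_eq_hasDerivWithinAt_continuousOn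
  simp only [zero_sub, zero_add] at hα hαc
  obtain ⟨K₁, s₁, hs₁, hl⟩ := hf'.exists_lipschitzOnWith
  have hd : ∀ᶠ x in 𝓝 x₀, DifferentiableAt ℝ f x :=
    (hf.eventually (by simp)).mono fun x hx => hx.differentiableAt (by norm_num)
  have hbd : ∀ᶠ x in 𝓝 x₀, ‖fderiv ℝ f x‖ < ‖fderiv ℝ f x₀‖ + 1 :=
    hf'.continuousAt.norm.eventually (gt_mem_nhds (by linarith))
  obtain ⟨δ, hδ, hball⟩ := Metric.mem_nhds_iff.1 (Filter.inter_mem (Filter.inter_mem hU hs₁)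
    (Filter.inter_mem hd hbd))
  have hz : ((x₀, ContinuousLinearMap.id ℝ E) : E × (E →L[ℝ] E)) ∈
      Metric.closedBall (x₀, ContinuousLinearMap.id ℝ E) (r : ℝ) :=
    Metric.mem_closedBall_self r.2
  have hα0 := (hα _ hz).1
  have hca : ContinuousAt α ((x₀, ContinuousLinearMap.id ℝ E), 0) :=
    hαc.continuousAt (prod_mem_nhds (Metric.closedBall_mem_nhds _ (by exact_mod_cast hr))
      (Icc_mem_nhds (by linarith) (by linarith)))
  have hc2 : ContinuousAt (fun z : E × ℝ => (α ((z.1, ContinuousLinearMap.id ℝ E), z.2)).1)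
      (x₀, 0) := by
    have : ContinuousAt (fun z : E × ℝ => (((z.1, ContinuousLinearMap.id ℝ E), z.2) :
        (E × (E →L[ℝ] E)) × ℝ)) (x₀, 0) := by fun_prop
    exact (ContinuousAt.comp (f := fun z : E × ℝ => (((z.1, ContinuousLinearMap.id ℝ E), z.2) :
        (E × (E →L[ℝ] E)) × ℝ)) hca this).fst
  have hpre := hc2.preimage_mem_nhds (t := Metric.ball x₀ δ) (by
    rw [hα0]; exact Metric.ball_mem_nhds _ hδ)
  obtain ⟨V₁, hV₁, T₁, hT₁, hVT⟩ := mem_nhds_prod_iff.1 hpre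
  obtain ⟨η, hη, hηT⟩ := Metric.mem_nhds_iff.1 hT₁
  obtain ⟨V, hVsub, hVo, hxV⟩ := mem_nhds_iff.1
    (Filter.inter_mem hV₁ (Metric.ball_mem_nhds x₀ (show (0 : ℝ) < r from hr)))
  set e := min ε η
  have he : 0 < e := lt_min hε hη
  have hin : ∀ x ∈ V, ((x, ContinuousLinearMap.id ℝ E) : E × (E →L[ℝ] E)) ∈
      Metric.closedBall (x₀, ContinuousLinearMap.id ℝ E) (r : ℝ) := by
    intro x hx
    have := (hVsub hx).2
    rw [Metric.mem_closedBall, Prod.dist_eq]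
    simpa using (Metric.mem_ball.1 this).le
  have hIcc : ∀ t, |t| < e → t ∈ Set.Ioo (-ε) ε := fun t ht =>
    abs_lt.1 (ht.trans_le (min_le_left _ _))
  have hder : ∀ x ∈ V, ∀ t, |t| < e → HasDerivAt (fun t => α ((x, ContinuousLinearMap.id ℝ E), t))
      (F (α ((x, ContinuousLinearMap.id ℝ E), t))) t := fun x hx t ht =>
    ((hα _ (hin x hx)).2 t (Set.Ioo_subset_Icc_self (hIcc t ht))).hasDerivAt
      (Icc_mem_nhds (hIcc t ht).1 (hIcc t ht).2)
  have hmem : ∀ x ∈ V, ∀ t, |t| < e → (α ((x, ContinuousLinearMap.id ℝ E), t)).1 ∈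
      Metric.ball x₀ δ := fun x hx t ht => hVT (Set.mk_mem_prod (hVsub hx).1 (hηT (by
        rw [Metric.mem_ball, dist_zero_right, Real.norm_eq_abs]
        exact ht.trans_le (min_le_right _ _))))
  have hψ : ∀ x ∈ V, ∀ t, |t| < e → HasDerivAt
      (fun t => (α ((x, ContinuousLinearMap.id ℝ E), t)).1)
      (f (α ((x, ContinuousLinearMap.id ℝ E), t)).1) t := fun x hx t ht => (hder x hx t ht).fst
  have hA : ∀ x ∈ V, ∀ t, |t| < e → HasDerivAt
      (fun t => (α ((x, ContinuousLinearMap.id ℝ E), t)).2)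
      ((fderiv ℝ f (α ((x, ContinuousLinearMap.id ℝ E), t)).1).comp
        (α ((x, ContinuousLinearMap.id ℝ E), t)).2) t := fun x hx t ht => (hder x hx t ht).snd
  refine ⟨e, he, V, hVo.mem_nhds hxV, fun t x => (α ((x, ContinuousLinearMap.id ℝ E), t)).1,
    fun t x => (α ((x, ContinuousLinearMap.id ℝ E), t)).2, hVo, ?_, ?_, ?_⟩
  · intro x hx
    have := (hα _ (hin x hx)).1
    simp only [this, and_self]
  · refine continuous_fst.comp_continuousOn (hαc.comp (f := fun z : ℝ × E =>
      (((z.2, ContinuousLinearMap.id ℝ E), z.1) : (E × (E →L[ℝ] E)) × ℝ)) (by fun_prop) ?_)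
    rintro ⟨t, x⟩ ⟨ht, hx⟩
    exact ⟨hin x hx, Set.Ioo_subset_Icc_self (hIcc t (abs_lt.2 ht))⟩
  · intro x hx t ht
    refine ⟨(hball (hmem x hx t ht)).1.1, hψ x hx t ht, ?_, hA x hx t ht⟩
    -- On the ball the derivative is bounded by its value at the centre plus one, which also makes
    -- the constant positive.
    refine hasFDerivAt_of_linearized (K := ‖fderiv ℝ f x₀‖₊ + 1) (K₁ := K₁)
      (B := Metric.ball x₀ δ) (V := V) (ε := e)
      (ψ := fun t x => (α ((x, ContinuousLinearMap.id ℝ E), t)).1)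
      (A := fun t x => (α ((x, ContinuousLinearMap.id ℝ E), t)).2)
      (convex_ball _ _) (fun z hz => (hball hz).2.1)
      (by positivity)
      (fun z hz => (hball hz).2.2.le) (hl.mono fun z hz => (hball hz).1.2)
      (fun x hx => ?_) hmem hψ (hVo.mem_nhds hx) ?_ (hA x hx) ht
    · have := (hα _ (hin x hx)).1
      simp only [this]
    · have := (hα _ (hin x hx)).1
      simp only [this]

end LocalFlow

end Thermostat
end

noncomputable section
namespace Thermostat

theorem two_le_infty : (2 : WithTop ℕ∞) ≤ ∞ :=
  WithTop.coe_le_coe.2 (le_top (a := (2 : ℕ∞)))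

/-! ### Vector fields and local flows on manifolds, in charts. -/

section ManifoldFlow

variable {E : Type*} [NormedAddCommGroup E] [NormedSpace ℝ E]
  {N : Type*} [TopologicalSpace N] [ChartedSpace E N] [IsManifold 𝓘(ℝ, E) ∞ N]

theorem hasMFDerivAt_chartAt (p : N) {q : N} (hq : q ∈ (chartAt E p).source) :
    HasMFDerivAt 𝓘(ℝ, E) 𝓘(ℝ, E) (chartAt E p) q
      (mfderiv 𝓘(ℝ, E) 𝓘(ℝ, E) (chartAt E p) q) :=
  (mdifferentiableAt_atlas (chart_mem_atlas E p) hq).hasMFDerivAt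

theorem hasMFDerivAt_chartAt_symm (p : N) {z : E} (hz : z ∈ (chartAt E p).target) :
    HasMFDerivAt 𝓘(ℝ, E) 𝓘(ℝ, E) (chartAt E p).symm z
      (mfderiv 𝓘(ℝ, E) 𝓘(ℝ, E) (chartAt E p).symm z) :=
  (mdifferentiableAt_atlas_symm (chart_mem_atlas E p) hz).hasMFDerivAt

/-- The derivative of a map to a vector space, computed in the chart at `p`. -/
theorem mfderiv_eq_fderiv_chartAt {E' : Type*} [NormedAddCommGroup E'] [NormedSpace ℝ E']
    {f : N → E'} (p : N) {q : N} (hq : q ∈ (chartAt E p).source)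
    (hf : DifferentiableAt ℝ (f ∘ (chartAt E p).symm) (chartAt E p q)) :
    HasMFDerivAt 𝓘(ℝ, E) 𝓘(ℝ, E') f q
      ((fderiv ℝ (f ∘ (chartAt E p).symm) (chartAt E p q)).comp
        (mfderiv 𝓘(ℝ, E) 𝓘(ℝ, E) (chartAt E p) q)) := by
  have h := hf.hasFDerivAt.hasMFDerivAt.comp q (hasMFDerivAt_chartAt p hq)
  refine h.congr_of_eventuallyEq ?_
  filter_upwards [(chartAt E p).open_source.mem_nhds hq] with x hx
  simp only [Function.comp_apply, (chartAt E p).left_inv hx]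

theorem contDiffAt_comp_chartAt_symm {E' : Type*} [NormedAddCommGroup E'] [NormedSpace ℝ E']
    {f : N → E'} (p : N) {q : N} (hq : q ∈ (chartAt E p).source) {n : ℕ∞}
    (hf : ContMDiffAt 𝓘(ℝ, E) 𝓘(ℝ, E') n f q) :
    ContDiffAt ℝ n (f ∘ (chartAt E p).symm) (chartAt E p q) := by
  rw [← contMDiffAt_iff_contDiffAt]
  have h1 : ContMDiffAt 𝓘(ℝ, E) 𝓘(ℝ, E) n (chartAt E p).symm (chartAt E p q) :=
    haveI : IsManifold 𝓘(ℝ, E) n N := .of_le (n := ∞) (by exact_mod_cast le_top)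
    contMDiffAt_symm_of_mem_maximalAtlas (IsManifold.chart_mem_maximalAtlas p)
      ((chartAt E p).map_source hq)
  refine ContMDiffAt.comp _ ?_ h1
  rwa [(chartAt E p).left_inv hq]

/-- A vector field, written in the chart at `p`. -/
def chartField (F : ∀ p : N, TangentSpace 𝓘(ℝ, E) p) (p : N) (z : E) : E :=
  mfderiv 𝓘(ℝ, E) 𝓘(ℝ, E) (chartAt E p) ((chartAt E p).symm z) (F ((chartAt E p).symm z))

theorem chartField_apply (F : ∀ p : N, TangentSpace 𝓘(ℝ, E) p) (p : N) {q : N}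
    (hq : q ∈ (chartAt E p).source) : chartField F p (chartAt E p q) =
      mfderiv 𝓘(ℝ, E) 𝓘(ℝ, E) (chartAt E p) q (F q) := by
  unfold chartField
  rw [(chartAt E p).left_inv hq]

theorem mfderiv_extChartAt_eq (p q : N) :
    mfderiv 𝓘(ℝ, E) 𝓘(ℝ, E) (extChartAt 𝓘(ℝ, E) p) q =
      mfderiv 𝓘(ℝ, E) 𝓘(ℝ, E) (chartAt E p) q := rfl

/-- The trivialisation of the tangent bundle at `p` is the derivative of the chart at `p`.
Smoothness of a vector field can therefore be tested on its components `mfderiv (chartAt E p)`. -/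
theorem trivializationAt_tangent_snd (p : N) {q : N}
    (hq : q ∈ (chartAt E p).source) (w : TangentSpace 𝓘(ℝ, E) q) :
    (trivializationAt E (TangentSpace 𝓘(ℝ, E)) p ⟨q, w⟩).2 =
      mfderiv 𝓘(ℝ, E) 𝓘(ℝ, E) (chartAt E p) q w := by
  rw [← mfderiv_extChartAt_eq, ← TangentBundle.continuousLinearMapAt_trivializationAt hq]
  symm
  refine (congrFun (Trivialization.coe_linearMapAt_of_mem (R := ℝ)
    (trivializationAt E (TangentSpace 𝓘(ℝ, E) : N → Type _) p) (b := q) hq) w)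

theorem contMDiffAt_section_iff (F : ∀ p : N, TangentSpace 𝓘(ℝ, E) p)
    (p : N) {q : N} (hq : q ∈ (chartAt E p).source) :
    ContMDiffAt 𝓘(ℝ, E) 𝓘(ℝ, E).tangent ∞ (fun p => (⟨p, F p⟩ : TangentBundle 𝓘(ℝ, E) N)) q ↔
      ContMDiffAt 𝓘(ℝ, E) 𝓘(ℝ, E) ∞
        (fun x => (mfderiv 𝓘(ℝ, E) 𝓘(ℝ, E) (chartAt E p) x (F x) : E)) q := by
  have h := (trivializationAt E (TangentSpace 𝓘(ℝ, E) : N → Type _) p).contMDiffAt_section_iff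
    (IB := 𝓘(ℝ, E)) (n := ∞) (s := F) (x₀ := q) hq
  refine h.trans (Filter.EventuallyEq.contMDiffAt_iff ?_)
  filter_upwards [(chartAt E p).open_source.mem_nhds hq] with x hx
  exact trivializationAt_tangent_snd p hx (F x)

theorem contDiffAt_chartField {F : ∀ p : N, TangentSpace 𝓘(ℝ, E) p}
    (hF : ContMDiff 𝓘(ℝ, E) 𝓘(ℝ, E).tangent ∞ (fun p => (⟨p, F p⟩ : TangentBundle 𝓘(ℝ, E) N)))
    (p : N) {z : E} (hz : z ∈ (chartAt E p).target) : ContDiffAt ℝ ∞ (chartField F p) z := by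
  have h := (contMDiffAt_section_iff F p ((chartAt E p).map_target hz)).1 (hF _)
  have := contDiffAt_comp_chartAt_symm p ((chartAt E p).map_target hz) (n := ⊤) h
  rwa [(chartAt E p).right_inv hz] at this

theorem mfderiv_chartAt_symm_chartField
    (F : ∀ p : N, TangentSpace 𝓘(ℝ, E) p) (p : N)
    {z : E} (hz : z ∈ (chartAt E p).target) :
    mfderiv 𝓘(ℝ, E) 𝓘(ℝ, E) (chartAt E p).symm z (chartField (E := E) F p z) =
      F ((chartAt E p).symm z) := by
  obtain ⟨q, hq, rfl⟩ : ∃ q ∈ (chartAt E p).source, chartAt E p q = z :=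
    ⟨_, (chartAt E p).map_target hz, (chartAt E p).right_inv hz⟩
  have h := DFunLike.congr_fun
    ((mdifferentiable_chart (I := 𝓘(ℝ, E)) p).symm_comp_deriv hq) (F q)
  have h3 : ∀ q', q' = q → (F q' : E) = F q := by rintro _ rfl; rfl
  refine (congrArg (mfderiv 𝓘(ℝ, E) 𝓘(ℝ, E) (chartAt E p).symm (chartAt E p q))
    (chartField_apply F p hq)).trans (Eq.trans h ?_)
  exact (h3 _ ((chartAt E p).left_inv hq)).symm

theorem hasMFDerivAt_chartAt_symm_comp
    {F : ∀ p : N, TangentSpace 𝓘(ℝ, E) p} (p : N)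
    {c : ℝ → E} {t : ℝ} (hc : HasDerivAt c (chartField F p (c t)) t)
    (ht : c t ∈ (chartAt E p).target) :
    HasMFDerivAt 𝓘(ℝ, ℝ) 𝓘(ℝ, E) (fun t => (chartAt E p).symm (c t)) t
      ((1 : ℝ →L[ℝ] ℝ).smulRight (F ((chartAt E p).symm (c t)))) := by
  have h := (hasMFDerivAt_chartAt_symm p ht).comp t hc.hasFDerivAt.hasMFDerivAt
  refine h.congr_mfderiv ?_
  refine ContinuousLinearMap.ext_ring ?_
  have := mfderiv_chartAt_symm_chartField F p ht
  refine Eq.trans ?_ (this.trans ?_)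
  · refine congrArg (mfderiv 𝓘(ℝ, E) 𝓘(ℝ, E) (chartAt E p).symm (c t)) ?_
    exact ContinuousLinearMap.toSpanSingleton_apply_one ℝ (chartField F p (c t))
  · exact (one_smul ℝ (F ((chartAt E p).symm (c t)))).symm

/-- The local flow near `p` of a smooth vector field on a manifold. The last clause is the
linearised equation, tested against functions on the manifold. -/
theorem exists_local_flow_manifold [CompleteSpace E]
    {F : ∀ p : N, TangentSpace 𝓘(ℝ, E) p}
    (hF : ContMDiff 𝓘(ℝ, E) 𝓘(ℝ, E).tangent ∞ (fun p => (⟨p, F p⟩ : TangentBundle 𝓘(ℝ, E) N)))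
    (p : N) :
    ∃ ε > 0, ∃ V : Set N, IsOpen V ∧ p ∈ V ∧ ∃ Φ : ℝ → N → N,
      ContinuousOn (fun z : ℝ × N => Φ z.1 z.2) (Set.Ioo (-ε) ε ×ˢ V) ∧
      (∀ q ∈ V, Φ 0 q = q ∧ IsMIntegralCurveOn (fun t => Φ t q) F (Set.Ioo (-ε) ε)) ∧
      (∀ q ∈ V, ∀ t, |t| < ε → MDifferentiableAt 𝓘(ℝ, E) 𝓘(ℝ, E) (Φ t) q) ∧
      ∀ (E' : Type) [NormedAddCommGroup E'] [NormedSpace ℝ E'] (f : N → E'),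
        ContMDiffAt 𝓘(ℝ, E) 𝓘(ℝ, E') ∞ f p → ∀ ξ : TangentSpace 𝓘(ℝ, E) p,
        HasDerivAt (fun s => (mfderiv 𝓘(ℝ, E) 𝓘(ℝ, E') f (Φ s p)
            (mfderiv 𝓘(ℝ, E) 𝓘(ℝ, E) (Φ s) p ξ) : E'))
          (mfderiv 𝓘(ℝ, E) 𝓘(ℝ, E') (fun q => (mfderiv 𝓘(ℝ, E) 𝓘(ℝ, E') f q (F q) : E')) p ξ)
          0 := by
  set e := chartAt E p
  have hp : p ∈ e.source := mem_chart_source E p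
  have hz₀ : e p ∈ e.target := e.map_source hp
  have hF2 := contDiffAt_chartField hF p hz₀
  obtain ⟨ε, hε, V, hV, ψ, A, hVo, h0, hψc, hψ⟩ := exists_local_flow (f := chartField F p)
    (x₀ := e p) (hF2.of_le two_le_infty) (e.open_target.mem_nhds hz₀)
  have hW : IsOpen (e.source ∩ e ⁻¹' V) := e.isOpen_inter_preimage hVo
  refine ⟨ε, hε, e.source ∩ e ⁻¹' V, hW, ⟨hp, show e p ∈ V from mem_of_mem_nhds hV⟩,
    fun t q => e.symm (ψ t (e q)), ?_, ?_, ?_, ?_⟩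
  · refine e.continuousOn_symm.comp (hψc.comp (f := fun z : ℝ × N => (z.1, e z.2)) ?_ ?_) ?_
    · exact continuousOn_fst.prodMk (e.continuousOn.comp continuousOn_snd fun z hz => hz.2.1)
    · exact fun z hz => ⟨hz.1, hz.2.2⟩
    · exact fun z hz => (hψ _ hz.2.2 _ (abs_lt.2 hz.1)).1
  · intro q hq
    refine ⟨by beta_reduce; rw [(h0 _ hq.2).1, e.left_inv hq.1], fun t ht => ?_⟩
    have h := hψ _ hq.2 t (abs_lt.2 ht)
    exact (hasMFDerivAt_chartAt_symm_comp p h.2.1 h.1).hasMFDerivWithinAt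
  · intro q hq t ht
    have h := hψ _ hq.2 t ht
    exact (((hasMFDerivAt_chartAt_symm p h.1).comp (e q) h.2.2.1.hasMFDerivAt).comp q
      (hasMFDerivAt_chartAt p hq.1)).mdifferentiableAt
  · intro E' _ _ f hf ξ
    set g : E → E' := f ∘ e.symm
    have hg : ContDiffAt ℝ ∞ g (e p) := contDiffAt_comp_chartAt_symm p hp (n := ⊤) hf
    set η : E := mfderiv 𝓘(ℝ, E) 𝓘(ℝ, E) e p ξ
    have hgd : ∀ᶠ z in 𝓝 (e p), DifferentiableAt ℝ g z := by
      have := (hg.of_le (m := 1) (by exact_mod_cast le_top)).eventually (by simp)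
      exact this.mono fun z hz => hz.differentiableAt (by simp)
    have hg' : DifferentiableAt ℝ (fderiv ℝ g) (e p) :=
      (hg.fderiv_right (m := 1) (by norm_num; exact two_le_infty)).differentiableAt (by simp)
    have hpV := mem_of_mem_nhds hV
    have hψ0 := (hψ _ hpV 0 (by simpa using hε))
    have hcurve : ContinuousAt (fun s => ψ s (e p)) 0 := hψ0.2.1.continuousAt
    have hA0 := (h0 _ hpV).2
    have hFd : DifferentiableAt ℝ (chartField F p) (e p) := hF2.differentiableAt (by simp)
    -- At time zero the derivative has two terms: the second derivative of `g` in the direction of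
    -- the field, from the moving base point, and the first derivative applied to `DF η`, from the
    -- linearised equation.
    have h1 : HasDerivAt (fun s => fderiv ℝ g (ψ s (e p)) (A s (e p) η))
        (fderiv ℝ (fderiv ℝ g) (e p) (chartField F p (e p)) η +
          fderiv ℝ g (e p) (fderiv ℝ (chartField F p) (e p) η)) 0 := by
      have ha : HasDerivAt (fun s => fderiv ℝ g (ψ s (e p)))
          (fderiv ℝ (fderiv ℝ g) (e p) (chartField F p (e p))) 0 := by
        have := hψ0.2.1
        rw [(h0 _ hpV).1] at this
        refine HasFDerivAt.comp_hasDerivAt (l := fderiv ℝ g) 0 ?_ this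
        rw [(h0 _ hpV).1]
        exact hg'.hasFDerivAt
      have hb := hψ0.2.2.2
      rw [hA0, (h0 _ hpV).1] at hb
      have := ha.clm_apply (hb.clm_apply (hasDerivAt_const (0 : ℝ) η))
      simpa [hA0, (h0 _ hpV).1] using this
    have hev : (fun s => (mfderiv 𝓘(ℝ, E) 𝓘(ℝ, E') f (e.symm (ψ s (e p)))
        (mfderiv 𝓘(ℝ, E) 𝓘(ℝ, E) (fun q => e.symm (ψ s (e q))) p ξ) : E')) =ᶠ[𝓝 0]
        fun s => fderiv ℝ g (ψ s (e p)) (A s (e p) η) := by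
      have hh : ∀ᶠ s in 𝓝 (0 : ℝ), DifferentiableAt ℝ g (ψ s (e p)) := by
        refine hcurve.eventually ?_
        beta_reduce
        rwa [(h0 _ hpV).1]
      filter_upwards [hh, Metric.ball_mem_nhds (0 : ℝ) hε] with s hs hsε
      rw [Metric.mem_ball, dist_zero_right, Real.norm_eq_abs] at hsε
      have h := hψ _ hpV s hsε
      have hsrc : e.symm (ψ s (e p)) ∈ e.source := e.map_target h.1
      have hff : HasMFDerivAt 𝓘(ℝ, E) 𝓘(ℝ, E') f (e.symm (ψ s (e p))) _ :=
        mfderiv_eq_fderiv_chartAt p hsrc (by rw [e.right_inv h.1]; exact hs)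
      have hmd : MDifferentiableAt 𝓘(ℝ, E) 𝓘(ℝ, E) (fun q => e.symm (ψ s (e q))) p :=
        (((hasMFDerivAt_chartAt_symm p h.1).comp (e p) h.2.2.1.hasMFDerivAt).comp p
          (hasMFDerivAt_chartAt p hp)).mdifferentiableAt
      rw [← mfderiv_comp_apply (f := fun q => e.symm (ψ s (e q))) p hff.mdifferentiableAt hmd]
      have hcomp : HasMFDerivAt 𝓘(ℝ, E) 𝓘(ℝ, E') (f ∘ fun q => e.symm (ψ s (e q))) p _ :=
        (hs.hasFDerivAt.comp (e p) h.2.2.1).hasMFDerivAt.comp p (hasMFDerivAt_chartAt p hp)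
      rw [hcomp.mfderiv]
      rfl
    -- Differentiating the function `F f` in the direction `ξ` gives the same two terms with the
    -- arguments of the second derivative exchanged; its symmetry identifies them.
    have hrhs : (mfderiv 𝓘(ℝ, E) 𝓘(ℝ, E')
        (fun q => (mfderiv 𝓘(ℝ, E) 𝓘(ℝ, E') f q (F q) : E')) p ξ : E') =
        fderiv ℝ (fderiv ℝ g) (e p) (chartField F p (e p)) η +
          fderiv ℝ g (e p) (fderiv ℝ (chartField F p) (e p) η) := by
      have hd : HasFDerivAt (fun z => fderiv ℝ g z (chartField F p z)) _ (e p) :=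
        hg'.hasFDerivAt.clm_apply hFd.hasFDerivAt
      have hd' := hd.hasMFDerivAt.comp p (hasMFDerivAt_chartAt p hp)
      have hsym : IsSymmSndFDerivAt ℝ g (e p) := hg.isSymmSndFDerivAt (by simpa using two_le_infty)
      have heq : (fun q => (mfderiv 𝓘(ℝ, E) 𝓘(ℝ, E') f q (F q) : E')) =ᶠ[𝓝 p]
          (fun z => fderiv ℝ g z (chartField F p z)) ∘ e := by
        filter_upwards [e.open_source.mem_nhds hp,
          (e.continuousAt hp).eventually hgd] with q hq hgq
        rw [(mfderiv_eq_fderiv_chartAt p hq hgq).mfderiv]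
        simp only [Function.comp_apply]
        rw [chartField_apply F p hq]
        rfl
      rw [(hd'.congr_of_eventuallyEq heq).mfderiv]
      rw [hsym.eq, add_comm]
      rfl
    rw [hrhs]
    exact h1.congr_of_eventuallyEq hev

end ManifoldFlow

end Thermostat
end

noncomputable section
namespace Thermostat

/-! ### The global flow on a closed manifold. -/

section ManifoldFlow

variable {E : Type*} [NormedAddCommGroup E] [NormedSpace ℝ E]
  {N : Type*} [TopologicalSpace N] [ChartedSpace E N] [IsManifold 𝓘(ℝ, E) ∞ N]

/-- The flow of a vector field, with all the regularity that is needed: a continuous action of `ℝ`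
by differentiable maps, whose derivative solves the linearised equation. -/
structure IsSmoothFlow (F : ∀ p : N, TangentSpace 𝓘(ℝ, E) p) (φ : ℝ → N → N) : Prop where
  isFlowOf : IsFlowOf 𝓘(ℝ, E) F φ
  map_add : ∀ s t p, φ (s + t) p = φ s (φ t p)
  continuous : Continuous fun z : ℝ × N => φ z.1 z.2
  linearized : ∀ (E' : Type) [NormedAddCommGroup E'] [NormedSpace ℝ E'] (p : N) (f : N → E'),
    ContMDiffAt 𝓘(ℝ, E) 𝓘(ℝ, E') ∞ f p → ∀ ξ : TangentSpace 𝓘(ℝ, E) p,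
    HasDerivAt (fun s => (mfderiv 𝓘(ℝ, E) 𝓘(ℝ, E') f (φ s p)
      (mfderiv 𝓘(ℝ, E) 𝓘(ℝ, E) (φ s) p ξ) : E'))
    (mfderiv 𝓘(ℝ, E) 𝓘(ℝ, E') (fun q => (mfderiv 𝓘(ℝ, E) 𝓘(ℝ, E') f q (F q) : E')) p ξ) 0

variable [CompleteSpace E] [T2Space N] [CompactSpace N]
  {F : ∀ p : N, TangentSpace 𝓘(ℝ, E) p}

/-- A smooth vector field on a closed manifold has a global flow. -/
theorem exists_isSmoothFlow
    (hF : ContMDiff 𝓘(ℝ, E) 𝓘(ℝ, E).tangent ∞ (fun p => (⟨p, F p⟩ : TangentBundle 𝓘(ℝ, E) N))) :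
    ∃ φ : ℝ → N → N, IsSmoothFlow F φ := by
  have hF1 : ContMDiff 𝓘(ℝ, E) 𝓘(ℝ, E).tangent 1
    (fun p => (⟨p, F p⟩ : TangentBundle 𝓘(ℝ, E) N)) := hF.of_le (by simp)
  have loc := exists_local_flow_manifold hF
  -- Compactness makes the time of existence uniform, and a uniform time lets integral curves be
  -- continued for ever.
  obtain ⟨ε, hε, hcurve⟩ : ∃ ε > 0, ∀ q : N, ∃ γ : ℝ → N, γ 0 = q ∧
      IsMIntegralCurveOn γ F (Set.Ioo (-ε) ε) := by
    have := isCompact_univ.induction_on (p := fun S : Set N => ∃ ε > 0, ∀ q ∈ S, ∃ γ : ℝ → N,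
      γ 0 = q ∧ IsMIntegralCurveOn γ F (Set.Ioo (-ε) ε)) ⟨1, one_pos, by simp⟩
      (fun S T hST ⟨ε, hε, h⟩ => ⟨ε, hε, fun q hq => h q (hST hq)⟩)
      (fun S T ⟨ε, hε, h⟩ ⟨ε', hε', h'⟩ => ⟨min ε ε', lt_min hε hε', by
        rintro q (hq | hq)
        · obtain ⟨γ, h0, hγ⟩ := h q hq
          exact ⟨γ, h0, hγ.mono (Set.Ioo_subset_Ioo (neg_le_neg (min_le_left _ _))
            (min_le_left _ _))⟩
        · obtain ⟨γ, h0, hγ⟩ := h' q hq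
          exact ⟨γ, h0, hγ.mono (Set.Ioo_subset_Ioo (neg_le_neg (min_le_right _ _))
            (min_le_right _ _))⟩⟩)
      (fun p _ => by
        obtain ⟨ε, hε, V, hV, hp, Φ, -, h, -⟩ := loc p
        exact ⟨V, mem_nhdsWithin_of_mem_nhds (hV.mem_nhds hp), ε, hε,
          fun q hq => ⟨fun t => Φ t q, h q hq⟩⟩)
    simpa using this
  choose γ hγ0 hγ using fun q => exists_isMIntegralCurve_of_isMIntegralCurveOn hF1 hε hcurve q
  set φ : ℝ → N → N := fun t q => γ q t
  -- The group law is uniqueness of integral curves: both sides, as functions of `s`, start at `φ t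
  -- p`.
  have hadd : ∀ s t p, φ (s + t) p = φ s (φ t p) := by
    intro s t p
    have h := isMIntegralCurve_Ioo_eq_of_contMDiff_boundaryless (t₀ := 0) hF1
      ((hγ p).comp_add t) (hγ (φ t p)) (by simp [hγ0, φ])
    exact congrFun h s
  have hloc : ∀ p, ∃ ε > 0, ∃ V : Set N, IsOpen V ∧ p ∈ V ∧ ∃ Φ : ℝ → N → N,
      ContinuousOn (fun z : ℝ × N => Φ z.1 z.2) (Set.Ioo (-ε) ε ×ˢ V) ∧
      (∀ q ∈ V, ∀ t, |t| < ε → MDifferentiableAt 𝓘(ℝ, E) 𝓘(ℝ, E) (Φ t) q) ∧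
      (∀ q ∈ V, ∀ t, |t| < ε → φ t q = Φ t q) ∧
      ∀ (E' : Type) [NormedAddCommGroup E'] [NormedSpace ℝ E'] (f : N → E'),
        ContMDiffAt 𝓘(ℝ, E) 𝓘(ℝ, E') ∞ f p → ∀ ξ : TangentSpace 𝓘(ℝ, E) p,
        HasDerivAt (fun s => (mfderiv 𝓘(ℝ, E) 𝓘(ℝ, E') f (Φ s p)
            (mfderiv 𝓘(ℝ, E) 𝓘(ℝ, E) (Φ s) p ξ) : E'))
          (mfderiv 𝓘(ℝ, E) 𝓘(ℝ, E') (fun q => (mfderiv 𝓘(ℝ, E) 𝓘(ℝ, E') f q (F q) : E')) p ξ)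
          0 := by
    intro p
    obtain ⟨ε, hε, V, hV, hp, Φ, hc, hi, hm, hlin⟩ := loc p
    refine ⟨ε, hε, V, hV, hp, Φ, hc, hm, fun q hq t ht => ?_, hlin⟩
    exact isMIntegralCurveOn_Ioo_eqOn_of_contMDiff_boundaryless (t₀ := 0) (a := -ε) (b := ε)
      ⟨by linarith, hε⟩ hF1 ((hγ q).isMIntegralCurveOn _) (hi q hq).2
      (by rw [hγ0, (hi q hq).1]) (abs_lt.1 ht)
  have hmd : ∀ p, ∃ ε > 0, ∃ V : Set N, IsOpen V ∧ p ∈ V ∧ ∀ q ∈ V, ∀ t, |t| < ε →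
      MDifferentiableAt 𝓘(ℝ, E) 𝓘(ℝ, E) (φ t) q := by
    intro p
    obtain ⟨ε, hε, V, hV, hp, Φ, -, hm, he, -⟩ := hloc p
    refine ⟨ε, hε, V, hV, hp, fun q hq t ht => (hm q hq t ht).congr_of_eventuallyEq ?_⟩
    filter_upwards [hV.mem_nhds hq] with x hx
    exact he x hx t ht
  obtain ⟨η, hη, hmd'⟩ : ∃ η > 0, ∀ q : N, ∀ t, |t| < η →
      MDifferentiableAt 𝓘(ℝ, E) 𝓘(ℝ, E) (φ t) q := by
    have := isCompact_univ.induction_on (p := fun S : Set N => ∃ η > 0, ∀ q ∈ S, ∀ t, |t| < η →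
      MDifferentiableAt 𝓘(ℝ, E) 𝓘(ℝ, E) (φ t) q) ⟨1, one_pos, by simp⟩
      (fun S T hST ⟨ε, hε, h⟩ => ⟨ε, hε, fun q hq => h q (hST hq)⟩)
      (fun S T ⟨ε, hε, h⟩ ⟨ε', hε', h'⟩ => ⟨min ε ε', lt_min hε hε', by
        rintro q (hq | hq) t ht
        · exact h q hq t (ht.trans_le (min_le_left _ _))
        · exact h' q hq t (ht.trans_le (min_le_right _ _))⟩)
      (fun p _ => by
        obtain ⟨ε, hε, V, hV, hp, h⟩ := hmd p
        exact ⟨V, mem_nhdsWithin_of_mem_nhds (hV.mem_nhds hp), ε, hε, h⟩)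
    simpa using this
  -- Differentiability spreads from short times to all times by composition: `t` is split as `t / (n
  -- + 2)`, which is shorter than `η`, and the remaining fraction, which is covered by the induction
  -- hypothesis.
  have hmdall : ∀ n : ℕ, ∀ t, |t| < (n + 1) * η → MDifferentiable 𝓘(ℝ, E) 𝓘(ℝ, E) (φ t) := by
    intro n
    induction n with
    | zero => intro t ht q; exact hmd' q t (by simpa using ht)
    | succ n ih =>
      intro t ht
      have hn : (0 : ℝ) < n + 2 := by positivity
      have e : φ t = φ (t / (n + 2)) ∘ φ (t * ((n + 1) / (n + 2))) := by
        funext q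
        rw [Function.comp_apply, ← hadd]
        congr 1
        field_simp
        ring
      push_cast at ht
      rw [e]
      refine MDifferentiable.comp (fun q => hmd' q _ ?_) (ih _ ?_)
      · rw [abs_div, abs_of_pos hn, div_lt_iff₀ hn]
        linarith
      · rw [abs_mul, abs_of_pos (show (0 : ℝ) < (n + 1) / (n + 2) by positivity), mul_div_assoc',
          div_lt_iff₀ hn]
        have : (0 : ℝ) < n + 1 := by positivity
        nlinarith
  have hmdt : ∀ t, MDifferentiable 𝓘(ℝ, E) 𝓘(ℝ, E) (φ t) := by
    intro t
    obtain ⟨n, hn⟩ := exists_nat_gt (|t| / η)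
    refine hmdall n t ?_
    rw [div_lt_iff₀ hη] at hn
    linarith
  refine ⟨φ, ⟨⟨hγ0, hγ, hmdt⟩, hadd, ?_, ?_⟩⟩
  · rw [continuous_iff_continuousAt]
    rintro ⟨t₀, q₀⟩
    have hc0 : ∀ p, ContinuousAt (fun z : ℝ × N => φ z.1 z.2) (0, p) := by
      intro p
      obtain ⟨ε, hε, V, hV, hp, Φ, hc, -, he, -⟩ := hloc p
      have hmem : Set.Ioo (-ε) ε ×ˢ V ∈ 𝓝 ((0 : ℝ), p) :=
        prod_mem_nhds (Ioo_mem_nhds (by linarith) hε) (hV.mem_nhds hp)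
      refine (hc.continuousAt hmem).congr ?_
      filter_upwards [hmem] with z hz
      exact (he z.2 hz.2 z.1 (abs_lt.2 hz.1)).symm
    -- Joint continuity at time `t₀` is moved to time zero by composing with the continuous map `φ
    -- t₀`.
    have hcomp : (fun z : ℝ × N => φ z.1 z.2) =
        (fun z : ℝ × N => φ z.1 z.2) ∘ fun z : ℝ × N => (z.1 - t₀, φ t₀ z.2) := by
      funext z
      simp only [Function.comp_apply, ← hadd, sub_add_cancel]
    rw [hcomp]
    refine ContinuousAt.comp ?_ ?_
    · simpa using hc0 (φ t₀ q₀)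
    · exact (continuousAt_fst.sub continuousAt_const).prodMk
        ((hmdt t₀).continuous.comp continuous_snd).continuousAt
  · intro E' _ _ p f hf ξ
    obtain ⟨ε, hε, V, hV, hp, Φ, -, -, he, hlin⟩ := hloc p
    refine (hlin E' f hf ξ).congr_of_eventuallyEq ?_
    filter_upwards [Metric.ball_mem_nhds (0 : ℝ) hε] with s hs
    rw [Metric.mem_ball, dist_zero_right, Real.norm_eq_abs] at hs
    have h1 : mfderiv 𝓘(ℝ, E) 𝓘(ℝ, E) (φ s) p = mfderiv 𝓘(ℝ, E) 𝓘(ℝ, E) (Φ s) p := by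
      refine Filter.EventuallyEq.mfderiv_eq ?_
      filter_upwards [hV.mem_nhds hp] with x hx
      exact he x hx s hs
    have h2 := he p hp s hs
    have h3 : ∀ x y : N, x = y → ∀ w : E, (mfderiv 𝓘(ℝ, E) 𝓘(ℝ, E') f x w : E') =
        mfderiv 𝓘(ℝ, E) 𝓘(ℝ, E') f y w := by rintro _ _ rfl _; rfl
    rw [h1]
    exact h3 _ _ h2 _

end ManifoldFlow

end Thermostat
end

noncomputable section
namespace Thermostat

/-! ### Invariant sections of contracting scalar equations over a flow; the Riccati equation. -/

section Dichotomy

open MeasureTheory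

theorem integrableOn_exp_mul_bounded {C B : ℝ} (hC : 0 < C) {h : ℝ → ℝ} (hc : Continuous h)
    (hb : ∀ u, |h u| ≤ B) (a : ℝ) :
    IntegrableOn (fun s => Real.exp (C * s) * h s) (Set.Iic a) := by
  have h1 := (integrableOn_exp_mul_Iic hC a).mul_const B
  refine h1.mono' (by fun_prop) (Eventually.of_forall fun s => ?_)
  rw [Real.norm_eq_abs, abs_mul, Real.abs_exp]
  exact mul_le_mul_of_nonneg_left (hb s) (Real.exp_pos _).le

/-- The exponentially weighted average of the past of `h` solves `x' = h - C x`. -/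
theorem hasDerivAt_exp_average {C B : ℝ} (hC : 0 < C) {h : ℝ → ℝ} (hc : Continuous h)
    (hb : ∀ u, |h u| ≤ B) (t : ℝ) :
    HasDerivAt (fun t => ∫ s in Set.Iic (0 : ℝ), Real.exp (C * s) * h (s + t))
      (h t - C * ∫ s in Set.Iic (0 : ℝ), Real.exp (C * s) * h (s + t)) t := by
  set k : ℝ → ℝ := fun u => Real.exp (C * u) * h u with hk
  have hkc : Continuous k := by fun_prop
  have hki : ∀ a, IntegrableOn k (Set.Iic a) := integrableOn_exp_mul_bounded hC hc hb
  -- Substituting `u = s + t` moves the dependence on `t` into a factor and an endpoint of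
  -- integration, so that `h` need not be differentiable.
  have key : ∀ t, (∫ s in Set.Iic (0 : ℝ), Real.exp (C * s) * h (s + t)) =
      Real.exp (-(C * t)) * ((∫ u in Set.Iic (0 : ℝ), k u) + ∫ u in (0 : ℝ)..t, k u) := by
    intro t
    have h1 := (measurePreserving_add_right (volume : Measure ℝ) t).setIntegral_preimage_emb
      (measurableEmbedding_addRight t) k (Set.Iic t)
    have h2 : (fun x : ℝ => x + t) ⁻¹' Set.Iic t = Set.Iic 0 := by
      ext x; simp
    rw [h2] at h1
    rw [← intervalIntegral.integral_Iic_sub_Iic (hki 0) (hki t), add_sub_cancel, ← h1,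
      ← integral_const_mul]
    refine integral_congr_ae (Eventually.of_forall fun s => ?_)
    simp only [hk]
    rw [← mul_assoc, ← Real.exp_add]
    congr 2
    ring
  have hd : HasDerivAt (fun t => Real.exp (-(C * t)) *
      ((∫ u in Set.Iic (0 : ℝ), k u) + ∫ u in (0 : ℝ)..t, k u))
      (Real.exp (-(C * t)) * (-C) * ((∫ u in Set.Iic (0 : ℝ), k u) + ∫ u in (0 : ℝ)..t, k u) +
        Real.exp (-(C * t)) * k t) t := by
    refine HasDerivAt.mul ?_ ?_
    · have : HasDerivAt (fun t : ℝ => -(C * t)) (-C) t := by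
        simpa using! ((hasDerivAt_id t).const_mul C).neg
      exact this.exp
    · exact (intervalIntegral.integral_hasDerivAt_right (hkc.intervalIntegrable _ _)
        (hkc.stronglyMeasurableAtFilter _ _) hkc.continuousAt).const_add _
  rw [key t, funext key]
  refine hd.congr_deriv ?_
  have : Real.exp (-(C * t)) * k t = h t := by
    simp only [hk]
    rw [← mul_assoc, ← Real.exp_add]
    simp
  rw [this]
  ring

variable {N : Type*} [TopologicalSpace N] {φ : ℝ → N → N}

theorem continuous_exp_average [CompactSpace N] [FirstCountableTopology N]
    (hφ : Continuous fun z : ℝ × N => φ z.1 z.2)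
    {C : ℝ} (hC : 0 < C) {h : N → ℝ} (hc : Continuous h) :
    Continuous fun p => ∫ s in Set.Iic (0 : ℝ), Real.exp (C * s) * h (φ s p) := by
  obtain ⟨B, hB⟩ := isCompact_univ.exists_bound_of_continuousOn hc.continuousOn
  have hm : ∀ p, Continuous fun s => h (φ s p) := fun p =>
    hc.comp (hφ.comp (continuous_id.prodMk continuous_const))
  refine continuous_of_dominated (bound := fun s => Real.exp (C * s) * B) (fun p => ?_)
    (fun p => Eventually.of_forall fun s => ?_) ((integrableOn_exp_mul_Iic hC 0).mul_const B)
    (Eventually.of_forall fun s => ?_)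
  · have := hm p
    fun_prop
  · rw [Real.norm_eq_abs, abs_mul, Real.abs_exp]
    exact mul_le_mul_of_nonneg_left (hB _ trivial) (Real.exp_pos _).le
  · exact continuous_const.mul (hc.comp (hφ.comp (continuous_const.prodMk continuous_id)))

/-- An ODE over a flow on a compact space which contracts a strip has a continuous invariant
section. -/
theorem exists_continuous_invariant_section [CompactSpace N] [FirstCountableTopology N]
    (hφ : Continuous fun z : ℝ × N => φ z.1 z.2) (hadd : ∀ s t p, φ (s + t) p = φ s (φ t p))
    {f : N → ℝ → ℝ} (hf : Continuous fun z : N × ℝ => f z.1 z.2) {l₁ l₂ m C : ℝ}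
    (hl : l₁ ≤ l₂) (hm : 0 < m) (hmC : m ≤ C)
    (hmono : ∀ p r₁ r₂, l₁ ≤ r₁ → r₁ ≤ r₂ → r₂ ≤ l₂ →
      m * (r₂ - r₁) ≤ f p r₁ - f p r₂ ∧ f p r₁ - f p r₂ ≤ C * (r₂ - r₁))
    (h₁ : ∀ p, 0 ≤ f p l₁) (h₂ : ∀ p, f p l₂ ≤ 0) :
    ∃ L : N → ℝ, Continuous L ∧ (∀ p, l₁ ≤ L p ∧ L p ≤ l₂) ∧
      ∀ p t, HasDerivAt (fun t => L (φ t p)) (f (φ t p) (L (φ t p))) t := by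
  have hC : 0 < C := hm.trans_le hmC
  -- The fibre variable is clamped to the strip, so that the operator below acts on all continuous
  -- functions, a complete space. The fixed point lies in the strip, where the clamp does nothing.
  set cl : ℝ → ℝ := fun r => max (min l₂ r) l₁ with hcl
  have hcl1 : ∀ r, l₁ ≤ cl r := fun r => le_max_right _ _
  have hcl2 : ∀ r, cl r ≤ l₂ := fun r => max_le (min_le_left _ _) hl
  have hclid : ∀ r, l₁ ≤ r → r ≤ l₂ → cl r = r := fun r h h' => by
    simp only [hcl, min_eq_right h', max_eq_left h]
  have hcll : ∀ r r', |cl r - cl r'| ≤ |r - r'| := fun r r' =>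
    (abs_max_sub_max_le_abs _ _ _).trans (by
      have := abs_min_sub_min_le_max l₂ r l₂ r'
      simpa using this)
  -- The equation is rewritten as `L' = g - C L`. Since `C` dominates the rate of decrease of `f`,
  -- the function `g` is monotone in the clamped variable with values in `[C l₁, C l₂]`; since `f`
  -- decreases at rate at least `m`, it is `(C - m)`-Lipschitz.
  set g : N → ℝ → ℝ := fun p r => C * cl r + f p (cl r) with hg
  have hgc : Continuous fun z : N × ℝ => g z.1 z.2 := by
    have : Continuous fun z : N × ℝ => cl z.2 := by fun_prop
    exact (continuous_const.mul this).add (hf.comp (continuous_fst.prodMk this))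
  have hg1 : ∀ p r, C * l₁ ≤ g p r := fun p r => by
    have := (hmono p l₁ (cl r) le_rfl (hcl1 r) (hcl2 r)).2
    have := h₁ p
    simp only [hg]
    linarith
  have hg2 : ∀ p r, g p r ≤ C * l₂ := fun p r => by
    have := (hmono p (cl r) l₂ (hcl1 r) (hcl2 r) le_rfl).2
    have := h₂ p
    simp only [hg]
    linarith
  have hgl : ∀ p r r', |g p r - g p r'| ≤ (C - m) * |r - r'| := by
    intro p r r'
    refine le_trans ?_ (mul_le_mul_of_nonneg_left (hcll r r') (sub_nonneg.2 hmC))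
    wlog h : cl r ≤ cl r' generalizing r r'
    · rw [abs_sub_comm (g p r), abs_sub_comm (cl r)]
      exact this r' r (le_of_not_ge h)
    have h3 := hmono p (cl r) (cl r') (hcl1 _) h (hcl2 _)
    rw [abs_sub_comm (cl r), abs_of_nonneg (sub_nonneg.2 h), abs_le]
    simp only [hg]
    constructor <;> linarith [h3.1, h3.2]
  have hgb : ∀ p r, |g p r| ≤ max |C * l₁| |C * l₂| := fun p r =>
    abs_le_max_abs_abs (hg1 p r) (hg2 p r)
  have hLc : ∀ L : C(N, ℝ), Continuous fun p => g p (L p) := fun L =>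
    hgc.comp (continuous_id.prodMk L.continuous)
  have hso : ∀ (L : C(N, ℝ)) p, Continuous fun s => g (φ s p) (L (φ s p)) := fun L p =>
    (hLc L).comp (hφ.comp (continuous_id.prodMk continuous_const))
  have hint : ∀ (L : C(N, ℝ)) p, IntegrableOn (fun s => Real.exp (C * s) * g (φ s p) (L (φ s p)))
      (Set.Iic 0) := fun L p => integrableOn_exp_mul_bounded hC (hso L p) (fun u => hgb _ _) 0
  -- The bounded solution of `L' = g - C L` is the average of the past of `g` with weight `exp (C
  -- s)`, so invariant sections are the fixed points of `T`.
  set T : C(N, ℝ) → C(N, ℝ) := fun L =>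
    ⟨fun p => ∫ s in Set.Iic (0 : ℝ), Real.exp (C * s) * g (φ s p) (L (φ s p)),
      continuous_exp_average hφ hC (hLc L)⟩ with hT
  have hexp : ∫ s in Set.Iic (0 : ℝ), Real.exp (C * s) = 1 / C := by
    rw [integral_exp_mul_Iic hC]; simp
  have hei : IntegrableOn (fun s => Real.exp (C * s)) (Set.Iic 0) := integrableOn_exp_mul_Iic hC 0
  have hTl : ∀ L p, l₁ ≤ T L p ∧ T L p ≤ l₂ := by
    intro L p
    have e1 : ∫ s in Set.Iic (0 : ℝ), Real.exp (C * s) * (C * l₁) = l₁ := by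
      rw [integral_mul_const, hexp]; field_simp
    have e2 : ∫ s in Set.Iic (0 : ℝ), Real.exp (C * s) * (C * l₂) = l₂ := by
      rw [integral_mul_const, hexp]; field_simp
    constructor
    · conv_lhs => rw [← e1]
      exact integral_mono (hei.mul_const _) (hint L p) fun s =>
        mul_le_mul_of_nonneg_left (hg1 _ _) (Real.exp_pos _).le
    · conv_rhs => rw [← e2]
      exact integral_mono (hint L p) (hei.mul_const _) fun s =>
        mul_le_mul_of_nonneg_left (hg2 _ _) (Real.exp_pos _).le
  -- The weight has total mass `1 / C`, so the Lipschitz constant `C - m` of `g` becomes the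
  -- contraction factor `(C - m) / C`.
  have hlip : LipschitzWith ((C - m) / C).toNNReal T := by
    refine LipschitzWith.of_dist_le_mul fun L L' => ?_
    rw [Real.coe_toNNReal _ (div_nonneg (sub_nonneg.2 hmC) hC.le)]
    refine (ContinuousMap.dist_le (mul_nonneg (div_nonneg (sub_nonneg.2 hmC) hC.le)
      dist_nonneg)).2 fun p => ?_
    rw [Real.dist_eq]
    change |(∫ s in Set.Iic (0 : ℝ), Real.exp (C * s) * g (φ s p) (L (φ s p))) -
      ∫ s in Set.Iic (0 : ℝ), Real.exp (C * s) * g (φ s p) (L' (φ s p))| ≤ _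
    rw [← integral_sub (hint L p) (hint L' p), ← Real.norm_eq_abs]
    refine (norm_integral_le_of_norm_le (hei.mul_const ((C - m) * dist L L'))
      (Eventually.of_forall fun s => ?_)).trans (le_of_eq ?_)
    · rw [← mul_sub, Real.norm_eq_abs, abs_mul, Real.abs_exp]
      refine mul_le_mul_of_nonneg_left ((hgl _ _ _).trans ?_) (Real.exp_pos _).le
      rw [← Real.dist_eq]
      exact mul_le_mul_of_nonneg_left (ContinuousMap.dist_apply_le_dist _) (sub_nonneg.2 hmC)
    · rw [integral_mul_const, hexp]
      ring
  have hcon : ContractingWith ((C - m) / C).toNNReal T := by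
    refine ⟨?_, hlip⟩
    rw [Real.toNNReal_lt_one, div_lt_one hC]
    linarith
  set L := ContractingWith.fixedPoint T hcon
  have hL : T L = L := hcon.fixedPoint_isFixedPt
  have hLl : ∀ p, l₁ ≤ L p ∧ L p ≤ l₂ := fun p => by
    have := hTl L p
    rwa [hL] at this
  refine ⟨L, L.continuous, hLl, fun p t => ?_⟩
  have hLe : ∀ q, L q = ∫ s in Set.Iic (0 : ℝ), Real.exp (C * s) * g (φ s q) (L (φ s q)) :=
    fun q => (DFunLike.congr_fun hL q).symm
  have h3 := hasDerivAt_exp_average hC (hso L p) (fun u => hgb _ _) t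
  have h4 : (fun t => L (φ t p)) = fun t =>
      ∫ s in Set.Iic (0 : ℝ), Real.exp (C * s) * g (φ (s + t) p) (L (φ (s + t) p)) := by
    funext t
    rw [hLe]
    simp only [hadd]
  rw [h4]
  refine h3.congr_deriv ?_
  rw [← congrFun h4 t]
  simp only [hg]
  rw [hclid _ (hLl _).1 (hLl _).2]
  ring

/-- The positive invariant section of the Riccati equation `u' = b - a u - u²` with `b > 0`, and the
corresponding section of the linear equation `x' = (l - b x) / u`. -/
theorem exists_riccati_section [CompactSpace N] [FirstCountableTopology N]
    (hφ : Continuous fun z : ℝ × N => φ z.1 z.2) (hadd : ∀ s t p, φ (s + t) p = φ s (φ t p))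
    {a b l : N → ℝ} (ha : Continuous a) (hb : Continuous b) (hl : Continuous l)
    (hpos : ∀ p, 0 < b p) :
    ∃ u x : N → ℝ, Continuous u ∧ Continuous x ∧ (∀ p, 0 < u p) ∧
      (∀ p t, HasDerivAt (fun t => u (φ t p))
        (b (φ t p) - a (φ t p) * u (φ t p) - u (φ t p) ^ 2) t) ∧
      ∀ p t, HasDerivAt (fun t => x (φ t p))
        ((l (φ t p) - b (φ t p) * x (φ t p)) / u (φ t p)) t := by
  have bdd : ∀ h : N → ℝ, Continuous h → ∃ B, 0 ≤ B ∧ ∀ p, |h p| ≤ B := fun h hh => by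
    obtain ⟨B, hB⟩ := isCompact_univ.exists_bound_of_continuousOn hh.continuousOn
    exact ⟨|B|, abs_nonneg _, fun p => (hB p trivial).trans (le_abs_self B)⟩
  obtain ⟨A, hA0, hA⟩ := bdd a ha
  obtain ⟨B, hB0, hB⟩ := bdd b hb
  obtain ⟨D, hD0, hD⟩ := bdd (fun p => (b p)⁻¹) (hb.inv₀ fun p => (hpos p).ne')
  have hbD : ∀ p, 1 ≤ D * b p := fun p => by
    have := (le_abs_self _).trans (hD p)
    rwa [inv_le_iff_one_le_mul₀ (hpos p)] at this
  have hbB : ∀ p, b p ≤ B := fun p => (le_abs_self _).trans (hB p)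
  -- `R` makes both ends of the strip `[R⁻¹, R]` inward-pointing for `u`: at `R` the term `-u` beats
  -- `A + B`, and at `R⁻¹` the term `b R` beats `A + 1`, because `D` bounds `b⁻¹`.
  set R := 1 + A + B + (A + 1) * D with hR
  have hR1 : 1 ≤ R := by
    have := mul_nonneg (add_nonneg hA0 zero_le_one) hD0
    linarith
  have hR0 : 0 < R := by linarith
  have hlog : 0 ≤ Real.log R := Real.log_nonneg hR1
  have hexp1 : ∀ r₁ r₂ : ℝ, Real.exp r₁ * (r₂ - r₁) ≤ Real.exp r₂ - Real.exp r₁ := fun r₁ r₂ => by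
    have h1 := Real.add_one_le_exp (r₂ - r₁)
    have h2 : Real.exp r₂ = Real.exp r₁ * Real.exp (r₂ - r₁) := by
      rw [← Real.exp_add]; congr 1; ring
    rw [h2]
    nlinarith [Real.exp_pos r₁]
  -- In the variable `log u` the Riccati equation reads `L' = b exp (-L) - a - exp L`, which is
  -- strictly decreasing in `L` whatever the sign of `a`. On the strip its slope is at least `R⁻¹`,
  -- from `exp L`, and at most `(B + 1) * R` in absolute value.
  obtain ⟨L, hLc, -, hL⟩ := exists_continuous_invariant_section hφ hadd
    (f := fun p r => b p * Real.exp (-r) - a p - Real.exp r) (l₁ := -Real.log R)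
    (l₂ := Real.log R) (m := R⁻¹) (C := (B + 1) * R) (by fun_prop) (by linarith)
    (inv_pos.2 hR0) (by
      have : R⁻¹ ≤ 1 := inv_le_one_of_one_le₀ hR1
      nlinarith)
    (fun p r₁ r₂ h1 h h2 => by
      have e1 := hexp1 r₁ r₂
      have e2 := hexp1 r₂ r₁
      have e3 := hexp1 (-r₁) (-r₂)
      have e4 := hexp1 (-r₂) (-r₁)
      have b1 : R⁻¹ ≤ Real.exp r₁ := by
        rw [← Real.exp_log (inv_pos.2 hR0), Real.log_inv]; exact Real.exp_le_exp.2 h1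
      have b2 : Real.exp r₂ ≤ R := by
        conv_rhs => rw [← Real.exp_log hR0]
        exact Real.exp_le_exp.2 h2
      have b3 : Real.exp (-r₁) ≤ R := by
        conv_rhs => rw [← Real.exp_log hR0]
        exact Real.exp_le_exp.2 (by linarith)
      have hp := hpos p
      have hd : 0 ≤ r₂ - r₁ := sub_nonneg.2 h
      have m1 := mul_le_mul_of_nonneg_right b1 hd
      have m2 := mul_le_mul_of_nonneg_right b2 hd
      have m3 := mul_le_mul_of_nonneg_right b3 hd
      have hmon : Real.exp (-r₂) ≤ Real.exp (-r₁) := Real.exp_le_exp.2 (by linarith)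
      constructor
      · nlinarith [mul_nonneg hp.le (sub_nonneg.2 hmon)]
      · have k1 : Real.exp (-r₁) - Real.exp (-r₂) ≤ R * (r₂ - r₁) := by linarith
        have k2 : b p * (Real.exp (-r₁) - Real.exp (-r₂)) ≤ B * (R * (r₂ - r₁)) :=
          mul_le_mul (hbB p) k1 (sub_nonneg.2 hmon) hB0
        linarith)
    (fun p => by
      rw [neg_neg, Real.exp_log hR0, Real.exp_neg, Real.exp_log hR0]
      have h1 : R⁻¹ ≤ 1 := inv_le_one_of_one_le₀ hR1
      have h2 := (abs_le.1 (hA p)).2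
      have h3 : (A + 1) * 1 ≤ (A + 1) * (D * b p) :=
        mul_le_mul_of_nonneg_left (hbD p) (by linarith)
      have h4 : b p * ((A + 1) * D) ≤ b p * R :=
        mul_le_mul_of_nonneg_left (by linarith) (hpos p).le
      nlinarith)
    (fun p => by
      rw [Real.exp_log hR0, Real.exp_neg, Real.exp_log hR0]
      have h1 : R⁻¹ ≤ 1 := inv_le_one_of_one_le₀ hR1
      have h2 := (abs_le.1 (hA p)).1
      have h3 : b p * R⁻¹ ≤ B * 1 := mul_le_mul (hbB p) h1 (inv_nonneg.2 hR0.le) hB0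
      have h4 := mul_nonneg (add_nonneg hA0 zero_le_one) hD0
      linarith)
  set u : N → ℝ := fun p => Real.exp (L p) with hu
  have huc : Continuous u := by fun_prop
  have hup : ∀ p, 0 < u p := fun p => Real.exp_pos _
  obtain ⟨U, hU0, hU⟩ := bdd u huc
  obtain ⟨Q, hQ0, hQ⟩ := bdd (fun p => b p / u p) (hb.div huc fun p => (hup p).ne')
  obtain ⟨W, hW0, hW⟩ := bdd (fun p => l p / b p) (hl.div hb fun p => (hpos p).ne')
  have hkey : ∀ p, 1 ≤ (D * (U + 1)) * (b p / u p) := fun p => by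
    rw [mul_div_assoc', le_div_iff₀ (hup p)]
    have h1 := (le_abs_self _).trans (hU p)
    have h2 := mul_le_mul (hbD p) (show u p ≤ U + 1 by linarith) (hup p).le
      (by linarith [hbD p])
    nlinarith
  have hDU : 0 ≤ D * (U + 1) := by positivity
  -- The right-hand side decreases in `x` at rate `b / u` and vanishes at `x = l / b`, which lies in
  -- `[-W, W]`. The rate is at least `(D (U + 1))⁻¹` and at most `Q`; the added ones keep the
  -- constants positive and ordered even when the bounds are zero.
  obtain ⟨x, hxc, -, hx⟩ := exists_continuous_invariant_section hφ hadd
    (f := fun p r => (l p - b p * r) / u p) (l₁ := -W) (l₂ := W) (m := (D * (U + 1) + 1)⁻¹)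
    (C := Q + 1) (by
      refine Continuous.div (by fun_prop) (huc.comp continuous_fst) fun z => (hup z.1).ne')
    (by linarith) (by positivity) (by
      have : (D * (U + 1) + 1)⁻¹ ≤ 1 := inv_le_one_of_one_le₀ (by linarith)
      linarith)
    (fun p r₁ r₂ h1 h h2 => by
      have e : (l p - b p * r₁) / u p - (l p - b p * r₂) / u p = (b p / u p) * (r₂ - r₁) := by
        ring
      rw [e]
      have hd : 0 ≤ r₂ - r₁ := sub_nonneg.2 h
      constructor
      · refine mul_le_mul_of_nonneg_right ?_ hd
        have := div_pos (hpos p) (hup p)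
        rw [inv_le_iff_one_le_mul₀ (by positivity)]
        nlinarith [hkey p]
      · exact mul_le_mul_of_nonneg_right (by linarith [(le_abs_self _).trans (hQ p)]) hd)
    (fun p => by
      have h1 := (abs_le.1 (hW p)).1
      rw [le_div_iff₀ (hpos p)] at h1
      exact div_nonneg (by nlinarith) (hup p).le)
    (fun p => by
      have h1 := (abs_le.1 (hW p)).2
      rw [div_le_iff₀ (hpos p)] at h1
      exact div_nonpos_of_nonpos_of_nonneg (by nlinarith) (hup p).le)
  refine ⟨u, x, huc, hxc, hup, fun p t => ?_, hx⟩
  have := (hL p t).exp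
  refine this.congr_deriv ?_
  have h1 : Real.exp (L (φ t p)) * Real.exp (-L (φ t p)) = 1 := by
    rw [← Real.exp_add]; simp
  simp only [hu]
  linear_combination b (φ t p) * h1

/-- Solutions of `f' = k f`. -/
theorem eq_mul_exp_integral {f k : ℝ → ℝ} (hk : Continuous k)
    (hf : ∀ t, HasDerivAt f (k t * f t) t) (t : ℝ) :
    f t = f 0 * Real.exp (∫ s in (0 : ℝ)..t, k s) := by
  have hd : ∀ t, HasDerivAt (fun t => f t * Real.exp (-∫ s in (0 : ℝ)..t, k s)) 0 t := by
    intro t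
    have h1 : HasDerivAt (fun t => ∫ s in (0 : ℝ)..t, k s) (k t) t :=
      intervalIntegral.integral_hasDerivAt_right (hk.intervalIntegrable _ _)
        (hk.stronglyMeasurableAtFilter _ _) hk.continuousAt
    refine ((hf t).mul h1.fun_neg.exp).congr_deriv ?_
    ring
  have h2 := is_const_of_deriv_eq_zero (fun t => (hd t).differentiableAt)
    (fun t => (hd t).deriv) t 0
  simp only [intervalIntegral.integral_same, neg_zero, Real.exp_zero, mul_one] at h2
  rw [← h2, mul_assoc, ← Real.exp_add]
  simp

end Dichotomy

end Thermostat
end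

noncomputable section
namespace Thermostat

/-! ### Riemannian geometry of a coordinate plane: connection, rotation, curvature. -/

section LeviCivita

variable {E : Type*} [NormedAddCommGroup E] [NormedSpace ℝ E]

/-- `Γ` is the Levi-Civita connection of the metric `G` at the point `y` of the plane. -/
structure LeviCivita (G : E → (E →L[ℝ] E →L[ℝ] ℝ)) (Γ : E → (E →L[ℝ] E →L[ℝ] E)) (y : E) : Prop where
  metric_smooth : ContDiffAt ℝ ∞ G y
  conn_smooth : ContDiffAt ℝ ∞ Γ y
  symm : ∀ a b, G y a b = G y b a
  pos : ∀ a, a ≠ 0 → 0 < G y a a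
  torsion : ∀ a b, Γ y a b = Γ y b a
  compat : ∀ a b c, fderiv ℝ G y a b c = G y (Γ y a b) c + G y b (Γ y a c)

/-- `J` is an isometric complex structure of `(E, G)` at the point `y`. -/
structure Rotation (G : E → (E →L[ℝ] E →L[ℝ] ℝ)) (J : E → E →L[ℝ] E) (y : E) : Prop where
  smooth : ContDiffAt ℝ ∞ J y
  sq : ∀ a, J y (J y a) = -a
  isometry : ∀ a b, G y (J y a) (J y b) = G y a b

variable {G : E → (E →L[ℝ] E →L[ℝ] ℝ)} {Γ : E → (E →L[ℝ] E →L[ℝ] E)} {J : E → E →L[ℝ] E} {y : E}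

theorem LeviCivita.eq_zero (h : LeviCivita G Γ y) {w : E} (hw : ∀ c, G y w c = 0) : w = 0 := by
  by_contra h0
  exact (h.pos w h0).ne' (hw w)

theorem LeviCivita.differentiableAt_metric (h : LeviCivita G Γ y) : DifferentiableAt ℝ G y :=
  h.metric_smooth.differentiableAt (by simp)

theorem LeviCivita.differentiableAt_conn (h : LeviCivita G Γ y) : DifferentiableAt ℝ Γ y :=
  h.conn_smooth.differentiableAt (by simp)

theorem Rotation.differentiableAt (h : Rotation G J y) : DifferentiableAt ℝ J y :=
  h.smooth.differentiableAt (by simp)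

theorem Rotation.inner_left (h : Rotation G J y) (a b : E) : G y (J y a) b = -G y a (J y b) := by
  have := h.isometry a (J y b)
  rw [h.sq, map_neg] at this
  linarith

theorem Rotation.inner_self (hJ : Rotation G J y) (h : LeviCivita G Γ y) (a : E) :
    G y (J y a) a = 0 := by
  have h1 := hJ.inner_left a a
  rw [h.symm a] at h1
  linarith

/-- Two orthonormal vectors are a basis of the plane. -/
theorem LeviCivita.expand [Fact (Module.finrank ℝ E = 2)] (h : LeviCivita G Γ y) {v n : E} (hv : G y v v = 1) (hn : G y n n = 1)
    (hvn : G y v n = 0) (w : E) : w = G y v w • v + G y n w • n := by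
  have hnv : G y n v = 0 := by rw [h.symm]; exact hvn
  have hli : LinearIndependent ℝ ![v, n] := by
    rw [LinearIndependent.pair_iff]
    intro s t hst
    have h1 := congrArg (G y v) hst
    have h2 := congrArg (G y n) hst
    simp [hv, hn, hvn, hnv] at h1 h2
    exact ⟨h1, h2⟩
  have hspan := hli.span_eq_top_of_card_eq_finrank
    (by rw [Fact.out (p := Module.finrank ℝ E = 2)]; simp)
  have hw : w ∈ Submodule.span ℝ (Set.range ![v, n]) := by rw [hspan]; trivial
  rw [Matrix.range_cons, Matrix.range_cons, Matrix.range_empty, Set.union_empty,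
    Set.singleton_union, Submodule.mem_span_pair] at hw
  obtain ⟨s, t, rfl⟩ := hw
  simp [hv, hn, hvn, hnv]

/-- An isometric complex structure of the plane is parallel. -/
theorem Rotation.parallel [Fact (Module.finrank ℝ E = 2)] (h : LeviCivita G Γ y) (hJ : ∀ᶠ z in 𝓝 y, Rotation G J z) (a b : E) :
    fderiv ℝ J y a b = J y (Γ y a b) - Γ y a (J y b) := by
  have hJy := hJ.self_of_nhds
  have dJ := hJy.differentiableAt.hasFDerivAt
  have dG := h.differentiableAt_metric.hasFDerivAt
  have e1 : ∀ b, fderiv ℝ J y a (J y b) + J y (fderiv ℝ J y a b) = 0 := by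
    intro b
    have d1 : HasFDerivAt (fun z => J z (J z b)) _ y :=
      dJ.clm_apply (dJ.clm_apply (hasFDerivAt_const b y))
    have d2 : HasFDerivAt (fun z => J z (J z b)) (0 : E →L[ℝ] E) y := by
      refine (hasFDerivAt_const (-b) y).congr_of_eventuallyEq ?_
      filter_upwards [hJ] with z hz
      exact hz.sq b
    have := DFunLike.congr_fun (d1.unique d2) a
    simp at this
    rw [add_comm]
    exact this
  have e2 : ∀ b c, fderiv ℝ G y a (J y b) (J y c) + G y (fderiv ℝ J y a b) (J y c) +
      G y (J y b) (fderiv ℝ J y a c) = fderiv ℝ G y a b c := by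
    intro b c
    have d1 : HasFDerivAt (fun z => G z (J z b) (J z c)) _ y :=
      (dG.clm_apply (dJ.clm_apply (hasFDerivAt_const b y))).clm_apply
        (dJ.clm_apply (hasFDerivAt_const c y))
    have d2 : HasFDerivAt (fun z => G z (J z b) (J z c)) _ y :=
      ((dG.clm_apply (hasFDerivAt_const b y)).clm_apply
        (hasFDerivAt_const c y)).congr_of_eventuallyEq (by
          filter_upwards [hJ] with z hz
          exact hz.isometry b c)
    have := DFunLike.congr_fun (d1.unique d2) a
    simp at this
    linarith
  -- `P` is the covariant derivative of `J` in the direction `a`. It anticommutes with `J` because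
  -- `J² = -1`, and `J` being an isometry gives `p2`. Together they make `P b` orthogonal to both
  -- `b` and `J b`, which span the plane.
  set P : E → E := fun b => fderiv ℝ J y a b - J y (Γ y a b) + Γ y a (J y b) with hP
  have p1 : ∀ b, P (J y b) = -J y (P b) := by
    intro b
    simp only [hP, map_add, map_sub, hJy.sq, map_neg]
    rw [eq_neg_of_add_eq_zero_left (e1 b)]
    abel
  have p2 : ∀ b c, G y (P b) (J y c) + G y (J y b) (P c) = 0 := by
    intro b c
    have h1 := e2 b c
    rw [h.compat, h.compat] at h1
    have h2 := hJy.isometry (Γ y a b) c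
    have h3 := hJy.isometry b (Γ y a c)
    simp only [hP, map_add, map_sub, add_apply, sub_apply]
    linarith
  have p3 : P b = 0 := by
    by_cases hb : b = 0
    · simp [hP, hb]
    have h1 : G y (P b) (J y b) = 0 := by
      have := p2 b b
      rw [h.symm (J y b)] at this
      linarith
    have h2 : G y (P b) b = 0 := by
      have := p2 b (J y b)
      rw [hJy.sq, p1, map_neg, map_neg, hJy.isometry, h.symm b] at this
      linarith
    have hpos := h.pos b hb
    set r := Real.sqrt (G y b b)
    have hr : r * r = G y b b := Real.mul_self_sqrt hpos.le
    have hr0 : r ≠ 0 := (Real.sqrt_pos.2 hpos).ne'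
    have hv : G y (r⁻¹ • b) (r⁻¹ • b) = 1 := by
      simp only [map_smul, smul_apply, smul_eq_mul, ← hr]
      field_simp
    have hn : G y (J y (r⁻¹ • b)) (J y (r⁻¹ • b)) = 1 := by rw [hJy.isometry, hv]
    have hvn : G y (r⁻¹ • b) (J y (r⁻¹ • b)) = 0 := by
      rw [h.symm]; exact hJy.inner_self h _
    rw [h.expand hv hn hvn (P b), h.symm _ (P b), h.symm _ (P b)]
    simp [h1, h2]
  have := p3
  simp only [hP] at this
  rw [← sub_eq_zero]
  rw [← this]
  abel

/-- The Christoffel symbols transform like a connection under a change of coordinates. -/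
theorem LeviCivita.transform {G₀ G₁ : E → (E →L[ℝ] E →L[ℝ] ℝ)} {Γ₀ Γ₁ : E → (E →L[ℝ] E →L[ℝ] E)} {τ : E → E}
    (hτ : ContDiffAt ℝ ∞ τ y) (hs : Function.Surjective (fderiv ℝ τ y))
    (h₀ : LeviCivita G₀ Γ₀ y) (h₁ : LeviCivita G₁ Γ₁ (τ y))
    (hG : ∀ᶠ z in 𝓝 y, ∀ a b, G₀ z a b = G₁ (τ z) (fderiv ℝ τ z a) (fderiv ℝ τ z b)) (a b : E) :
    Γ₁ (τ y) (fderiv ℝ τ y a) (fderiv ℝ τ y b) =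
      fderiv ℝ τ y (Γ₀ y a b) - fderiv ℝ (fderiv ℝ τ) y a b := by
  have dτ := (hτ.differentiableAt (by simp)).hasFDerivAt
  have ddτ := ((hτ.fderiv_right (m := 1) (by norm_num; exact two_le_infty)).differentiableAt
    (by simp)).hasFDerivAt
  have hsym : IsSymmSndFDerivAt ℝ τ y := hτ.isSymmSndFDerivAt (by simpa using two_le_infty)
  have d₀ := h₀.differentiableAt_metric.hasFDerivAt
  have d₁ := h₁.differentiableAt_metric.hasFDerivAt
  have hGy := hG.self_of_nhds
  set A := fderiv ℝ τ y with hA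
  set D := fderiv ℝ (fderiv ℝ τ) y with hD
  -- `S` is the defect of the transformation law. Compatibility of both connections with the metrics
  -- makes it skew in the last two slots, and vanishing torsion makes it symmetric in the first two.
  set S : E → E → E := fun a b => A (Γ₀ y a b) - D a b - Γ₁ (τ y) (A a) (A b) with hS
  have key : ∀ a b c, G₁ (τ y) (S a b) (A c) + G₁ (τ y) (A b) (S a c) = 0 := by
    intro a b c
    have e1 : HasFDerivAt (fun z => G₁ (τ z) (fderiv ℝ τ z b) (fderiv ℝ τ z c)) _ y :=
      ((d₁.comp y dτ).clm_apply (ddτ.clm_apply (hasFDerivAt_const b y))).clm_apply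
        (ddτ.clm_apply (hasFDerivAt_const c y))
    have e2 : HasFDerivAt (fun z => G₁ (τ z) (fderiv ℝ τ z b) (fderiv ℝ τ z c)) _ y :=
      ((d₀.clm_apply (hasFDerivAt_const b y)).clm_apply
        (hasFDerivAt_const c y)).congr_of_eventuallyEq (by
          filter_upwards [hG] with z hz
          exact (hz b c).symm)
    have h := DFunLike.congr_fun (e1.unique e2) a
    simp [← hA] at h
    rw [h₀.compat, h₁.compat, hGy, hGy] at h
    simp only [hS, map_sub, sub_apply]
    linarith
  have hSs : ∀ a b, S a b = S b a := by
    intro a b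
    simp only [hS]
    rw [h₀.torsion a b, h₁.torsion (A a), show D a b = D b a from hsym.eq a b]
  have hz : S a b = 0 := by
    refine h₁.eq_zero fun c' => ?_
    obtain ⟨c, rfl⟩ := hs c'
    -- A trilinear form symmetric in two slots and skew in two others vanishes: this is the cyclic
    -- argument of the Koszul formula.
    have k1 := key a b c
    have k2 := key b c a
    have k3 := key c a b
    rw [hSs b c] at k2
    rw [hSs c a] at k3
    rw [hSs b a] at k2
    rw [h₁.symm (A b)] at k1
    rw [h₁.symm (A c)] at k2
    rw [h₁.symm (A a)] at k3
    change G₁ (τ y) (S a b) (A c) = 0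
    linarith
  simp only [hS] at hz
  exact (sub_eq_zero.1 hz).symm

/-- The curvature tensor `R(a, b) c`. -/
def riemann (Γ : E → (E →L[ℝ] E →L[ℝ] E)) (y a b c : E) : E :=
  fderiv ℝ Γ y a b c - fderiv ℝ Γ y b a c + (Γ y a (Γ y b c) - Γ y b (Γ y a c))

/-- The curvature `g(R(e₀, e₁) e₁, e₀) / det g` in the basis `e₀, e₁` of the plane. -/
def sectional (G : E → (E →L[ℝ] E →L[ℝ] ℝ)) (Γ : E → (E →L[ℝ] E →L[ℝ] E)) (e₀ e₁ y : E) : ℝ :=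
  G y (riemann Γ y e₀ e₁ e₁) e₀ / (G y e₀ e₀ * G y e₁ e₁ - G y e₀ e₁ * G y e₁ e₀)

theorem riemann_skew_left (a b c : E) : riemann Γ y a b c = -riemann Γ y b a c := by
  simp only [riemann]
  abel

theorem riemann_add_right (a b b' c : E) :
    riemann Γ y a (b + b') c = riemann Γ y a b c + riemann Γ y a b' c := by
  simp only [riemann, map_add, add_apply]
  abel

theorem riemann_smul_right (a b c : E) (r : ℝ) :
    riemann Γ y a (r • b) c = r • riemann Γ y a b c := by
  simp only [riemann, map_smul, smul_apply, smul_sub, smul_add]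

theorem riemann_self (a c : E) : riemann Γ y a a c = 0 := by
  simp [riemann]

theorem riemann_add_vec (a b c c' : E) :
    riemann Γ y a b (c + c') = riemann Γ y a b c + riemann Γ y a b c' := by
  simp only [riemann, map_add]
  abel

theorem riemann_smul_vec (a b c : E) (r : ℝ) :
    riemann Γ y a b (r • c) = r • riemann Γ y a b c := by
  simp only [riemann, map_smul, smul_sub, smul_add]

/-- The curvature operators are skew. -/
theorem LeviCivita.riemann_skew (h : ∀ᶠ z in 𝓝 y, LeviCivita G Γ z) (a b c d : E) :
    G y (riemann Γ y a b c) d + G y c (riemann Γ y a b d) = 0 := by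
  have hy := h.self_of_nhds
  have dG := hy.differentiableAt_metric.hasFDerivAt
  have dΓ := hy.differentiableAt_conn.hasFDerivAt
  have ddG := ((hy.metric_smooth.fderiv_right (m := 1)
    (by norm_num; exact two_le_infty)).differentiableAt (by simp)).hasFDerivAt
  have hsym : IsSymmSndFDerivAt ℝ G y :=
    hy.metric_smooth.isSymmSndFDerivAt (by simpa using two_le_infty)
  -- The equation `∇G = 0` holds near `y`, hence may be differentiated. Exchanging `a` and `b` and
  -- using the symmetry of the second derivative of `G` leaves exactly the curvature terms.
  have key : ∀ a b, fderiv ℝ (fderiv ℝ G) y a b c d =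
      fderiv ℝ G y a (Γ y b c) d + G y (fderiv ℝ Γ y a b c) d +
      (fderiv ℝ G y a c (Γ y b d) + G y c (fderiv ℝ Γ y a b d)) := by
    intro a b
    have e1 : HasFDerivAt (fun z => fderiv ℝ G z b c d) _ y :=
      ((ddG.clm_apply (hasFDerivAt_const b y)).clm_apply (hasFDerivAt_const c y)).clm_apply
        (hasFDerivAt_const d y)
    have e2 : HasFDerivAt (fun z => G z (Γ z b c) d + G z c (Γ z b d)) _ y :=
      ((dG.clm_apply ((dΓ.clm_apply (hasFDerivAt_const b y)).clm_apply
        (hasFDerivAt_const c y))).clm_apply (hasFDerivAt_const d y)).add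
      ((dG.clm_apply (hasFDerivAt_const c y)).clm_apply
        ((dΓ.clm_apply (hasFDerivAt_const b y)).clm_apply (hasFDerivAt_const d y)))
    have e3 : HasFDerivAt (fun z => fderiv ℝ G z b c d) _ y := e2.congr_of_eventuallyEq (by
      filter_upwards [h] with z hz
      exact hz.compat b c d)
    have := DFunLike.congr_fun (e1.unique e3) a
    simp at this
    linarith
  have h1 := key a b
  have h2 := key b a
  rw [show fderiv ℝ (fderiv ℝ G) y b a = fderiv ℝ (fderiv ℝ G) y a b from hsym.eq b a, h1] at h2
  rw [hy.compat, hy.compat, hy.compat, hy.compat] at h2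
  simp only [riemann, map_add, map_sub, add_apply,
    sub_apply]
  linarith

/-- The curvature in an orthonormal frame. -/
theorem LeviCivita.sectional_eq (h : ∀ᶠ z in 𝓝 y, LeviCivita G Γ z) {e₀ e₁ v n : E}
    {v₀ v₁ n₀ n₁ : ℝ} (ev : v = v₀ • e₀ + v₁ • e₁) (en : n = n₀ • e₀ + n₁ • e₁)
    (hv : G y v v = 1) (hn : G y n n = 1) (hvn : G y v n = 0) :
    G y n (riemann Γ y v n v) = -sectional G Γ e₀ e₁ y := by
  have hy := h.self_of_nhds
  have hnv : G y n v = 0 := by rw [hy.symm]; exact hvn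
  -- `Δ` is the determinant of the change of basis. It enters the curvature twice, once through the
  -- skew pair `(v, n)` and once through the other pair, while orthonormality says that `Δ²` times
  -- the Gram determinant is one.
  set Δ := v₀ * n₁ - v₁ * n₀
  set r := G y (riemann Γ y e₀ e₁ e₁) e₀ with hr
  have sk := LeviCivita.riemann_skew h e₀ e₁
  have s0 : G y (riemann Γ y e₀ e₁ e₀) e₀ = 0 := by
    have := sk e₀ e₀; rw [hy.symm e₀] at this; linarith
  have s1 : G y (riemann Γ y e₀ e₁ e₁) e₁ = 0 := by
    have := sk e₁ e₁; rw [hy.symm e₁] at this; linarith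
  have s2 : G y (riemann Γ y e₀ e₁ e₀) e₁ = -r := by
    have := sk e₀ e₁; rw [hy.symm e₀] at this; linarith
  have hl : ∀ a c : E, ∀ b₀ b₁ : ℝ, riemann Γ y a (b₀ • e₀ + b₁ • e₁) c =
      b₀ • riemann Γ y a e₀ c + b₁ • riemann Γ y a e₁ c := by
    intro a c b₀ b₁
    rw [riemann_add_right, riemann_smul_right, riemann_smul_right]
  have hR : ∀ c, riemann Γ y v n c = Δ • riemann Γ y e₀ e₁ c := by
    intro c
    rw [en, hl, riemann_skew_left v e₀, riemann_skew_left v e₁, ev, hl, hl, riemann_self,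
      riemann_self, riemann_skew_left e₁ e₀]
    module
  have hRv : G y (riemann Γ y e₀ e₁ v) n = -Δ * r := by
    rw [ev, en, riemann_add_vec, riemann_smul_vec, riemann_smul_vec]
    simp only [map_add, map_smul, add_apply, smul_apply, smul_eq_mul, s0, s1, s2, ← hr]
    ring
  have hdet : Δ ^ 2 * (G y e₀ e₀ * G y e₁ e₁ - G y e₀ e₁ * G y e₁ e₀) = 1 := by
    have h1 : G y v v * G y n n - G y v n * G y n v = 1 := by rw [hv, hn, hvn]; ring
    rw [← h1, ev, en]
    simp only [map_add, map_smul, add_apply, smul_apply, smul_eq_mul, Δ]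
    ring
  have hne : G y e₀ e₀ * G y e₁ e₁ - G y e₀ e₁ * G y e₁ e₀ ≠ 0 := right_ne_zero_of_mul
    (by rw [hdet]; exact one_ne_zero)
  rw [hy.symm, hR, map_smul, smul_apply, hRv, smul_eq_mul, sectional, ← hr,
    ← neg_div, eq_div_iff hne]
  linear_combination (-r) * hdet

end LeviCivita

end Thermostat
end

noncomputable section
namespace Thermostat

/-! ### The Jacobi equation of a thermostat in coordinates. -/

section Variation

variable {E : Type*} [NormedAddCommGroup E] [NormedSpace ℝ E]
variable {G : E → (E →L[ℝ] E →L[ℝ] ℝ)} {Γ : E → (E →L[ℝ] E →L[ℝ] E)} {J : E → E →L[ℝ] E}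

theorem hasDerivAt_bilin {F : Type*} [NormedAddCommGroup F] [NormedSpace ℝ F]
    {B : E → (E →L[ℝ] E →L[ℝ] F)} {y P Q : ℝ → E} {y' P' Q' : E} {t : ℝ}
    (hB : DifferentiableAt ℝ B (y t))
    (hy : HasDerivAt y y' t) (hP : HasDerivAt P P' t) (hQ : HasDerivAt Q Q' t) :
    HasDerivAt (fun s => B (y s) (P s) (Q s))
      (fderiv ℝ B (y t) y' (P t) (Q t) + B (y t) P' (Q t) + B (y t) (P t) Q') t := by
  have h1 := hB.hasFDerivAt.comp_hasDerivAt t hy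
  have h2 := (h1.clm_apply hP).clm_apply hQ
  refine h2.congr_deriv ?_
  simp only [add_apply, Function.comp]

/-- The product rule for the covariant derivative along a curve. -/
theorem LeviCivita.hasDerivAt_metric {y P Q : ℝ → E} {y' P' Q' : E} {t : ℝ}
    (h : LeviCivita G Γ (y t))
    (hy : HasDerivAt y y' t) (hP : HasDerivAt P P' t) (hQ : HasDerivAt Q Q' t) :
    HasDerivAt (fun s => G (y s) (P s) (Q s))
      (G (y t) (P' + Γ (y t) y' (P t)) (Q t) + G (y t) (P t) (Q' + Γ (y t) y' (Q t))) t := by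
  refine (hasDerivAt_bilin h.differentiableAt_metric hy hP hQ).congr_deriv ?_
  rw [h.compat]
  simp only [map_add, add_apply]
  ring

/-- The variational equations of the thermostat, in the orthonormal frame `v`, `J v`. -/
theorem LeviCivita.variation [Fact (Module.finrank ℝ E = 2)] {y v a b : ℝ → E} {t k dk : ℝ}
    (h : ∀ᶠ z in 𝓝 (y t), LeviCivita G Γ z) (hJ : ∀ᶠ z in 𝓝 (y t), Rotation G J z)
    {e₀ e₁ : E} (he : ∀ w : E, ∃ c d : ℝ, w = c • e₀ + d • e₁)
    (hy : HasDerivAt y (v t) t)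
    (hv : HasDerivAt v (-Γ (y t) (v t) (v t) + k • J (y t) (v t)) t)
    (ha : HasDerivAt a (b t) t)
    (hb : HasDerivAt b (-(fderiv ℝ Γ (y t) (a t) (v t) (v t) + Γ (y t) (b t) (v t) +
      Γ (y t) (v t) (b t)) + (dk • J (y t) (v t) +
        k • (fderiv ℝ J (y t) (a t) (v t) + J (y t) (b t)))) t)
    (hunit : G (y t) (v t) (v t) = 1)
    (htan : G (y t) (v t) (b t + Γ (y t) (a t) (v t)) = 0) :
    HasDerivAt (fun s => G (y s) (v s) (a s)) (k * G (y t) (J (y t) (v t)) (a t)) t ∧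
    HasDerivAt (fun s => G (y s) (J (y s) (v s)) (a s))
      (G (y t) (J (y t) (v t)) (b t + Γ (y t) (a t) (v t)) - k * G (y t) (v t) (a t)) t ∧
    HasDerivAt (fun s => G (y s) (J (y s) (v s)) (b s + Γ (y s) (a s) (v s)))
      (-(sectional G Γ e₀ e₁ (y t) * G (y t) (J (y t) (v t)) (a t)) + dk) t := by
  have hL := h.self_of_nhds
  have hR := hJ.self_of_nhds
  have hn : HasDerivAt (fun s => J (y s) (v s))
      (fderiv ℝ J (y t) (v t) (v t) +
        J (y t) (-Γ (y t) (v t) (v t) + k • J (y t) (v t))) t := by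
    refine ((hR.differentiableAt.hasFDerivAt.comp_hasDerivAt t hy).clm_apply hv).congr_deriv ?_
    simp only [Function.comp]
  have hβ := hb.add (hasDerivAt_bilin hL.differentiableAt_conn hy ha hv)
  have pv := Rotation.parallel hL hJ (v t) (v t)
  have pa := Rotation.parallel hL hJ (a t) (v t)
  have x' := hL.hasDerivAt_metric hy hv ha
  have y' := hL.hasDerivAt_metric hy hn ha
  have z' := hL.hasDerivAt_metric hy hn hβ
  simp only [Pi.add_apply] at z'
  set Y := y t
  set v₀ := v t
  set a₀ := a t
  set b₀ := b t
  set n := J Y v₀ with hndef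
  have hJJ : J Y n = -v₀ := hR.sq v₀
  have e1 : -Γ Y v₀ v₀ + k • n + Γ Y v₀ v₀ = k • n := by abel
  have e2 : b₀ + Γ Y v₀ a₀ = b₀ + Γ Y a₀ v₀ := by rw [hL.torsion]
  have e3 : fderiv ℝ J Y v₀ v₀ + J Y (-Γ Y v₀ v₀ + k • n) + Γ Y v₀ n = -(k • v₀) := by
    rw [pv, map_add, map_neg, map_smul, hJJ, smul_neg]
    abel
  have hnn : G Y n n = 1 := by rw [hR.isometry, hunit]
  have hnv : G Y n v₀ = 0 := hR.inner_self hL v₀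
  have hvn : G Y v₀ n = 0 := by rw [hL.symm]; exact hnv
  refine ⟨x'.congr_deriv ?_, y'.congr_deriv ?_, z'.congr_deriv ?_⟩
  · rw [e1, e2, htan, map_smul, smul_apply, smul_eq_mul, add_zero]
  · rw [e2, e3, map_neg, map_smul, neg_apply, smul_apply, smul_eq_mul]
    ring
  · rw [e3]
    -- The covariant derivative of `b + Γ(a, v)` along the curve: the derivatives of `Γ` from the
    -- linearised equation and from the moving point combine into the curvature, and parallelism of
    -- `J` puts the rest into covariant form.
    have e4 : -(fderiv ℝ Γ Y a₀ v₀ v₀ + Γ Y b₀ v₀ + Γ Y v₀ b₀) +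
          (dk • n + k • (fderiv ℝ J Y a₀ v₀ + J Y b₀)) +
          (fderiv ℝ Γ Y v₀ a₀ v₀ + Γ Y b₀ v₀ + Γ Y a₀ (-Γ Y v₀ v₀ + k • n)) +
          Γ Y v₀ (b₀ + Γ Y a₀ v₀) =
        riemann Γ Y v₀ a₀ v₀ + dk • n + k • J Y (b₀ + Γ Y a₀ v₀) := by
      rw [pa]
      simp only [riemann, map_add, map_neg, map_smul, smul_add, smul_sub]
      abel
    rw [e4]
    have e5 : a₀ = G Y v₀ a₀ • v₀ + G Y n a₀ • n := hL.expand hunit hnn hvn a₀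
    -- Only the component of `a` along `J v` contributes, as `R(v, v) = 0`.
    have e6 : riemann Γ Y v₀ a₀ v₀ = G Y n a₀ • riemann Γ Y v₀ n v₀ := by
      conv_lhs => rw [e5]
      rw [riemann_add_right, riemann_smul_right, riemann_smul_right, riemann_self, smul_zero,
        zero_add]
    obtain ⟨c, d, ev⟩ := he v₀
    obtain ⟨c', d', en⟩ := he n
    have e7 := LeviCivita.sectional_eq h ev en hunit hnn hvn
    -- By `htan` the vector `b + Γ(a, v)` is orthogonal to `v`, so its rotation is orthogonal to `J
    -- v`.
    have e8 : G Y n (J Y (b₀ + Γ Y a₀ v₀)) = 0 := by rw [hndef, hR.isometry, htan]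
    simp only [map_add (G Y n), map_smul, map_neg, neg_apply, smul_apply, smul_eq_mul, htan, e6,
      e7, hnn, e8]
    ring

end Variation

end Thermostat
end

noncomputable section
namespace Thermostat

/-! ### The metric, connection and curvature of the surface in a preferred chart. -/

section ChartGeometry

variable {M : Type*} [TopologicalSpace M] [ChartedSpace E2 M] [IsManifold 𝓘(ℝ, E2) ∞ M]

/-- The components of a tangent vector in the preferred chart at `x₀`. -/
def coordVec (x₀ x : M) : TangentSpace 𝓘(ℝ, E2) x →L[ℝ] E2 :=
  mfderiv 𝓘(ℝ, E2) 𝓘(ℝ, E2) (chartAt E2 x₀) x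

theorem trivializationAt_mk_snd (x₀ : M) {x : M} (hx : x ∈ (chartAt E2 x₀).source)
    (v : TangentSpace 𝓘(ℝ, E2) x) :
    (trivializationAt E2 (TangentSpace 𝓘(ℝ, E2)) x₀ ⟨x, v⟩).2 = coordVec x₀ x v :=
  trivializationAt_tangent_snd x₀ hx v

theorem coordVec_frameVec (x₀ : M) {x : M} (hx : x ∈ (chartAt E2 x₀).source) (w : E2) :
    coordVec x₀ x (frameVec x₀ x w) = w := by
  rw [← trivializationAt_mk_snd x₀ hx]
  exact congrArg Prod.snd
    ((trivializationAt E2 (TangentSpace 𝓘(ℝ, E2)) x₀).apply_mk_symm hx w)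

theorem frameVec_coordVec (x₀ : M) {x : M} (hx : x ∈ (chartAt E2 x₀).source)
    (v : TangentSpace 𝓘(ℝ, E2) x) : frameVec x₀ x (coordVec x₀ x v) = v := by
  rw [← trivializationAt_mk_snd x₀ hx]
  exact (trivializationAt E2 (TangentSpace 𝓘(ℝ, E2)) x₀).symm_apply_apply_mk hx v

theorem coordVec_injective (x₀ : M) {x : M} (hx : x ∈ (chartAt E2 x₀).source) :
    Function.Injective (coordVec x₀ x) :=
  Function.LeftInverse.injective (frameVec_coordVec x₀ hx)

theorem frameVec_add (x₀ : M) {x : M} (hx : x ∈ (chartAt E2 x₀).source) (v w : E2) :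
    frameVec x₀ x (v + w) = frameVec x₀ x v + frameVec x₀ x w := by
  apply coordVec_injective x₀ hx
  rw [map_add]
  simp only [coordVec_frameVec x₀ hx]

theorem frameVec_smul (x₀ : M) {x : M} (hx : x ∈ (chartAt E2 x₀).source) (c : ℝ) (v : E2) :
    frameVec x₀ x (c • v) = c • frameVec x₀ x v := by
  apply coordVec_injective x₀ hx
  rw [map_smul]
  simp only [coordVec_frameVec x₀ hx]

/-- The tangent space at `x` is modelled on the preferred chart at `x`, so the derivative of that
chart at `x` is the identity. This justifies definitions such as `christoffelVec` and `natVec`,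
which read tangent vectors at `x` as elements of the plane. -/
theorem coordVec_self (x : M) (v : TangentSpace 𝓘(ℝ, E2) x) : coordVec x x v = v := by
  rw [← trivializationAt_mk_snd x (mem_chart_source E2 x), TangentBundle.trivializationAt_apply]
  have : fderivWithin ℝ ((chartAt E2 x).extend 𝓘(ℝ, E2) ∘ ((chartAt E2 x).extend 𝓘(ℝ, E2)).symm)
      (Set.range 𝓘(ℝ, E2)) ((chartAt E2 x).extend 𝓘(ℝ, E2) x) =
      ContinuousLinearMap.id ℝ E2 := by
    simp only [modelWithCornersSelf_coe, Set.range_id, fderivWithin_univ]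
    refine HasFDerivAt.fderiv ((hasFDerivAt_id _).congr_of_eventuallyEq ?_)
    filter_upwards [(chartAt E2 x).open_target.mem_nhds
      ((chartAt E2 x).map_source (mem_chart_source E2 x))] with z hz
    exact (chartAt E2 x).right_inv hz
  exact DFunLike.congr_fun this v

theorem tmChart_apply (q : TangentBundle 𝓘(ℝ, E2) M) {x : M}
    (hx : x ∈ (chartAt E2 q.1).source) (v : TangentSpace 𝓘(ℝ, E2) x) :
    tmChart q ⟨x, v⟩ = (chartAt E2 q.1 x, coordVec q.1 x v) :=
  Prod.ext rfl (trivializationAt_mk_snd q.1 hx v)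

theorem tmChart_symm_apply (q : TangentBundle 𝓘(ℝ, E2) M) {z : E2 × E2}
    (hz : z.1 ∈ (chartAt E2 q.1).target) :
    (tmChart q).symm z = ⟨(chartAt E2 q.1).symm z.1, frameVec q.1 _ z.2⟩ := by
  have hx := (chartAt E2 q.1).map_target hz
  refine (tmChart q).injOn ((tmChart q).map_target ((mem_tmChart_target _ _).2 hz))
    ((mem_tmChart_source _ _).2 hx) ?_
  rw [(tmChart q).right_inv ((mem_tmChart_target _ _).2 hz), tmChart_apply q hx,
    coordVec_frameVec q.1 hx, (chartAt E2 q.1).right_inv hz]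

theorem eq_sum_stdVec (w : E2) : w = w 0 • stdVec 0 + w 1 • stdVec 1 := by
  ext i
  fin_cases i <;> simp [stdVec]

instance : Fact (Module.finrank ℝ E2 = 2) := ⟨finrank_euclideanSpace_fin⟩

/-- The bilinear form on the plane with values `c i j` on the standard basis. -/
def bilinForm {F : Type*} [NormedAddCommGroup F] [NormedSpace ℝ F] (c : Fin 2 → Fin 2 → F) :
    E2 →L[ℝ] E2 →L[ℝ] F :=
  ∑ i, ∑ j, (EuclideanSpace.proj i : E2 →L[ℝ] ℝ).smulRight
    ((EuclideanSpace.proj j : E2 →L[ℝ] ℝ).smulRight (c i j))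

theorem bilinForm_apply {F : Type*} [NormedAddCommGroup F] [NormedSpace ℝ F]
    (c : Fin 2 → Fin 2 → F) (a b : E2) :
    bilinForm c a b = ∑ i, ∑ j, (a i * b j) • c i j := by
  simp [bilinForm, smul_smul]

theorem bilinForm_stdVec {F : Type*} [NormedAddCommGroup F] [NormedSpace ℝ F]
    (c : Fin 2 → Fin 2 → F) (i j : Fin 2) : bilinForm c (stdVec i) (stdVec j) = c i j := by
  rw [bilinForm_apply]
  fin_cases i <;> fin_cases j <;> simp [stdVec]

theorem contDiffAt_bilinForm {F : Type*} [NormedAddCommGroup F] [NormedSpace ℝ F]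
    {c : Fin 2 → Fin 2 → E2 → F} {y : E2} (hc : ∀ i j, ContDiffAt ℝ ∞ (c i j) y) :
    ContDiffAt ℝ ∞ (fun z => bilinForm fun i j => c i j z) y := by
  unfold bilinForm
  refine ContDiffAt.sum fun i _ => ContDiffAt.sum fun j _ => ?_
  exact contDiffAt_const.smulRight (contDiffAt_const.smulRight (hc i j))

theorem hasFDerivAt_bilinForm {F : Type*} [NormedAddCommGroup F] [NormedSpace ℝ F]
    {c : Fin 2 → Fin 2 → E2 → F} {y : E2} (hc : ∀ i j, DifferentiableAt ℝ (c i j) y) (a b d : E2) :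
    DifferentiableAt ℝ (fun z => bilinForm fun i j => c i j z) y →
    fderiv ℝ (fun z => bilinForm fun i j => c i j z) y a b d =
      ∑ i, ∑ j, (b i * d j) • fderiv ℝ (c i j) y a := by
  intro h
  have h1 : HasFDerivAt (fun z => bilinForm (fun i j => c i j z) b d) _ y :=
    (h.hasFDerivAt.clm_apply (hasFDerivAt_const b y)).clm_apply (hasFDerivAt_const d y)
  have h2 : HasFDerivAt (fun z => bilinForm (fun i j => c i j z) b d)
      (∑ i, ∑ j, (b i * d j) • fderiv ℝ (c i j) y) y := by
    simp only [bilinForm_apply]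
    exact HasFDerivAt.fun_sum fun i _ => HasFDerivAt.fun_sum fun j _ =>
      (hc i j).hasFDerivAt.const_smul _
  have := DFunLike.congr_fun (h1.unique h2) a
  simpa using this

variable (g : SurfaceMetric M)

/-- The metric in the preferred chart at `x₀`. -/
def metricForm (x₀ : M) (y : E2) : E2 →L[ℝ] E2 →L[ℝ] ℝ :=
  bilinForm fun i j => gram g x₀ y i j

/-- The Levi-Civita connection in the preferred chart at `x₀`. -/
def connForm (x₀ : M) (y : E2) : E2 →L[ℝ] E2 →L[ℝ] E2 :=
  bilinForm fun i j => ∑ k, christoffel g x₀ k i j y • stdVec k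

theorem metricForm_apply (x₀ : M) {y : E2} (hy : y ∈ (chartAt E2 x₀).target) (a b : E2) :
    metricForm g x₀ y a b =
      g.inner ((chartAt E2 x₀).symm y) (frameVec x₀ _ a) (frameVec x₀ _ b) := by
  have hx := (chartAt E2 x₀).map_target hy
  rw [metricForm, bilinForm_apply]
  simp only [gram, Matrix.of_apply]
  generalize (chartAt E2 x₀).symm y = x at hx ⊢
  have lin : ∀ (u : TangentSpace 𝓘(ℝ, E2) x) (w : E2), g.inner x u (frameVec x₀ x w) =
      w 0 * g.inner x u (frameVec x₀ x (stdVec 0)) +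
        w 1 * g.inner x u (frameVec x₀ x (stdVec 1)) := by
    intro u w
    conv_lhs => rw [eq_sum_stdVec w]
    rw [frameVec_add x₀ hx, frameVec_smul x₀ hx, frameVec_smul x₀ hx, map_add, map_smul, map_smul]
    rfl
  rw [lin _ b, g.symm _ (frameVec x₀ x a) (frameVec x₀ x (stdVec 0)),
    g.symm _ (frameVec x₀ x a) (frameVec x₀ x (stdVec 1)), lin _ a, lin _ a]
  simp only [Fin.sum_univ_two, smul_eq_mul]
  rw [g.symm x (frameVec x₀ x (stdVec 1)) (frameVec x₀ x (stdVec 0))]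
  ring

theorem metricForm_coordVec (x₀ : M) {x : M} (hx : x ∈ (chartAt E2 x₀).source)
    (a b : TangentSpace 𝓘(ℝ, E2) x) :
    metricForm g x₀ (chartAt E2 x₀ x) (coordVec x₀ x a) (coordVec x₀ x b) = g.inner x a b := by
  rw [metricForm_apply g x₀ ((chartAt E2 x₀).map_source hx), (chartAt E2 x₀).left_inv hx,
    frameVec_coordVec x₀ hx, frameVec_coordVec x₀ hx]

theorem metricForm_symm (x₀ : M) {y : E2} (hy : y ∈ (chartAt E2 x₀).target) (a b : E2) :
    metricForm g x₀ y a b = metricForm g x₀ y b a := by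
  rw [metricForm_apply g x₀ hy, metricForm_apply g x₀ hy, g.symm]

theorem metricForm_pos (x₀ : M) {y : E2} (hy : y ∈ (chartAt E2 x₀).target) (a : E2) (ha : a ≠ 0) :
    0 < metricForm g x₀ y a a := by
  rw [metricForm_apply g x₀ hy]
  refine g.pos _ _ fun h => ha ?_
  have h1 := coordVec_frameVec x₀ ((chartAt E2 x₀).map_target hy) a
  rw [h, map_zero] at h1
  exact h1.symm

theorem gram_eq (x₀ : M) (y : E2) (i j : Fin 2) :
    gram g x₀ y i j = metricForm g x₀ y (stdVec i) (stdVec j) :=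
  (bilinForm_stdVec _ i j).symm

theorem gram_symm (x₀ : M) (y : E2) (i j : Fin 2) : gram g x₀ y i j = gram g x₀ y j i :=
  g.symm _ _ _

/-- Transfers the smoothness of `normSq` on `TM` to the metric coefficients. The zero vector at `x₀`
only serves to select the chart. -/
theorem metricForm_self (x₀ : M) {y : E2} (hy : y ∈ (chartAt E2 x₀).target) (a : E2) :
    metricForm g x₀ y a a = normSq g ((tmChart (⟨x₀, 0⟩ : TangentBundle 𝓘(ℝ, E2) M)).symm (y, a)) := by
  rw [tmChart_symm_apply _ hy, metricForm_apply g x₀ hy]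
  rfl

theorem contDiffAt_gram (x₀ : M) {y : E2} (hy : y ∈ (chartAt E2 x₀).target) (i j : Fin 2) :
    ContDiffAt ℝ ∞ (fun z => gram g x₀ z i j) y := by
  set q : TangentBundle 𝓘(ℝ, E2) M := ⟨x₀, 0⟩
  have hN : ∀ a : E2, ContDiffAt ℝ ∞ (fun z => metricForm g x₀ z a a) y := by
    intro a
    have h1 : ContMDiffAt 𝓘(ℝ, E2 × E2) (𝓘(ℝ, E2).prod 𝓘(ℝ, E2)) ∞
        (tmChart q).symm (y, a) := by
      refine (contMDiffOn_extChartAt_symm (I := 𝓘(ℝ, E2).prod 𝓘(ℝ, E2)) (n := ∞) q).contMDiffAt ?_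
      refine (isOpen_extChartAt_target q).mem_nhds ?_
      rw [extChartAt_target]
      refine ⟨(mem_tmChart_target q (y, a)).2 hy, ?_⟩
      simp
    have h2 : ContMDiffAt 𝓘(ℝ, E2 × E2) 𝓘(ℝ, ℝ) ∞ (fun z => normSq g ((tmChart q).symm z)) (y, a) :=
      (contMDiff_normSq g).contMDiffAt.comp (y, a) h1
    have h3 := h2.contDiffAt
    have h4 : ContDiffAt ℝ ∞ (fun z : E2 => normSq g ((tmChart q).symm (z, a))) y :=
      h3.comp y (contDiffAt_id.prodMk contDiffAt_const)
    refine h4.congr_of_eventuallyEq ?_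
    filter_upwards [(chartAt E2 x₀).open_target.mem_nhds hy] with z hz
    exact metricForm_self g x₀ hz a
  -- Polarisation: off-diagonal coefficients are recovered from squared lengths.
  have h := (((hN (stdVec i + stdVec j)).sub (hN (stdVec i))).sub (hN (stdVec j))).div_const 2
  refine h.congr_of_eventuallyEq ?_
  filter_upwards [(chartAt E2 x₀).open_target.mem_nhds hy] with z hz
  rw [gram_eq]
  simp only [map_add, add_apply]
  rw [metricForm_symm g x₀ hz (stdVec j) (stdVec i)]
  ring

theorem contDiffAt_metricForm (x₀ : M) {y : E2} (hy : y ∈ (chartAt E2 x₀).target) :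
    ContDiffAt ℝ ∞ (metricForm g x₀) y :=
  contDiffAt_bilinForm fun i j => contDiffAt_gram g x₀ hy i j

theorem gram_det (x₀ : M) (y : E2) : (gram g x₀ y).det =
    gram g x₀ y 0 0 * gram g x₀ y 1 1 - gram g x₀ y 0 1 * gram g x₀ y 0 1 := by
  rw [Matrix.det_fin_two, gram_symm g x₀ y 1 0]

theorem gram_det_pos (x₀ : M) {y : E2} (hy : y ∈ (chartAt E2 x₀).target) :
    0 < (gram g x₀ y).det := by
  have h0 : 0 < gram g x₀ y 0 0 := by
    rw [gram_eq]
    exact metricForm_pos g x₀ hy _ (by simp [stdVec])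
  -- The vector `(-g₀₁, g₀₀)` has squared length `g₀₀` times the determinant.
  have h1 := metricForm_pos g x₀ hy (-gram g x₀ y 0 1 • stdVec 0 + gram g x₀ y 0 0 • stdVec 1) (by
    intro h
    have := congrArg (fun w : E2 => w 1) h
    simp [stdVec] at this
    exact h0.ne' this)
  rw [metricForm, bilinForm_apply] at h1
  simp [Fin.sum_univ_two, stdVec] at h1
  rw [gram_symm g x₀ y 1 0] at h1
  rw [gram_det]
  refine pos_of_mul_pos_right (a := gram g x₀ y 0 0) ?_ h0.le
  linarith

theorem contDiffAt_gram_det (x₀ : M) {y : E2} (hy : y ∈ (chartAt E2 x₀).target) :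
    ContDiffAt ℝ ∞ (fun z => (gram g x₀ z).det) y := by
  simp only [gram_det]
  exact ((contDiffAt_gram g x₀ hy 0 0).mul (contDiffAt_gram g x₀ hy 1 1)).sub
    ((contDiffAt_gram g x₀ hy 0 1).mul (contDiffAt_gram g x₀ hy 0 1))

theorem gram_inv_apply (x₀ : M) (y : E2) : (gram g x₀ y)⁻¹ =
    ((gram g x₀ y).det)⁻¹ • !![gram g x₀ y 1 1, -gram g x₀ y 0 1; -gram g x₀ y 0 1, gram g x₀ y 0 0] := by
  rw [Matrix.inv_def, Matrix.adjugate_fin_two, Ring.inverse_eq_inv', gram_symm g x₀ y 1 0]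

theorem contDiffAt_gram_inv (x₀ : M) {y : E2} (hy : y ∈ (chartAt E2 x₀).target) (i j : Fin 2) :
    ContDiffAt ℝ ∞ (fun z => (gram g x₀ z)⁻¹ i j) y := by
  have hd := (contDiffAt_gram_det g x₀ hy).inv (gram_det_pos g x₀ hy).ne'
  have h := contDiffAt_gram g x₀ hy
  simp only [gram_inv_apply, Matrix.smul_apply, smul_eq_mul]
  refine hd.mul ?_
  fin_cases i <;> fin_cases j <;> simp
  exacts [h 1 1, (h 0 1).neg, (h 0 1).neg, h 0 0]

theorem contDiffAt_pd {f : E2 → ℝ} {y : E2} (hf : ContDiffAt ℝ ∞ f y) (i : Fin 2) :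
    ContDiffAt ℝ ∞ (pd i f) y := by
  unfold pd
  exact (hf.fderiv_right (m := ∞) le_rfl).clm_apply contDiffAt_const

theorem contDiffAt_christoffel (x₀ : M) {y : E2} (hy : y ∈ (chartAt E2 x₀).target)
    (k i j : Fin 2) : ContDiffAt ℝ ∞ (christoffel g x₀ k i j) y := by
  unfold christoffel
  refine contDiffAt_const.mul (ContDiffAt.sum fun l _ => (contDiffAt_gram_inv g x₀ hy k l).mul ?_)
  exact ((contDiffAt_pd (contDiffAt_gram g x₀ hy j l) i).add
    (contDiffAt_pd (contDiffAt_gram g x₀ hy i l) j)).sub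
    (contDiffAt_pd (contDiffAt_gram g x₀ hy i j) l)

theorem contDiffAt_connForm (x₀ : M) {y : E2} (hy : y ∈ (chartAt E2 x₀).target) :
    ContDiffAt ℝ ∞ (connForm g x₀) y :=
  contDiffAt_bilinForm (c := fun i j z => ∑ k, christoffel g x₀ k i j z • stdVec k) fun i j =>
    ContDiffAt.sum fun k _ => (contDiffAt_christoffel g x₀ hy k i j).smul contDiffAt_const

theorem christoffel_symm (x₀ : M) (k i j : Fin 2) (y : E2) :
    christoffel g x₀ k i j y = christoffel g x₀ k j i y := by
  unfold christoffel
  congr 1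
  refine Finset.sum_congr rfl fun l _ => ?_
  have : (fun z => gram g x₀ z i j) = fun z => gram g x₀ z j i :=
    funext fun z => gram_symm g x₀ z i j
  rw [this]
  ring

/-- The Christoffel symbols of the first kind. -/
theorem sum_christoffel_mul_gram (x₀ : M) {y : E2} (hy : y ∈ (chartAt E2 x₀).target)
    (i j k : Fin 2) : ∑ l, christoffel g x₀ l k i y * gram g x₀ y l j =
      (1 / 2) * (pd k (fun z => gram g x₀ z i j) y + pd i (fun z => gram g x₀ z k j) y
        - pd j (fun z => gram g x₀ z k i) y) := by
  have hdet : IsUnit (gram g x₀ y).det := (gram_det_pos g x₀ hy).ne'.isUnit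
  have hinv := Matrix.mul_nonsing_inv (gram g x₀ y) hdet
  have hc : ∀ m, ∑ l, gram g x₀ y j l * (gram g x₀ y)⁻¹ l m = if j = m then 1 else 0 := by
    intro m
    have := congrFun (congrFun hinv j) m
    rwa [Matrix.mul_apply, Matrix.one_apply] at this
  set f : Fin 2 → ℝ := fun l => pd k (fun z => gram g x₀ z i l) y + pd i (fun z => gram g x₀ z k l) y
        - pd l (fun z => gram g x₀ z k i) y with hf
  have h1 : ∀ l, christoffel g x₀ l k i y = (1 / 2) * ∑ m, (gram g x₀ y)⁻¹ l m * f m := fun l => rfl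
  have c0 := hc 0
  have c1 := hc 1
  simp only [Fin.sum_univ_two] at c0 c1 ⊢
  change _ = 1 / 2 * f j
  rw [h1, h1]
  simp only [Fin.sum_univ_two]
  rw [gram_symm g x₀ y 0 j, gram_symm g x₀ y 1 j]
  have : f j = (if j = 0 then 1 else 0) * f 0 + (if j = 1 then 1 else 0) * f 1 := by
    fin_cases j <;> simp
  rw [this, ← c0, ← c1]
  ring

/-- By `sum_christoffel_mul_gram`, the sum of the Christoffel symbols of the first kind for `(i, j)`
and for `(j, i)` leaves only the derivative of `g_ij`. -/
theorem metricForm_connForm (x₀ : M) {y : E2} (hy : y ∈ (chartAt E2 x₀).target) (a b c : E2) :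
    fderiv ℝ (metricForm g x₀) y a b c = metricForm g x₀ y (connForm g x₀ y a b) c +
      metricForm g x₀ y b (connForm g x₀ y a c) := by
  have hd : ∀ i j, DifferentiableAt ℝ (fun z => gram g x₀ z i j) y := fun i j =>
    (contDiffAt_gram g x₀ hy i j).differentiableAt (by simp)
  have h0 : fderiv ℝ (metricForm g x₀) y a b c =
      ∑ i, ∑ j, (b i * c j) • fderiv ℝ (fun z => gram g x₀ z i j) y a :=
    hasFDerivAt_bilinForm hd a b c ((contDiffAt_metricForm g x₀ hy).differentiableAt (by simp))
  have h1 : ∀ i j, fderiv ℝ (fun z => gram g x₀ z i j) y a =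
      ∑ k, a k * (∑ l, christoffel g x₀ l k i y * gram g x₀ y l j +
        ∑ l, christoffel g x₀ l k j y * gram g x₀ y l i) := by
    intro i j
    conv_lhs => rw [eq_sum_stdVec a]
    rw [map_add, map_smul, map_smul, Fin.sum_univ_two]
    have e : ∀ k, ∑ l, christoffel g x₀ l k i y * gram g x₀ y l j +
        ∑ l, christoffel g x₀ l k j y * gram g x₀ y l i = pd k (fun z => gram g x₀ z i j) y := by
      intro k
      rw [sum_christoffel_mul_gram g x₀ hy, sum_christoffel_mul_gram g x₀ hy]
      have : (fun z => gram g x₀ z j i) = fun z => gram g x₀ z i j :=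
        funext fun z => gram_symm g x₀ z j i
      rw [this]
      ring
    rw [e, e]
    rfl
  rw [h0]
  simp only [h1]
  simp only [metricForm, connForm, bilinForm_apply, Fin.sum_univ_two, smul_eq_mul, PiLp.add_apply,
    PiLp.smul_apply, stdVec, PiLp.single_apply]
  simp
  rw [gram_symm g x₀ y 1 0]
  ring

theorem leviCivita (x₀ : M) {y : E2} (hy : y ∈ (chartAt E2 x₀).target) :
    LeviCivita (metricForm g x₀) (connForm g x₀) y where
  metric_smooth := contDiffAt_metricForm g x₀ hy
  conn_smooth := contDiffAt_connForm g x₀ hy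
  symm := metricForm_symm g x₀ hy
  pos := metricForm_pos g x₀ hy
  torsion a b := by
    simp only [connForm, bilinForm_apply, Fin.sum_univ_two]
    rw [christoffel_symm g x₀ 0 1 0, christoffel_symm g x₀ 1 1 0]
    module
  compat := metricForm_connForm g x₀ hy

theorem christoffelVec_eq (x : M) (a b : TangentSpace 𝓘(ℝ, E2) x) :
    christoffelVec g x a b = connForm g x (chartAt E2 x x) a b := by
  have key : ∀ a b : E2, (WithLp.toLp 2 fun k => ∑ i, ∑ j,
      christoffel g x k i j (chartAt E2 x x) * a i * b j : E2) =
        connForm g x (chartAt E2 x x) a b := by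
    intro a b
    simp only [connForm]
    rw [bilinForm_apply]
    ext i
    fin_cases i <;> simp [Fin.sum_univ_two, stdVec] <;> ring
  exact key a b

/-- Matches the coordinate formula in the definition of `gaussCurvature` with the curvature tensor,
at the centre of the preferred chart. Other charts are treated in `Adapted.sectional_eq`. -/
theorem sectional_eq_gaussCurvature (x : M) :
    sectional (metricForm g x) (connForm g x) (stdVec 0) (stdVec 1) (chartAt E2 x x) =
      gaussCurvature g x := by
  have hy := (chartAt E2 x).map_source (mem_chart_source E2 x)
  set y := chartAt E2 x x
  have hd : ∀ i j, DifferentiableAt ℝ (fun z => ∑ k, christoffel g x k i j z • stdVec k) y :=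
    fun i j => (ContDiffAt.sum fun k _ =>
      (contDiffAt_christoffel g x hy k i j).smul contDiffAt_const).differentiableAt (by simp)
  have hΓ : ∀ a b c : E2, fderiv ℝ (connForm g x) y a b c =
      ∑ i, ∑ j, (b i * c j) • ∑ k, fderiv ℝ (christoffel g x k i j) y a • stdVec k := by
    intro a b c
    have h1 := hasFDerivAt_bilinForm hd a b c
      ((contDiffAt_connForm g x hy).differentiableAt (by simp))
    refine h1.trans ?_
    refine Finset.sum_congr rfl fun i _ => Finset.sum_congr rfl fun j _ => ?_
    congr 1
    have h2 : HasFDerivAt (fun z => ∑ k, christoffel g x k i j z • stdVec k)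
        (∑ k, (fderiv ℝ (christoffel g x k i j) y).smulRight (stdVec k)) y :=
      HasFDerivAt.fun_sum fun k _ => ((contDiffAt_christoffel g x hy k i j).differentiableAt
        (by simp)).hasFDerivAt.smul_const _
    rw [h2.fderiv]
    simp
  unfold sectional gaussCurvature
  rw [Matrix.det_fin_two, gram_eq, gram_eq, gram_eq, gram_eq]
  congr 1
  have hcomp : ∀ l, riemann (connForm g x) y (stdVec 0) (stdVec 1) (stdVec 1) l =
      curvatureComp g x l y := by
    intro l
    simp only [riemann, hΓ]
    simp only [connForm, bilinForm_apply, curvatureComp, pd, Fin.sum_univ_two]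
    fin_cases l <;> simp [stdVec] <;> ring
  simp only [metricForm]
  rw [bilinForm_apply]
  simp only [hcomp, Fin.sum_univ_two]
  simp [stdVec]
  ring

end ChartGeometry

end Thermostat
end

/-! ### The rotation by a quarter turn in a preferred chart. -/

noncomputable section
namespace Thermostat

/-- The sign of an orientation of the coordinate plane. -/
theorem exists_sign_det_rightAngleRotation (o₀ : Orientation ℝ E2 (Fin 2)) :
    ∃ ε : ℝ, ε * ε = 1 ∧ ∀ (E : Type) [NormedAddCommGroup E] [InnerProductSpace ℝ E]
      [Fact (Module.finrank ℝ E = 2)] (o : Orientation ℝ E (Fin 2)) (e : E ≃ₗ[ℝ] E2),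
      Orientation.map (Fin 2) e o = o₀ → ∀ v : E, v ≠ 0 →
      0 < ε * (e v 0 * e (o.rightAngleRotation v) 1 - e v 1 * e (o.rightAngleRotation v) 0) := by
  set sb := (EuclideanSpace.basisFun (Fin 2) ℝ).toBasis
  have hdet : ∀ w n : E2, sb.det ![w, n] = w 0 * n 1 - w 1 * n 0 := by
    intro w n
    rw [Module.Basis.det_apply, Matrix.det_fin_two]
    simp [Module.Basis.toMatrix_apply, sb]
    ring
  -- The basis `(v, J v)` is positive because the area form takes the value `|v|²` on it; an
  -- isomorphism carrying the orientation to `o₀` carries it to a basis of orientation `o₀`, whose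
  -- determinant then has a fixed sign.
  have horient : ∀ (E : Type) [NormedAddCommGroup E] [InnerProductSpace ℝ E]
      [Fact (Module.finrank ℝ E = 2)] (o : Orientation ℝ E (Fin 2)) (e : E ≃ₗ[ℝ] E2),
      Orientation.map (Fin 2) e o = o₀ → ∀ (v : E) (hv : v ≠ 0),
      ((o.basisRightAngleRotation v hv).map e).orientation = o₀ := by
    intro E _ _ _ o e he v hv
    rw [Module.Basis.orientation_map, ← he]
    congr 1
    set b := o.finOrthonormalBasis (n := 2) (by norm_num) Fact.out
    have hb : b.toBasis.orientation = o := o.finOrthonormalBasis_orientation _ _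
    suffices b.toBasis.orientation = (o.basisRightAngleRotation v hv).orientation by
      rw [← this, hb]
    rw [Module.Basis.orientation_eq_iff_det_pos,
      ← o.volumeForm_robust b hb, Orientation.coe_basisRightAngleRotation,
      ← Orientation.areaForm_to_volumeForm, Orientation.areaForm_rightAngleRotation_right]
    exact real_inner_self_pos.2 hv
  have hcoe : ∀ (E : Type) [NormedAddCommGroup E] [InnerProductSpace ℝ E]
      [Fact (Module.finrank ℝ E = 2)] (o : Orientation ℝ E (Fin 2)) (e : E ≃ₗ[ℝ] E2) (v : E)
      (hv : v ≠ 0), ⇑((o.basisRightAngleRotation v hv).map e) =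
        ![e v, e (o.rightAngleRotation v)] := by
    intro E _ _ _ o e v hv
    funext i
    fin_cases i <;> simp
  rcases sb.orientation_eq_or_eq_neg o₀ with h | h
  · refine ⟨1, by norm_num, fun E _ _ _ o e he v hv => ?_⟩
    have h1 := horient E o e he v hv
    rw [h, eq_comm, Module.Basis.orientation_eq_iff_det_pos] at h1
    rw [hcoe] at h1
    rwa [one_mul, ← hdet]
  · refine ⟨-1, by norm_num, fun E _ _ _ o e he v hv => ?_⟩
    have h1 := horient E o e he v hv
    have h2 : ¬ 0 < sb.det ((o.basisRightAngleRotation v hv).map e) := by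
      rw [← Module.Basis.orientation_eq_iff_det_pos, h1, eq_comm]
      rw [← Module.Basis.orientation_ne_iff_eq_neg] at h
      exact h
    have h3 := (sb.isUnit_det ((o.basisRightAngleRotation v hv).map e)).ne_zero
    have h4 : sb.det ((o.basisRightAngleRotation v hv).map e) < 0 :=
      lt_of_le_of_ne (not_lt.1 h2) h3
    rw [hcoe] at h4
    rwa [neg_one_mul, ← hdet, neg_pos]

section ChartRotation

variable {M : Type*} [TopologicalSpace M] [ChartedSpace E2 M] [IsManifold 𝓘(ℝ, E2) ∞ M]
variable (g : SurfaceMetric M) (o : SurfaceOrientation M)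

/-- The rotation by `±π/2` of the coordinate plane with the metric `g`. -/
def signedRotForm (x₀ : M) (ε : ℝ) (y : E2) : E2 →L[ℝ] E2 :=
  (EuclideanSpace.proj 0 : E2 →L[ℝ] ℝ).smulRight ((ε / Real.sqrt (gram g x₀ y).det) •
      (-gram g x₀ y 0 1 • stdVec 0 + gram g x₀ y 0 0 • stdVec 1)) +
    (EuclideanSpace.proj 1 : E2 →L[ℝ] ℝ).smulRight ((ε / Real.sqrt (gram g x₀ y).det) •
      (-gram g x₀ y 1 1 • stdVec 0 + gram g x₀ y 0 1 • stdVec 1))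

theorem signedRotForm_zero (x₀ : M) (ε : ℝ) (y w : E2) : signedRotForm g x₀ ε y w 0 =
    (ε / Real.sqrt (gram g x₀ y).det) * (-(gram g x₀ y 0 1 * w 0 + gram g x₀ y 1 1 * w 1)) := by
  simp [signedRotForm, stdVec]
  ring

theorem signedRotForm_one (x₀ : M) (ε : ℝ) (y w : E2) : signedRotForm g x₀ ε y w 1 =
    (ε / Real.sqrt (gram g x₀ y).det) * (gram g x₀ y 0 0 * w 0 + gram g x₀ y 0 1 * w 1) := by
  simp [signedRotForm, stdVec]
  ring

theorem metricForm_expand (x₀ : M) (y a b : E2) : metricForm g x₀ y a b =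
    (gram g x₀ y 0 0 * a 0 + gram g x₀ y 0 1 * a 1) * b 0 +
      (gram g x₀ y 0 1 * a 0 + gram g x₀ y 1 1 * a 1) * b 1 := by
  rw [metricForm, bilinForm_apply]
  simp only [Fin.sum_univ_two, smul_eq_mul]
  rw [gram_symm g x₀ y 1 0]
  ring

/-- The matrix is a multiple of the standard rotation composed with the Gram matrix, and `J² = -1`
and the isometry property both reduce to the normalisation `hc` of the scalar factor. -/
theorem rotation_signedRotForm (x₀ : M) {ε : ℝ} (hε : ε * ε = 1) {y : E2}
    (hy : y ∈ (chartAt E2 x₀).target) :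
    Rotation (metricForm g x₀) (signedRotForm g x₀ ε) y := by
  have hd := gram_det_pos g x₀ hy
  have hc : (ε / Real.sqrt (gram g x₀ y).det) * (ε / Real.sqrt (gram g x₀ y).det) *
      (gram g x₀ y 0 0 * gram g x₀ y 1 1 - gram g x₀ y 0 1 * gram g x₀ y 0 1) = 1 := by
    rw [← gram_det, div_mul_div_comm, hε, Real.mul_self_sqrt hd.le, one_div,
      inv_mul_cancel₀ hd.ne']
  refine ⟨?_, fun a => ?_, fun a b => ?_⟩
  · have hs : ContDiffAt ℝ ∞ (fun z => ε / Real.sqrt (gram g x₀ z).det) y :=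
      contDiffAt_const.div ((contDiffAt_gram_det g x₀ hy).sqrt hd.ne') (Real.sqrt_pos.2 hd).ne'
    have h := contDiffAt_gram g x₀ hy
    unfold signedRotForm
    refine ContDiffAt.add ?_ ?_
    · exact contDiffAt_const.smulRight (hs.smul
        (((h 0 1).neg.smul contDiffAt_const).add ((h 0 0).smul contDiffAt_const)))
    · exact contDiffAt_const.smulRight (hs.smul
        (((h 1 1).neg.smul contDiffAt_const).add ((h 0 1).smul contDiffAt_const)))
  · ext i
    fin_cases i
    · change signedRotForm g x₀ ε y (signedRotForm g x₀ ε y a) 0 = -(a 0)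
      rw [signedRotForm_zero, signedRotForm_zero, signedRotForm_one]
      linear_combination (-(a 0)) * hc
    · change signedRotForm g x₀ ε y (signedRotForm g x₀ ε y a) 1 = -(a 1)
      rw [signedRotForm_one, signedRotForm_zero, signedRotForm_one]
      linear_combination (-(a 1)) * hc
  · rw [metricForm_expand, metricForm_expand]
    simp only [signedRotForm_zero, signedRotForm_one]
    linear_combination ((gram g x₀ y 0 0 * a 0 + gram g x₀ y 0 1 * a 1) * b 0 +
      (gram g x₀ y 0 1 * a 0 + gram g x₀ y 1 1 * a 1) * b 1) * hc

/-- In the plane only two vectors are orthogonal to `w` and as long as `w`, and they are opposite;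
the sign of the determinant picks one. -/
theorem eq_signedRotForm (x₀ : M) {ε : ℝ} (hε : ε * ε = 1) {y : E2}
    (hy : y ∈ (chartAt E2 x₀).target) {w n : E2} (hw : w ≠ 0)
    (hwn : metricForm g x₀ y w n = 0) (hn : metricForm g x₀ y n n = metricForm g x₀ y w w)
    (hdet : 0 < ε * (w 0 * n 1 - w 1 * n 0)) : n = signedRotForm g x₀ ε y w := by
  have hd := gram_det_pos g x₀ hy
  have hP := metricForm_pos g x₀ hy w hw
  set s := Real.sqrt (gram g x₀ y).det with hs
  have hs0 : 0 < s := Real.sqrt_pos.2 hd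
  have hss : s * s = gram g x₀ y 0 0 * gram g x₀ y 1 1 - gram g x₀ y 0 1 * gram g x₀ y 0 1 := by
    rw [hs, Real.mul_self_sqrt hd.le, gram_det]
  rw [metricForm_expand] at hwn hP
  rw [metricForm_expand, metricForm_expand] at hn
  have h0 := signedRotForm_zero g x₀ ε y w
  have h1 := signedRotForm_one g x₀ ε y w
  rw [← hs] at h0 h1
  set A := gram g x₀ y 0 0
  set B := gram g x₀ y 0 1
  set C := gram g x₀ y 1 1
  set P := (A * w 0 + B * w 1) * w 0 + (B * w 0 + C * w 1) * w 1 with hPdef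
  set D := w 0 * n 1 - w 1 * n 0 with hD
  have e0 : n 0 * P = -(B * w 0 + C * w 1) * D := by
    simp only [hPdef, hD]
    linear_combination (w 0) * hwn
  have e1 : n 1 * P = (A * w 0 + B * w 1) * D := by
    simp only [hPdef, hD]
    linear_combination (w 1) * hwn
  -- Orthogonality fixes the direction of `n`, with `D` as scale; equality of lengths then
  -- determines `D` up to sign, and `hdet` removes the ambiguity in `e3`.
  have e2 : (ε * D * s) ^ 2 = P ^ 2 := by
    have : P ^ 2 * P = (ε * D * s) ^ 2 * P := by
      have h3 : P ^ 2 * P = (A * (n 0 * P) + B * (n 1 * P)) * (n 0 * P) +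
          (B * (n 0 * P) + C * (n 1 * P)) * (n 1 * P) := by
        linear_combination (-P ^ 2) * hn
      rw [h3, e0, e1, hPdef]
      linear_combination (-D ^ 2 * ε * ε * P) * hss -
        (D ^ 2 * (A * C - B * B) * P) * hε
    exact (mul_right_cancel₀ hP.ne' this).symm
  have e3 : ε * D * s = P := by
    rcases sq_eq_sq_iff_eq_or_eq_neg.1 e2 with h | h
    · exact h
    · have := mul_pos hdet hs0
      linarith
  have e4 : D = P * (ε / s) := by
    rw [mul_div_assoc', eq_div_iff hs0.ne']
    linear_combination ε * e3 - (D * s) * hε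
  ext i
  fin_cases i
  · change n 0 = signedRotForm g x₀ ε y w 0
    rw [h0]
    refine mul_right_cancel₀ hP.ne' ?_
    rw [e0, e4]
    ring
  · change n 1 = signedRotForm g x₀ ε y w 1
    rw [h1]
    refine mul_right_cancel₀ hP.ne' ?_
    rw [e1, e4]
    ring

theorem inner_quarterTurn (x : M) (v : TangentSpace 𝓘(ℝ, E2) x) :
    g.inner x v (quarterTurn g o x v) = 0 ∧
      g.inner x (quarterTurn g o x v) (quarterTurn g o x v) = g.inner x v v := by
  let _ : RiemannianBundle (fun x : M => TangentSpace 𝓘(ℝ, E2) x) := ⟨g.toRiemannianMetric⟩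
  have _ : Fact (Module.finrank ℝ (TangentSpace 𝓘(ℝ, E2) x) = 2) :=
    ⟨finrank_euclideanSpace_fin⟩
  have h1 : (inner ℝ v ((o.orient x).rightAngleRotation v) : ℝ) = 0 := by simp
  have h2 := (o.orient x).inner_comp_rightAngleRotation v v
  exact ⟨h1, h2⟩

/-- Local constancy of the orientation provides one sign for a whole neighbourhood; this is what
makes `J` smooth. -/
theorem exists_sign_quarterTurn (x₀ : M) : ∃ ε : ℝ, ε * ε = 1 ∧ ∀ᶠ x in 𝓝 x₀,
    ∀ v : TangentSpace 𝓘(ℝ, E2) x, coordVec x₀ x (quarterTurn g o x v) =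
      signedRotForm g x₀ ε (chartAt E2 x₀ x) (coordVec x₀ x v) := by
  obtain ⟨o₀, ho⟩ := o.locallyConstant x₀
  obtain ⟨ε, hε, h⟩ := exists_sign_det_rightAngleRotation o₀
  refine ⟨ε, hε, ?_⟩
  filter_upwards [ho, (chartAt E2 x₀).open_source.mem_nhds (mem_chart_source E2 x₀)] with x hx hxs v
  have hyt := (chartAt E2 x₀).map_source hxs
  obtain ⟨q1, q2⟩ := inner_quarterTurn g o x v
  by_cases hv : v = 0
  · have h0 : quarterTurn g o x v = 0 := by
      rw [hv, map_zero] at q2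
      by_contra hne
      have := g.pos x _ hne
      rw [hv] at this
      rw [q2] at this
      simp at this
    rw [h0, hv, map_zero, map_zero]
  refine eq_signedRotForm g x₀ hε hyt ?_ ?_ ?_ ?_
  · intro h0
    exact hv (coordVec_injective x₀ hxs (h0.trans (map_zero _).symm))
  · rw [metricForm_coordVec g x₀ hxs, q1]
  · rw [metricForm_coordVec g x₀ hxs, metricForm_coordVec g x₀ hxs, q2]
  · let _ : RiemannianBundle (fun x : M => TangentSpace 𝓘(ℝ, E2) x) := ⟨g.toRiemannianMetric⟩
    have _ : Fact (Module.finrank ℝ (TangentSpace 𝓘(ℝ, E2) x) = 2) :=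
      ⟨finrank_euclideanSpace_fin⟩
    have h1 := h (TangentSpace 𝓘(ℝ, E2) x) (o.orient x) _ (hx hxs) v hv
    have h2 : ∀ u : TangentSpace 𝓘(ℝ, E2) x, ((trivializationAt E2
        (fun x : M => TangentSpace 𝓘(ℝ, E2) x) x₀).linearEquivAt ℝ x hxs) u = coordVec x₀ x u :=
      fun u => trivializationAt_mk_snd x₀ hxs u
    rw [h2, h2] at h1
    exact h1

/-- The rotation `J` in the preferred chart at `x₀`. -/
def rotForm (x₀ : M) (y : E2) : E2 →L[ℝ] E2 :=
  signedRotForm g x₀ (exists_sign_quarterTurn g o x₀).choose y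

theorem rotation_rotForm (x₀ : M) {y : E2} (hy : y ∈ (chartAt E2 x₀).target) :
    Rotation (metricForm g x₀) (rotForm g o x₀) y :=
  rotation_signedRotForm g x₀ (exists_sign_quarterTurn g o x₀).choose_spec.1 hy

theorem coordVec_quarterTurn (x₀ : M) : ∀ᶠ x in 𝓝 x₀,
    ∀ v : TangentSpace 𝓘(ℝ, E2) x, coordVec x₀ x (quarterTurn g o x v) =
      rotForm g o x₀ (chartAt E2 x₀ x) (coordVec x₀ x v) :=
  (exists_sign_quarterTurn g o x₀).choose_spec.2

end ChartRotation

end Thermostat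
end

noncomputable section
namespace Thermostat

/-! ### The unit tangent bundle in natural coordinates, and the change of chart. -/

section UnitTangentGeometry

variable {M : Type*} [TopologicalSpace M] [ChartedSpace E2 M] [IsManifold 𝓘(ℝ, E2) ∞ M]

theorem coordVec_frameVec_eq_fderiv (x₀ x₁ : M) {x : M} (h₀ : x ∈ (chartAt E2 x₀).source)
    (h₁ : x ∈ (chartAt E2 x₁).source) (w : E2) : coordVec x₀ x (frameVec x₁ x w) =
      fderiv ℝ (chartAt E2 x₀ ∘ (chartAt E2 x₁).symm) (chartAt E2 x₁ x) w := by
  have hs : ContMDiffAt 𝓘(ℝ, E2) 𝓘(ℝ, E2) ∞ (chartAt E2 x₀) x :=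
    (contMDiffOn_chart (x := x₀)).contMDiffAt ((chartAt E2 x₀).open_source.mem_nhds h₀)
  have h2 := contDiffAt_comp_chartAt_symm x₁ h₁ (n := ⊤) hs
  have h3 := mfderiv_eq_fderiv_chartAt x₁ h₁ (h2.differentiableAt (by simp))
  unfold coordVec
  rw [h3.mfderiv]
  exact congrArg (fderiv ℝ (chartAt E2 x₀ ∘ (chartAt E2 x₁).symm) (chartAt E2 x₁ x))
    (coordVec_frameVec x₁ h₁ w)

theorem contDiffAt_chartTransition (x₀ x₁ : M) {y : E2} (hy : y ∈ (chartAt E2 x₁).target)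
    (h₀ : (chartAt E2 x₁).symm y ∈ (chartAt E2 x₀).source) :
    ContDiffAt ℝ ∞ (chartAt E2 x₀ ∘ (chartAt E2 x₁).symm) y := by
  have hs : ContMDiffAt 𝓘(ℝ, E2) 𝓘(ℝ, E2) ∞ (chartAt E2 x₀) ((chartAt E2 x₁).symm y) :=
    (contMDiffOn_chart (x := x₀)).contMDiffAt ((chartAt E2 x₀).open_source.mem_nhds h₀)
  have := contDiffAt_comp_chartAt_symm x₁ ((chartAt E2 x₁).map_target hy) (n := ⊤) hs
  rwa [(chartAt E2 x₁).right_inv hy] at this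

variable {g : SurfaceMetric M} {o : SurfaceOrientation M}

open UnitTangentBundle

theorem contMDiffOn_tmChart (q : TangentBundle 𝓘(ℝ, E2) M) :
    ContMDiffOn (𝓘(ℝ, E2).prod 𝓘(ℝ, E2)) 𝓘(ℝ, E2 × E2) ∞ (tmChart q) (tmChart q).source := by
  have := contMDiffOn_extChartAt (I := 𝓘(ℝ, E2).prod 𝓘(ℝ, E2)) (n := ∞) (x := q)
  exact this

theorem contMDiffAt_tmChart_symm (q : TangentBundle 𝓘(ℝ, E2) M) {z : E2 × E2}
    (hz : z.1 ∈ (chartAt E2 q.1).target) :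
    ContMDiffAt 𝓘(ℝ, E2 × E2) (𝓘(ℝ, E2).prod 𝓘(ℝ, E2)) ∞ (tmChart q).symm z := by
  refine (contMDiffOn_extChartAt_symm (I := 𝓘(ℝ, E2).prod 𝓘(ℝ, E2)) (n := ∞) q).contMDiffAt ?_
  refine (isOpen_extChartAt_target q).mem_nhds ?_
  rw [extChartAt_target]
  refine ⟨(mem_tmChart_target q z).2 hz, ?_⟩
  simp

/-- Read in the chart at `q`, the inclusion is the affine line of slopes, followed by the inverse
natural chart and the radial projection, each of them smooth where it is needed. -/
theorem contMDiff_incl :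
    ContMDiff 𝓘(ℝ, E2 × ℝ) (𝓘(ℝ, E2).prod 𝓘(ℝ, E2)) ∞ (incl (g := g)) := by
  intro q
  have hqs := UnitTangentBundle.mem_chart_source q
  have hc : ContMDiffAt 𝓘(ℝ, E2 × ℝ) 𝓘(ℝ, E2 × ℝ) ∞ q.chart q :=
    (contMDiffOn_chart (x := q)).contMDiffAt (q.chart.open_source.mem_nhds hqs)
  have hz : (q.chart q).1 ∈ (chartAt E2 q.incl.1).target := (q.chart.map_source hqs).1
  have h1 : ContMDiffAt 𝓘(ℝ, E2 × ℝ) 𝓘(ℝ, E2 × E2) ∞ (affineLine q.dir) (q.chart q) :=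
    (contDiff_affineLine _).contMDiff.contMDiffAt
  have h2 := (contMDiffAt_tmChart_symm q.incl (z := affineLine q.dir (q.chart q)) hz).comp
    (q.chart q) h1
  have h3 := (contMDiffAt_radialProj g _ (normSq_preInv q _ hz)).comp (q.chart q) h2
  have h4 := ContMDiffAt.comp (I := 𝓘(ℝ, E2 × ℝ)) (I' := 𝓘(ℝ, E2 × ℝ)) q h3 hc
  refine h4.congr_of_eventuallyEq ?_
  filter_upwards [q.chart.open_source.mem_nhds hqs] with q' hq'
  have h5 := incl_chartInv q (q.chart q') (q.chart.map_source hq').1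
  have h6 : chartInv q (q.chart q') = q' := q.chart.left_inv hq'
  rw [h6] at h5
  exact h5

theorem continuous_base : Continuous (base (g := g)) :=
  (FiberBundle.continuous_proj E2 (TangentSpace 𝓘(ℝ, E2) : M → Type _)).comp continuous_incl

/-- The natural coordinates `(y, v)` of a unit vector, in the preferred chart at `p`. -/
def natCoord (p q : UnitTangentBundle g) : E2 × E2 := tmChart p.incl q.incl

theorem natCoord_eq (p : UnitTangentBundle g) {q : UnitTangentBundle g}
    (hq : q.base ∈ (chartAt E2 p.base).source) :
    natCoord p q = (chartAt E2 p.base q.base, coordVec p.base q.base q.vec) :=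
  tmChart_apply p.incl hq q.vec

theorem natCoord_mem (p : UnitTangentBundle g) {q : UnitTangentBundle g}
    (hq : q.base ∈ (chartAt E2 p.base).source) :
    (natCoord p q).1 ∈ (chartAt E2 p.base).target :=
  (chartAt E2 p.base).map_source hq

theorem contMDiffAt_natCoord (p : UnitTangentBundle g) {q : UnitTangentBundle g}
    (hq : q.base ∈ (chartAt E2 p.base).source) :
    ContMDiffAt 𝓘(ℝ, E2 × ℝ) 𝓘(ℝ, E2 × E2) ∞ (natCoord p) q := by
  have hs : q.incl ∈ (tmChart p.incl).source := (mem_tmChart_source _ _).2 hq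
  exact ((contMDiffOn_tmChart p.incl).contMDiffAt
    ((tmChart p.incl).open_source.mem_nhds hs)).comp q contMDiff_incl.contMDiffAt

/-- The derivative of the natural coordinates. -/
def natVel (p q : UnitTangentBundle g) : TangentSpace 𝓘(ℝ, E2 × ℝ) q →L[ℝ] E2 × E2 :=
  mfderiv 𝓘(ℝ, E2 × ℝ) 𝓘(ℝ, E2 × E2) (natCoord p) q

theorem hasMFDerivAt_natCoord (p : UnitTangentBundle g) {q : UnitTangentBundle g}
    (hq : q.base ∈ (chartAt E2 p.base).source) :
    HasMFDerivAt 𝓘(ℝ, E2 × ℝ) 𝓘(ℝ, E2 × E2) (natCoord p) q (natVel p q) :=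
  ((contMDiffAt_natCoord p hq).mdifferentiableAt (by simp)).hasMFDerivAt

theorem metricForm_natCoord (p : UnitTangentBundle g) {q : UnitTangentBundle g}
    (hq : q.base ∈ (chartAt E2 p.base).source) :
    metricForm g p.base (natCoord p q).1 (natCoord p q).2 (natCoord p q).2 = 1 := by
  rw [natCoord_eq p hq, metricForm_coordVec g p.base hq]
  exact q.normSq_incl

theorem eventually_base_mem (p : UnitTangentBundle g) {q : UnitTangentBundle g}
    (hq : q.base ∈ (chartAt E2 p.base).source) :
    ∀ᶠ q' in 𝓝 q, q'.base ∈ (chartAt E2 p.base).source :=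
  continuous_base.continuousAt.eventually ((chartAt E2 p.base).open_source.mem_nhds hq)

/-- By metric compatibility the derivative of `g(w, w)` sees only the vertical part `b + Γ(a, w)` of
a vector. Tangency to `SM` hence means that this part is orthogonal to `w`. -/
theorem hasFDerivAt_metricForm_self (x₀ : M) {y : E2} (hy : y ∈ (chartAt E2 x₀).target) (w : E2) :
    ∃ D : E2 × E2 →L[ℝ] ℝ, HasFDerivAt (fun z : E2 × E2 => metricForm g x₀ z.1 z.2 z.2) D (y, w) ∧
      ∀ a b, D (a, b) = 2 * metricForm g x₀ y w (b + connForm g x₀ y a w) := by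
  have hL := leviCivita g x₀ hy
  have h1 : HasFDerivAt (fun z : E2 × E2 => metricForm g x₀ z.1)
      ((fderiv ℝ (metricForm g x₀) y).comp (ContinuousLinearMap.fst ℝ E2 E2)) (y, w) :=
    HasFDerivAt.comp (g := metricForm g x₀) (f := Prod.fst) (y, w)
      hL.differentiableAt_metric.hasFDerivAt hasFDerivAt_fst
  refine ⟨_, (h1.clm_apply hasFDerivAt_snd).clm_apply hasFDerivAt_snd, fun a b => ?_⟩
  simp
  rw [hL.compat, hL.symm b w, hL.symm (connForm g x₀ y a w) w]
  ring

/-- A vector tangent to `SM`, in natural coordinates. -/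
theorem natVel_tangent (p : UnitTangentBundle g) {q : UnitTangentBundle g}
    (hq : q.base ∈ (chartAt E2 p.base).source) (ξ : TangentSpace 𝓘(ℝ, E2 × ℝ) q) :
    metricForm g p.base (natCoord p q).1 (natCoord p q).2
      ((natVel p q ξ).2 + connForm g p.base (natCoord p q).1 (natVel p q ξ).1 (natCoord p q).2) =
        0 := by
  obtain ⟨D, hD, hDe⟩ := hasFDerivAt_metricForm_self (g := g) p.base (natCoord_mem p hq)
    (natCoord p q).2
  have h1 := hD.hasMFDerivAt.comp q
    (hasMFDerivAt_natCoord p hq)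
  have h2 : HasMFDerivAt 𝓘(ℝ, E2 × ℝ) 𝓘(ℝ, ℝ) ((fun z : E2 × E2 =>
      metricForm g p.base z.1 z.2 z.2) ∘ natCoord p) q
      (0 : TangentSpace 𝓘(ℝ, E2 × ℝ) q →L[ℝ] ℝ) := by
    refine (hasMFDerivAt_const (1 : ℝ) q).congr_of_eventuallyEq ?_
    filter_upwards [eventually_base_mem p hq] with q' hq'
    exact metricForm_natCoord p hq'
  have h3 := DFunLike.congr_fun (hasMFDerivAt_unique h1 h2) ξ
  have h4 : D ((natVel p q ξ).1, (natVel p q ξ).2) = 0 := h3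
  rw [hDe] at h4
  linarith

/-- The change of the natural coordinates of `TM`. -/
theorem natCoord_transition (p q : UnitTangentBundle g) {z : E2 × E2}
    (hz : z.1 ∈ (chartAt E2 q.base).target)
    (hz' : (chartAt E2 q.base).symm z.1 ∈ (chartAt E2 p.base).source) :
    tmChart p.incl ((tmChart q.incl).symm z) =
      ((chartAt E2 p.base ∘ (chartAt E2 q.base).symm) z.1,
        fderiv ℝ (chartAt E2 p.base ∘ (chartAt E2 q.base).symm) z.1 z.2) := by
  rw [tmChart_symm_apply q.incl hz]
  refine (tmChart_apply p.incl hz' (frameVec q.base _ z.2)).trans (Prod.ext rfl ?_)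
  change coordVec p.base _ (frameVec q.base _ z.2) = _
  rw [coordVec_frameVec_eq_fderiv p.base q.base hz' ((chartAt E2 q.base).map_target hz),
    (chartAt E2 q.base).right_inv hz]

/-- The components in the chart at `p` of a vector tangent to `SM` at `q`, given by its natural
components `(a, b)` at `q`. -/
theorem natVel_ofTangent (p q : UnitTangentBundle g)
    (hq : q.base ∈ (chartAt E2 p.base).source) (a b : E2)
    (htan : metricForm g q.base (chartAt E2 q.base q.base) q.vec
      (b + connForm g q.base (chartAt E2 q.base q.base) a q.vec) = 0) :
    natVel p q (q.ofTangent ((a, b) : E2 × E2)) =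
      (coordVec p.base q.base a, coordVec p.base q.base
        (b + connForm g q.base (chartAt E2 q.base q.base) a q.vec) -
          connForm g p.base (natCoord p q).1 (coordVec p.base q.base a) (natCoord p q).2) := by
  set x₁ := q.base
  set x₀ := p.base
  have hx₁ : x₁ ∈ (chartAt E2 x₁).source := mem_chart_source E2 x₁
  set y := chartAt E2 x₁ x₁ with hy
  have hyt : y ∈ (chartAt E2 x₁).target := (chartAt E2 x₁).map_source hx₁
  have hyx : (chartAt E2 x₁).symm y = x₁ := (chartAt E2 x₁).left_inv hx₁
  set τ := chartAt E2 x₀ ∘ (chartAt E2 x₁).symm with hτdef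
  have hτs : ContDiffAt ℝ ∞ τ y := contDiffAt_chartTransition x₀ x₁ hyt (by rw [hyx]; exact hq)
  have hcoord : ∀ w : E2, coordVec x₀ x₁ w = fderiv ℝ τ y w := by
    intro w
    have h1 := coordVec_frameVec_eq_fderiv x₀ x₁ hq hx₁ w
    have h2 : frameVec x₁ x₁ w = w :=
      (congrArg (frameVec x₁ x₁) (coordVec_self x₁ w)).symm.trans (frameVec_coordVec x₁ hx₁ w)
    rw [h2] at h1
    exact h1
  set v : E2 := q.vec with hv
  have hself : natCoord q q = (y, v) := by
    rw [natCoord_eq q hx₁, coordVec_self]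
  have hpq : natCoord p q = (τ y, fderiv ℝ τ y v) := by
    rw [natCoord_eq p hq]
    refine Prod.ext ?_ (hcoord v)
    simp only [hτdef, Function.comp, hyx]
    rfl
  have hNq := metricForm_natCoord p hq
  rw [hpq] at hNq ⊢
  replace hNq : metricForm g x₀ (τ y) (fderiv ℝ τ y v) (fderiv ℝ τ y v) = 1 := hNq
  have hτy : τ y ∈ (chartAt E2 x₀).target := by
    have := natCoord_mem p hq
    rwa [hpq] at this
  -- the derivative in coordinates
  set T : E2 × E2 → E2 × E2 := fun z => (τ z.1, fderiv ℝ τ z.1 z.2) with hT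
  -- In coordinates the map `natCoord p ∘ retract q` is the transition map `T` of `TM` followed by
  -- the radial projection `ρ`.
  set ρ : E2 × E2 → E2 × E2 := fun z =>
    (z.1, (Real.sqrt (metricForm g x₀ z.1 z.2 z.2))⁻¹ • z.2) with hρ
  have dτ := (hτs.differentiableAt (by simp)).hasFDerivAt
  have ddτ := ((hτs.fderiv_right (m := 1) (by norm_num; exact two_le_infty)).differentiableAt
    (by simp)).hasFDerivAt
  have hdT : HasFDerivAt T (((fderiv ℝ τ y).comp (ContinuousLinearMap.fst ℝ E2 E2)).prod
      ((fderiv ℝ τ y).comp (ContinuousLinearMap.snd ℝ E2 E2) +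
        ((fderiv ℝ (fderiv ℝ τ) y).comp (ContinuousLinearMap.fst ℝ E2 E2)).flip v)) (y, v) := by
    have h1 : HasFDerivAt (fun z : E2 × E2 => τ z.1) _ (y, v) :=
      HasFDerivAt.comp (g := τ) (f := Prod.fst) (y, v) dτ hasFDerivAt_fst
    have h2 : HasFDerivAt (fun z : E2 × E2 => fderiv ℝ τ z.1) _ (y, v) :=
      HasFDerivAt.comp (g := fderiv ℝ τ) (f := Prod.fst) (y, v) ddτ hasFDerivAt_fst
    exact h1.prodMk (h2.clm_apply hasFDerivAt_snd)
  obtain ⟨D, hD, hDe⟩ := hasFDerivAt_metricForm_self (g := g) x₀ hτy (fderiv ℝ τ y v)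
  -- At a unit vector, `ρ` fixes to first order the directions in which the length is stationary.
  -- Vectors tangent to `SM` are therefore transformed by `T` alone.
  have hdρ : ∃ R : E2 × E2 →L[ℝ] E2 × E2, HasFDerivAt ρ R (T (y, v)) ∧
      ∀ ζ, D ζ = 0 → R ζ = ζ := by
    have h1 : HasFDerivAt (fun z : E2 × E2 => (Real.sqrt (metricForm g x₀ z.1 z.2 z.2))⁻¹)
        (-(1 / 2 : ℝ) • D) (T (y, v)) := by
      have h2 : HasDerivAt (fun r : ℝ => (Real.sqrt r)⁻¹) (-(1 / 2 : ℝ))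
          (metricForm g x₀ (τ y) (fderiv ℝ τ y v) (fderiv ℝ τ y v)) := by
        rw [hNq]
        have h3 := (Real.hasDerivAt_sqrt (x := 1) one_ne_zero).inv (by simp)
        refine h3.congr_deriv ?_
        simp
      exact HasDerivAt.comp_hasFDerivAt (h₂ := fun r : ℝ => (Real.sqrt r)⁻¹) (T (y, v)) h2 hD
    refine ⟨_, hasFDerivAt_fst.prodMk (h1.smul hasFDerivAt_snd), fun ζ hζ => ?_⟩
    simp [hT, hNq, hζ]
  obtain ⟨R, hR, hRe⟩ := hdρ
  have hcomp := hR.comp (y, v) hdT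
  -- comparison with the manifold derivative
  have hret : HasMFDerivAt (𝓘(ℝ, E2).prod 𝓘(ℝ, E2)) 𝓘(ℝ, E2 × E2) (natCoord p ∘ retract q) q.incl
      ((mfderiv 𝓘(ℝ, E2 × ℝ) 𝓘(ℝ, E2 × E2) (natCoord p) q).comp
        (mfderiv (𝓘(ℝ, E2).prod 𝓘(ℝ, E2)) 𝓘(ℝ, E2 × ℝ) (retract q) q.incl)) := by
    have h1 : HasMFDerivAt 𝓘(ℝ, E2 × ℝ) 𝓘(ℝ, E2 × E2) (natCoord p) (retract q q.incl)
        (mfderiv 𝓘(ℝ, E2 × ℝ) 𝓘(ℝ, E2 × E2) (natCoord p) (retract q q.incl)) := by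
      refine (ContMDiffAt.mdifferentiableAt (n := ∞) ?_ (by simp)).hasMFDerivAt
      rw [retract_incl]
      exact contMDiffAt_natCoord p hq
    have h2 := h1.comp q.incl (hasMFDerivAt_retract q).mdifferentiableAt.hasMFDerivAt
    rw [retract_incl] at h2
    exact h2
  obtain ⟨A, hA, hAe⟩ : ∃ A : E2 × E2 →L[ℝ] E2 × E2, HasMFDerivAt (𝓘(ℝ, E2).prod 𝓘(ℝ, E2))
      𝓘(ℝ, E2 × E2) (natCoord p ∘ retract q) q.incl A ∧ ∀ ζ : E2 × E2, A ζ =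
        natVel p q (q.ofTangent ζ) :=
    ⟨_, hret, fun _ => rfl⟩
  have hev : (fun z => (natCoord p ∘ retract q) ((tmChart q.incl).symm z)) =ᶠ[𝓝 (y, v)]
      fun z => ρ (T z) := by
    have e1 : ∀ᶠ z : E2 × E2 in 𝓝 (y, v), z.1 ∈ (chartAt E2 x₁).target :=
      continuousAt_fst.eventually ((chartAt E2 x₁).open_target.mem_nhds hyt)
    have e2 : ∀ᶠ z : E2 × E2 in 𝓝 (y, v), (chartAt E2 x₁).symm z.1 ∈ (chartAt E2 x₀).source := by
      have hc : ContinuousAt (fun z : E2 × E2 => (chartAt E2 x₁).symm z.1) (y, v) :=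
        ((chartAt E2 x₁).symm.continuousAt hyt).comp (f := fun z : E2 × E2 => z.1) continuousAt_fst
      refine hc.eventually ((chartAt E2 x₀).open_source.mem_nhds ?_)
      change (chartAt E2 x₁).symm y ∈ _
      rw [hyx]
      exact hq
    have e3 : ∀ᶠ z : E2 × E2 in 𝓝 (y, v), z.2 ≠ 0 := by
      refine continuousAt_snd.eventually (isOpen_ne.mem_nhds ?_)
      intro h0
      change v = 0 at h0
      rw [h0] at hNq
      simp at hNq
    filter_upwards [e1, e2, e3] with z hz hz' hz0
    have hnt := natCoord_transition p q hz hz'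
    have hsymm := tmChart_symm_apply q.incl hz
    have hpos : 0 < normSq g ((tmChart q.incl).symm z) := by
      refine normSq_pos g _ q.incl ?_
      rw [(tmChart q.incl).right_inv ((mem_tmChart_target _ _).2 hz)]
      exact hz0
    have hN : normSq g ((tmChart q.incl).symm z) =
        metricForm g x₀ (T z).1 (T z).2 (T z).2 := by
      have h1 := metricForm_coordVec g x₀ (x := ((tmChart q.incl).symm z).1)
        (by rw [hsymm]; exact hz') ((tmChart q.incl).symm z).2 ((tmChart q.incl).symm z).2
      have h2 := tmChart_apply p.incl (x := ((tmChart q.incl).symm z).1)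
        (by rw [hsymm]; exact hz') ((tmChart q.incl).symm z).2
      have h3 : T z = (chartAt E2 x₀ ((tmChart q.incl).symm z).1,
        coordVec x₀ ((tmChart q.incl).symm z).1 ((tmChart q.incl).symm z).2) := hnt.symm.trans h2
      rw [h3, h1]
      rfl
    change tmChart p.incl (retract q ((tmChart q.incl).symm z)).incl = ρ (T z)
    unfold retract
    rw [dif_pos hpos]
    simp only
    rw [tmChart_radialProj, hnt, hN]
  have h1 : HasFDerivWithinAt (fun z : E2 × E2 => (natCoord p ∘ retract q)
      ((tmChart q.incl).symm z)) A (Set.range (𝓘(ℝ, E2).prod 𝓘(ℝ, E2))) (natCoord q q) := hA.2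
  rw [hself, show Set.range (𝓘(ℝ, E2).prod 𝓘(ℝ, E2)) = Set.univ by simp,
    hasFDerivWithinAt_univ] at h1
  have h2 := h1.unique (hcomp.congr_of_eventuallyEq hev)
  have h3 := DFunLike.congr_fun h2 ((a, b) : E2 × E2)
  have hval : ((fderiv ℝ τ y).comp (ContinuousLinearMap.fst ℝ E2 E2)).prod
      ((fderiv ℝ τ y).comp (ContinuousLinearMap.snd ℝ E2 E2) +
        ((fderiv ℝ (fderiv ℝ τ) y).comp (ContinuousLinearMap.fst ℝ E2 E2)).flip v) (a, b) =
      (fderiv ℝ τ y a, fderiv ℝ τ y b + fderiv ℝ (fderiv ℝ τ) y a v) := by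
    simp
  have hG : ∀ᶠ z in 𝓝 y, ∀ a b, metricForm g x₁ z a b =
      metricForm g x₀ (τ z) (fderiv ℝ τ z a) (fderiv ℝ τ z b) := by
    have e2 : ∀ᶠ z : E2 in 𝓝 y, (chartAt E2 x₁).symm z ∈ (chartAt E2 x₀).source := by
      refine ((chartAt E2 x₁).symm.continuousAt hyt).eventually
        ((chartAt E2 x₀).open_source.mem_nhds ?_)
      rw [hyx]
      exact hq
    filter_upwards [(chartAt E2 x₁).open_target.mem_nhds hyt, e2] with z hz hz' a b
    have hc := fun w => coordVec_frameVec_eq_fderiv x₀ x₁ hz' ((chartAt E2 x₁).map_target hz) w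
    rw [(chartAt E2 x₁).right_inv hz] at hc
    rw [metricForm_apply g x₁ hz, ← metricForm_coordVec g x₀ hz', hc, hc]
    rfl
  have hsurj : Function.Surjective (fderiv ℝ τ y) := by
    intro w
    have h4 := coordVec_frameVec x₀ hq w
    exact ⟨frameVec x₀ x₁ w, (hcoord _).symm.trans h4⟩
  -- The second derivative of the transition map, which enters the derivative of `T`, is absorbed by
  -- the transformation law of the Christoffel symbols.
  have htr := LeviCivita.transform hτs hsurj (leviCivita g x₁ hyt) (leviCivita g x₀ hτy) hG a v
  have hfin : (fderiv ℝ τ y a, fderiv ℝ τ y b + fderiv ℝ (fderiv ℝ τ) y a v) =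
      (fderiv ℝ τ y a, fderiv ℝ τ y (b + connForm g x₁ y a v) -
        connForm g x₀ (τ y) (fderiv ℝ τ y a) (fderiv ℝ τ y v)) := by
    rw [htr, map_add]
    refine Prod.ext rfl ?_
    simp only
    abel
  have hz : D (fderiv ℝ τ y a, fderiv ℝ τ y b + fderiv ℝ (fderiv ℝ τ) y a v) = 0 := by
    rw [hfin, hDe]
    have h5 := hG.self_of_nhds v (b + connForm g x₁ y a v)
    simp only [sub_add_cancel]
    rw [← h5]
    exact mul_eq_zero_of_right _ htan
  rw [← hAe, h3, ContinuousLinearMap.comp_apply, hval, hRe _ hz, hfin, hcoord, hcoord]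

end UnitTangentGeometry

end Thermostat
end

noncomputable section
namespace Thermostat

/-! ### The moving frame X, H, V: independence of charts and smoothness. -/

section MovingFrame

variable {M : Type*} [TopologicalSpace M] [ChartedSpace E2 M] [IsManifold 𝓘(ℝ, E2) ∞ M]
variable (g : SurfaceMetric M) (o : SurfaceOrientation M)

open UnitTangentBundle

/-- The natural coordinates at `p` are good coordinates near `q`. -/
structure Adapted (p q : UnitTangentBundle g) : Prop where
  mem_source : q ∈ p.chart.source
  rot : ∀ᶠ x in 𝓝 q.base, ∀ v : TangentSpace 𝓘(ℝ, E2) x,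
    coordVec p.base x (quarterTurn g o x v) =
      rotForm g o p.base (chartAt E2 p.base x) (coordVec p.base x v)

variable {g o}

theorem adapted_self (p : UnitTangentBundle g) : Adapted g o p p :=
  ⟨UnitTangentBundle.mem_chart_source p, coordVec_quarterTurn g o p.base⟩

theorem Adapted.eventually {p q : UnitTangentBundle g} (h : Adapted g o p q) :
    ∀ᶠ q' in 𝓝 q, Adapted g o p q' := by
  filter_upwards [p.chart.open_source.mem_nhds h.mem_source,
    continuous_base.continuousAt.eventually (eventually_eventually_nhds.2 h.rot)] with q' h1 h2
  exact ⟨h1, h2⟩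

theorem Adapted.base_mem {p q : UnitTangentBundle g} (h : Adapted g o p q) :
    q.base ∈ (chartAt E2 p.base).source :=
  (mem_tmChart_source _ _).1 h.mem_source.1

theorem Adapted.leviCivita {p q : UnitTangentBundle g} (h : Adapted g o p q) :
    LeviCivita (metricForm g p.base) (connForm g p.base) (natCoord p q).1 :=
  Thermostat.leviCivita g p.base (natCoord_mem p h.base_mem)

theorem Adapted.rotation {p q : UnitTangentBundle g} (h : Adapted g o p q) :
    Rotation (metricForm g p.base) (rotForm g o p.base) (natCoord p q).1 :=
  rotation_rotForm g o p.base (natCoord_mem p h.base_mem)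

/-- The natural coordinates of the vector `J v`. -/
def natRot (o : SurfaceOrientation M) (p q : UnitTangentBundle g) : E2 :=
  rotForm g o p.base (natCoord p q).1 (natCoord p q).2

theorem Adapted.coordVec_vec {p q : UnitTangentBundle g} (h : Adapted g o p q) :
    coordVec p.base q.base q.vec = (natCoord p q).2 :=
  (congrArg Prod.snd (natCoord_eq p h.base_mem)).symm

theorem Adapted.coordVec_quarterTurn {p q : UnitTangentBundle g} (h : Adapted g o p q) :
    coordVec p.base q.base (quarterTurn g o q.base q.vec) = natRot o p q := by
  rw [h.rot.self_of_nhds, h.coordVec_vec]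
  rfl

theorem Adapted.unit {p q : UnitTangentBundle g} (h : Adapted g o p q) :
    metricForm g p.base (natCoord p q).1 (natCoord p q).2 (natCoord p q).2 = 1 :=
  metricForm_natCoord p h.base_mem

theorem Adapted.unit_rot {p q : UnitTangentBundle g} (h : Adapted g o p q) :
    metricForm g p.base (natCoord p q).1 (natRot o p q) (natRot o p q) = 1 :=
  (h.rotation.isometry _ _).trans h.unit

theorem Adapted.rot_vec {p q : UnitTangentBundle g} (h : Adapted g o p q) :
    metricForm g p.base (natCoord p q).1 (natRot o p q) (natCoord p q).2 = 0 :=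
  h.rotation.inner_self h.leviCivita _

theorem Adapted.vec_rot {p q : UnitTangentBundle g} (h : Adapted g o p q) :
    metricForm g p.base (natCoord p q).1 (natCoord p q).2 (natRot o p q) = 0 := by
  rw [h.leviCivita.symm, h.rot_vec]

theorem Adapted.expand {p q : UnitTangentBundle g} (h : Adapted g o p q) (w : E2) :
    w = metricForm g p.base (natCoord p q).1 (natCoord p q).2 w • (natCoord p q).2 +
      metricForm g p.base (natCoord p q).1 (natRot o p q) w • natRot o p q :=
  h.leviCivita.expand h.unit h.unit_rot h.vec_rot w

/-- A horizontal lift has `b + Γ(a, v) = 0`, so in `natVel_ofTangent` only the connection term of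
the new chart survives: horizontality does not depend on coordinates. -/
theorem natVel_horizontalLift {p q : UnitTangentBundle g}
    (h : q.base ∈ (chartAt E2 p.base).source) (a : TangentSpace 𝓘(ℝ, E2) q.base) :
    natVel p q (horizontalLift g q a) = (coordVec p.base q.base a,
      -connForm g p.base (natCoord p q).1 (coordVec p.base q.base a) (natCoord p q).2) := by
  have e : horizontalLift g q a = q.ofTangent
      ((a, -connForm g q.base (chartAt E2 q.base q.base) a q.vec) : E2 × E2) := by
    rw [horizontalLift, christoffelVec_eq]
    rfl
  have h1 := natVel_ofTangent p q h a (-connForm g q.base (chartAt E2 q.base q.base) a q.vec) (by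
    rw [neg_add_cancel, map_zero])
  rw [neg_add_cancel] at h1
  rw [e, h1, show coordVec p.base q.base (0 : E2) = 0 from map_zero (coordVec p.base q.base),
    zero_sub]

theorem Adapted.natVel_geodesicField {p q : UnitTangentBundle g} (h : Adapted g o p q) :
    natVel p q (geodesicField g q) = ((natCoord p q).2,
      -connForm g p.base (natCoord p q).1 (natCoord p q).2 (natCoord p q).2) := by
  rw [geodesicField, natVel_horizontalLift h.base_mem, h.coordVec_vec]

theorem Adapted.natVel_horizontalField {p q : UnitTangentBundle g} (h : Adapted g o p q) :
    natVel p q (horizontalField g o q) = (natRot o p q,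
      -connForm g p.base (natCoord p q).1 (natRot o p q) (natCoord p q).2) := by
  rw [horizontalField, natVel_horizontalLift h.base_mem, h.coordVec_quarterTurn]

theorem Adapted.natVel_verticalField {p q : UnitTangentBundle g} (h : Adapted g o p q) :
    natVel p q (verticalField g o q) = (0, natRot o p q) := by
  obtain ⟨n, hn⟩ : ∃ n : E2, n = quarterTurn g o q.base q.vec := ⟨_, rfl⟩
  have e : verticalField g o q = q.ofTangent ((0, n) : E2 × E2) := by
    rw [hn]
    rfl
  have hz : connForm g q.base (chartAt E2 q.base q.base) 0 q.vec = 0 := by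
    rw [map_zero]
    rfl
  have h1 := natVel_ofTangent p q h.base_mem 0 n (by
    rw [hz, add_zero, hn]
    have h2 := metricForm_coordVec g q.base (mem_chart_source E2 q.base) q.vec
      (quarterTurn g o q.base q.vec)
    rw [coordVec_self, coordVec_self] at h2
    exact h2.trans (inner_quarterTurn g o q.base q.vec).1)
  have h3 : coordVec p.base q.base n = natRot o p q := by
    rw [hn]
    exact h.coordVec_quarterTurn
  rw [e, h1, hz, add_zero, h3, show coordVec p.base q.base (0 : E2) = 0 from
    map_zero (coordVec p.base q.base), map_zero, zero_apply, sub_zero]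

theorem Adapted.natVel_thermostat {p q : UnitTangentBundle g} (h : Adapted g o p q)
    (lam : UnitTangentBundle g → ℝ) :
    natVel p q (thermostat g o lam q) = ((natCoord p q).2,
      -connForm g p.base (natCoord p q).1 (natCoord p q).2 (natCoord p q).2 +
        lam q • natRot o p q) := by
  rw [thermostat, map_add, map_smul, h.natVel_geodesicField, h.natVel_verticalField]
  simp

theorem contMDiffAt_chart (p : UnitTangentBundle g) {q : UnitTangentBundle g}
    (hq : q ∈ p.chart.source) :
    ContMDiffAt 𝓘(ℝ, E2 × ℝ) 𝓘(ℝ, E2 × ℝ) ∞ (chartAt (E2 × ℝ) p) q :=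
  (contMDiffOn_chart (x := p)).contMDiffAt (p.chart.open_source.mem_nhds hq)

theorem mfderiv_chart_eq (p : UnitTangentBundle g) {q : UnitTangentBundle g}
    (hq : q ∈ p.chart.source) (ξ : TangentSpace 𝓘(ℝ, E2 × ℝ) q) :
    (mfderiv 𝓘(ℝ, E2 × ℝ) 𝓘(ℝ, E2 × ℝ) (chartAt (E2 × ℝ) p) q ξ : E2 × ℝ) =
      fderiv ℝ (slope p.dir) (natCoord p q) (natVel p q ξ) := by
  have h1 : HasFDerivAt (slope p.dir) (fderiv ℝ (slope p.dir) (natCoord p q)) (natCoord p q) :=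
    ((contDiffAt_slope p.dir (natCoord p q) hq.2.ne').differentiableAt (by simp)).hasFDerivAt
  have h2 := h1.hasMFDerivAt.comp q (hasMFDerivAt_natCoord p ((mem_tmChart_source _ _).1 hq.1))
  have h3 : HasMFDerivAt 𝓘(ℝ, E2 × ℝ) 𝓘(ℝ, E2 × ℝ) (chartAt (E2 × ℝ) p) q _ := h2
  rw [h3.mfderiv]
  rfl

/-- The derivative of the chart of `SM` factors through the natural components and is invertible.
Identities between tangent vectors of `SM` can thus be checked in natural coordinates. -/
theorem natVel_injective (p : UnitTangentBundle g) {q : UnitTangentBundle g}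
    (hq : q ∈ p.chart.source) : Function.Injective (natVel p q) := by
  intro ξ η h
  have h1 := mfderiv_chart_eq p hq ξ
  rw [h, ← mfderiv_chart_eq p hq η] at h1
  have h2 := (isInvertible_mfderiv_extChartAt (I := 𝓘(ℝ, E2 × ℝ)) (x := p) (y := q)
    (by rw [extChartAt_source]; exact hq)).injective
  rw [mfderiv_extChartAt_eq] at h2
  exact h2 h1

/-- A vector field is smooth if its natural components are. -/
theorem contMDiff_section_of_natVel {F : ∀ q : UnitTangentBundle g, TangentSpace 𝓘(ℝ, E2 × ℝ) q}
    (hF : ∀ p, ContMDiffAt 𝓘(ℝ, E2 × ℝ) 𝓘(ℝ, E2 × E2) ∞ (fun q => natVel p q (F q)) p) :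
    ContMDiff 𝓘(ℝ, E2 × ℝ) 𝓘(ℝ, E2 × ℝ).tangent ∞
      (fun q => (⟨q, F q⟩ : TangentBundle 𝓘(ℝ, E2 × ℝ) (UnitTangentBundle g))) := by
  intro p
  have hp := UnitTangentBundle.mem_chart_source p
  rw [contMDiffAt_section_iff F p hp]
  have h1 : ContDiffAt ℝ ∞ (fderiv ℝ (slope p.dir)) (natCoord p p) :=
    (contDiffAt_slope p.dir (natCoord p p) hp.2.ne').fderiv_right (m := ∞) le_rfl
  have h2 : ContMDiffAt 𝓘(ℝ, E2 × ℝ) 𝓘(ℝ, E2 × E2 →L[ℝ] E2 × ℝ) ∞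
      (fun q => fderiv ℝ (slope p.dir) (natCoord p q)) p :=
    h1.contMDiffAt.comp p (contMDiffAt_natCoord p ((mem_tmChart_source _ _).1 hp.1))
  have h3 := h2.clm_apply (hF p)
  refine h3.congr_of_eventuallyEq ?_
  filter_upwards [p.chart.open_source.mem_nhds hp] with q hq
  exact mfderiv_chart_eq p hq (F q)

theorem contMDiff_lieDeriv {F : ∀ q : UnitTangentBundle g, TangentSpace 𝓘(ℝ, E2 × ℝ) q}
    (hF : ContMDiff 𝓘(ℝ, E2 × ℝ) 𝓘(ℝ, E2 × ℝ).tangent ∞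
      (fun q => (⟨q, F q⟩ : TangentBundle 𝓘(ℝ, E2 × ℝ) (UnitTangentBundle g))))
    {f : UnitTangentBundle g → ℝ} (hf : ContMDiff 𝓘(ℝ, E2 × ℝ) 𝓘(ℝ, ℝ) ∞ f) :
    ContMDiff 𝓘(ℝ, E2 × ℝ) 𝓘(ℝ, ℝ) ∞ (lieDeriv F f) := by
  intro p
  have hp := UnitTangentBundle.mem_chart_source p
  have hs := (contMDiffAt_section_iff F p hp).1 (hF p)
  have h1 : ContDiffAt ℝ ∞ (f ∘ (chartAt (E2 × ℝ) p).symm) (chartAt (E2 × ℝ) p p) :=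
    contDiffAt_comp_chartAt_symm p hp (n := ⊤) (hf p)
  have h2 : ContMDiffAt 𝓘(ℝ, E2 × ℝ) 𝓘(ℝ, E2 × ℝ →L[ℝ] ℝ) ∞
      (fun q => fderiv ℝ (f ∘ (chartAt (E2 × ℝ) p).symm) (chartAt (E2 × ℝ) p q)) p :=
    (h1.fderiv_right (m := ∞) le_rfl).contMDiffAt.comp p (contMDiffAt_chart p hp)
  refine (h2.clm_apply hs).congr_of_eventuallyEq ?_
  filter_upwards [p.chart.open_source.mem_nhds hp] with q hq
  have h3 : ContDiffAt ℝ ∞ (f ∘ (chartAt (E2 × ℝ) p).symm) (chartAt (E2 × ℝ) p q) :=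
    contDiffAt_comp_chartAt_symm p hq (n := ⊤) (hf q)
  unfold lieDeriv
  rw [(mfderiv_eq_fderiv_chartAt p hq (h3.differentiableAt (by simp))).mfderiv]
  rfl

theorem contMDiffAt_comp_natCoord {F : Type*} [NormedAddCommGroup F] [NormedSpace ℝ F] {B : E2 → F}
    {p q : UnitTangentBundle g} (h : q.base ∈ (chartAt E2 p.base).source)
    (hB : ContDiffAt ℝ ∞ B (natCoord p q).1) :
    ContMDiffAt 𝓘(ℝ, E2 × ℝ) 𝓘(ℝ, F) ∞ (fun q => B (natCoord p q).1) q :=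
  ContMDiffAt.comp (g := fun z : E2 × E2 => B z.1) q
    (hB.comp (natCoord p q) contDiffAt_fst).contMDiffAt (contMDiffAt_natCoord p h)

theorem contMDiffAt_natCoord_snd {p q : UnitTangentBundle g}
    (h : q.base ∈ (chartAt E2 p.base).source) :
    ContMDiffAt 𝓘(ℝ, E2 × ℝ) 𝓘(ℝ, E2) ∞ (fun q => (natCoord p q).2) q :=
  ContMDiffAt.comp (g := fun z : E2 × E2 => z.2) q
    contDiffAt_snd.contMDiffAt (contMDiffAt_natCoord p h)

theorem Adapted.contMDiffAt_natRot {p q : UnitTangentBundle g} (h : Adapted g o p q) :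
    ContMDiffAt 𝓘(ℝ, E2 × ℝ) 𝓘(ℝ, E2) ∞ (natRot o p) q :=
  (contMDiffAt_comp_natCoord h.base_mem h.rotation.smooth).clm_apply
    (contMDiffAt_natCoord_snd h.base_mem)

theorem contMDiff_geodesicField (o : SurfaceOrientation M) :
    ContMDiff 𝓘(ℝ, E2 × ℝ) 𝓘(ℝ, E2 × ℝ).tangent ∞
      (fun q => (⟨q, geodesicField g q⟩ : TangentBundle 𝓘(ℝ, E2 × ℝ) (UnitTangentBundle g))) := by
  refine contMDiff_section_of_natVel fun p => ?_
  have h := adapted_self (o := o) p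
  have hv := contMDiffAt_natCoord_snd h.base_mem
  refine ContMDiffAt.congr_of_eventuallyEq (hv.prodMk_space
    (((contMDiffAt_comp_natCoord h.base_mem h.leviCivita.conn_smooth).clm_apply hv).clm_apply
      hv).neg) ?_
  filter_upwards [h.eventually] with q hq
  exact hq.natVel_geodesicField

theorem contMDiff_horizontalField :
    ContMDiff 𝓘(ℝ, E2 × ℝ) 𝓘(ℝ, E2 × ℝ).tangent ∞
      (fun q => (⟨q, horizontalField g o q⟩ :
        TangentBundle 𝓘(ℝ, E2 × ℝ) (UnitTangentBundle g))) := by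
  refine contMDiff_section_of_natVel fun p => ?_
  have h := adapted_self (o := o) p
  have hv := contMDiffAt_natCoord_snd h.base_mem
  have hn := h.contMDiffAt_natRot
  refine ContMDiffAt.congr_of_eventuallyEq (hn.prodMk_space
    (((contMDiffAt_comp_natCoord h.base_mem h.leviCivita.conn_smooth).clm_apply hn).clm_apply
      hv).neg) ?_
  filter_upwards [h.eventually] with q hq
  exact hq.natVel_horizontalField

theorem contMDiff_verticalField :
    ContMDiff 𝓘(ℝ, E2 × ℝ) 𝓘(ℝ, E2 × ℝ).tangent ∞
      (fun q => (⟨q, verticalField g o q⟩ :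
        TangentBundle 𝓘(ℝ, E2 × ℝ) (UnitTangentBundle g))) := by
  refine contMDiff_section_of_natVel fun p => ?_
  have h := adapted_self (o := o) p
  have h0 : ContMDiffAt 𝓘(ℝ, E2 × ℝ) 𝓘(ℝ, E2) ∞ (fun _ : UnitTangentBundle g => (0 : E2)) p :=
    contMDiffAt_const
  refine ContMDiffAt.congr_of_eventuallyEq (h0.prodMk_space h.contMDiffAt_natRot) ?_
  filter_upwards [h.eventually] with q hq
  exact hq.natVel_verticalField

theorem contMDiff_thermostat {lam : UnitTangentBundle g → ℝ}
    (hlam : ContMDiff 𝓘(ℝ, E2 × ℝ) 𝓘(ℝ, ℝ) ∞ lam) :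
    ContMDiff 𝓘(ℝ, E2 × ℝ) 𝓘(ℝ, E2 × ℝ).tangent ∞
      (fun q => (⟨q, thermostat g o lam q⟩ :
        TangentBundle 𝓘(ℝ, E2 × ℝ) (UnitTangentBundle g))) :=
  (contMDiff_geodesicField o).add_section (hlam.smul_section contMDiff_verticalField)

/-- The component of a tangent vector of `SM` along `X`. -/
def compX (p q : UnitTangentBundle g) (ξ : TangentSpace 𝓘(ℝ, E2 × ℝ) q) : ℝ :=
  metricForm g p.base (natCoord p q).1 (natCoord p q).2 (natVel p q ξ).1

/-- The component of a tangent vector of `SM` along `H`. -/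
def compH (o : SurfaceOrientation M) (p q : UnitTangentBundle g)
    (ξ : TangentSpace 𝓘(ℝ, E2 × ℝ) q) : ℝ :=
  metricForm g p.base (natCoord p q).1 (natRot o p q) (natVel p q ξ).1

/-- The component of a tangent vector of `SM` along `V`. -/
def compV (o : SurfaceOrientation M) (p q : UnitTangentBundle g)
    (ξ : TangentSpace 𝓘(ℝ, E2 × ℝ) q) : ℝ :=
  metricForm g p.base (natCoord p q).1 (natRot o p q) ((natVel p q ξ).2 +
    connForm g p.base (natCoord p q).1 (natVel p q ξ).1 (natCoord p q).2)

/-- The base component is expanded in the orthonormal basis `v`, `J v`. The vertical part has no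
component along `v` by `natVel_tangent`, so it is a multiple of `J v`. -/
theorem Adapted.eq_frame {p q : UnitTangentBundle g} (h : Adapted g o p q)
    (ξ : TangentSpace 𝓘(ℝ, E2 × ℝ) q) : ξ = compX p q ξ • geodesicField g q +
      compH o p q ξ • horizontalField g o q + compV o p q ξ • verticalField g o q := by
  apply natVel_injective p h.mem_source
  rw [map_add, map_add, map_smul, map_smul, map_smul, h.natVel_geodesicField,
    h.natVel_horizontalField, h.natVel_verticalField]
  have h1 := h.expand (natVel p q ξ).1
  have h2 := h.expand ((natVel p q ξ).2 +
    connForm g p.base (natCoord p q).1 (natVel p q ξ).1 (natCoord p q).2)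
  rw [natVel_tangent p h.base_mem, zero_smul, zero_add] at h2
  refine Prod.ext ?_ ?_
  · simpa [compX, compH] using h1
  · have h3 := congrArg (fun a => connForm g p.base (natCoord p q).1 a (natCoord p q).2) h1
    simp only [map_add, map_smul, add_apply, smul_apply] at h3
    have h4 : (natVel p q ξ).2 = compV o p q ξ • natRot o p q -
        connForm g p.base (natCoord p q).1 (natVel p q ξ).1 (natCoord p q).2 :=
      eq_sub_of_add_eq h2
    rw [h3] at h4
    refine h4.trans ?_
    simp only [Prod.snd_add, Prod.smul_snd, smul_neg, compX, compH]
    module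

theorem Adapted.comp_frame {p q : UnitTangentBundle g} (h : Adapted g o p q) (a b c : ℝ) :
    compX p q (a • geodesicField g q + b • horizontalField g o q + c • verticalField g o q) = a ∧
    compH o p q (a • geodesicField g q + b • horizontalField g o q + c • verticalField g o q) = b ∧
    compV o p q (a • geodesicField g q + b • horizontalField g o q + c • verticalField g o q) =
      c := by
  have e : natVel p q (a • geodesicField g q + b • horizontalField g o q +
      c • verticalField g o q) = (a • (natCoord p q).2 + b • natRot o p q,
        c • natRot o p q - connForm g p.base (natCoord p q).1
          (a • (natCoord p q).2 + b • natRot o p q) (natCoord p q).2) := by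
    rw [map_add, map_add, map_smul, map_smul, map_smul, h.natVel_geodesicField,
      h.natVel_horizontalField, h.natVel_verticalField]
    refine Prod.ext ?_ ?_
    · simp
    · simp only [Prod.snd_add, Prod.smul_snd, map_add, map_smul, add_apply, smul_apply]
      module
  unfold compX compH compV
  rw [e]
  simp only [sub_add_cancel, map_add, map_smul, smul_eq_mul, h.unit, h.vec_rot, h.rot_vec,
    h.unit_rot]
  refine ⟨?_, ?_, ?_⟩ <;> ring

/-- The components in the moving frame do not depend on the coordinates. -/
theorem Adapted.comp_eq {p q : UnitTangentBundle g} (h : Adapted g o p q)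
    (ξ : TangentSpace 𝓘(ℝ, E2 × ℝ) q) : compX p q ξ = compX q q ξ ∧
      compH o p q ξ = compH o q q ξ ∧ compV o p q ξ = compV o q q ξ := by
  have h1 := h.comp_frame (compX q q ξ) (compH o q q ξ) (compV o q q ξ)
  rwa [← (adapted_self q).eq_frame ξ] at h1

end MovingFrame

end Thermostat
end

noncomputable section
namespace Thermostat

/-! ### The unit tangent bundle is Hausdorff, compact and first countable. -/

section UnitTangentTopology

variable {M : Type*} [TopologicalSpace M] [ChartedSpace E2 M] [IsManifold 𝓘(ℝ, E2) ∞ M]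
variable {g : SurfaceMetric M}

open UnitTangentBundle

instance [T2Space M] : T2Space (UnitTangentBundle g) := by
  refine ⟨fun p q hpq => ?_⟩
  by_cases hb : p.base = q.base
  · set S : Set (UnitTangentBundle g) := {r | r.base ∈ (chartAt E2 p.base).source}
    have hS : IsOpen S := (chartAt E2 p.base).open_source.preimage continuous_base
    have hp : p ∈ S := mem_chart_source E2 p.base
    have hq : q ∈ S := by
      change q.base ∈ (chartAt E2 p.base).source
      rw [← hb]
      exact mem_chart_source E2 p.base
    have hne : natCoord p p ≠ natCoord p q := fun h => hpq (incl_injective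
      ((tmChart p.incl).injOn ((mem_tmChart_source _ _).2 hp) ((mem_tmChart_source _ _).2 hq) h))
    obtain ⟨U, W, hU, hW, hpU, hqW, hd⟩ := t2_separation hne
    have hc : ContinuousOn (natCoord p) S := fun r hr =>
      (contMDiffAt_natCoord p hr).continuousAt.continuousWithinAt
    refine ⟨S ∩ natCoord p ⁻¹' U, S ∩ natCoord p ⁻¹' W, hc.isOpen_inter_preimage hS hU,
      hc.isOpen_inter_preimage hS hW, ⟨hp, hpU⟩, ⟨hq, hqW⟩, ?_⟩
    exact (hd.preimage _).mono Set.inter_subset_right Set.inter_subset_right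
  · obtain ⟨U, W, hU, hW, hpU, hqW, hd⟩ := t2_separation hb
    exact ⟨_, _, hU.preimage continuous_base, hW.preimage continuous_base, hpU, hqW,
      hd.preimage _⟩

theorem continuousAt_retract (p : UnitTangentBundle g) {q : TangentBundle 𝓘(ℝ, E2) M}
    (hq : 0 < normSq g q) : ContinuousAt (retract p) q := by
  rw [(Topology.IsInducing.mk rfl : Topology.IsInducing (incl (g := g))).continuousAt_iff]
  refine (contMDiffAt_radialProj g _ hq).continuousAt.congr ?_
  filter_upwards [(contMDiff_normSq g).continuous.continuousAt.eventually (lt_mem_nhds hq)]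
    with q' hq'
  simp only [Function.comp, retract, dif_pos hq']

theorem retract_smul (p q : UnitTangentBundle g) {c : ℝ} (hc : 0 < c) :
    retract p ⟨q.incl.1, c • q.incl.2⟩ = q := by
  have h2 : normSq g (⟨q.incl.1, c • q.incl.2⟩ : TangentBundle 𝓘(ℝ, E2) M) = c * c := by
    have := q.normSq_incl
    simp only [normSq] at this
    simp [normSq, this]
  unfold retract
  rw [dif_pos (by rw [h2]; exact mul_pos hc hc)]
  refine incl_injective ?_
  change radialProj g _ = _
  unfold radialProj
  rw [h2, Real.sqrt_mul_self hc.le]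
  simp only [smul_smul, inv_mul_cancel₀ hc.ne', one_smul]

/-- Over a small coordinate ball, `SM` is contained in the image under the retraction of a closed
ball times the coordinate unit circle; finitely many such compact images cover it. -/
instance [CompactSpace M] : CompactSpace (UnitTangentBundle g) := by
  rcases isEmpty_or_nonempty (UnitTangentBundle g) with he | ⟨⟨p⟩⟩
  · exact ⟨by rw [Set.univ_eq_empty_iff.2 he]; exact isCompact_empty⟩
  obtain ⟨C, hC, hCs⟩ := (isCompact_univ (X := M)).induction_on
    (p := fun S => ∃ C : Set (UnitTangentBundle g), IsCompact C ∧ base ⁻¹' S ⊆ C)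
    ⟨∅, isCompact_empty, by simp⟩
    (fun S T hST ⟨C, hC, h⟩ => ⟨C, hC, (Set.preimage_mono hST).trans h⟩)
    (fun S T ⟨C, hC, h⟩ ⟨C', hC', h'⟩ => ⟨C ∪ C', hC.union hC', by
      rw [Set.preimage_union]; exact Set.union_subset_union h h'⟩)
    (fun x₀ _ => by
      set e := chartAt E2 x₀
      have hx₀ := mem_chart_source E2 x₀
      obtain ⟨r, hr, hball⟩ := Metric.nhds_basis_closedBall.mem_iff.1
        (e.open_target.mem_nhds (e.map_source hx₀))
      set q₀ : TangentBundle 𝓘(ℝ, E2) M := ⟨x₀, 0⟩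
      set K : Set (E2 × E2) := Metric.closedBall (e x₀) r ×ˢ Metric.sphere 0 1
      have hK : IsCompact K := (isCompact_closedBall _ _).prod (isCompact_sphere _ _)
      have hpos : ∀ z ∈ K, 0 < normSq g ((tmChart q₀).symm z) := by
        rintro z ⟨hz1, hz2⟩
        refine normSq_pos g _ q₀ ?_
        rw [(tmChart q₀).right_inv ((mem_tmChart_target _ _).2 (hball hz1))]
        intro h0
        rw [mem_sphere_zero_iff_norm, h0, norm_zero] at hz2
        exact zero_ne_one hz2
      have hcont : ContinuousOn (fun z => retract p ((tmChart q₀).symm z)) K := fun z hz =>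
        ((continuousAt_retract p (hpos z hz)).comp ((tmChart q₀).symm.continuousAt
          ((mem_tmChart_target _ _).2 (hball hz.1)))).continuousWithinAt
      refine ⟨e.source ∩ e ⁻¹' Metric.ball (e x₀) r, mem_nhdsWithin_of_mem_nhds
        ((e.isOpen_inter_preimage Metric.isOpen_ball).mem_nhds
          ⟨hx₀, Metric.mem_ball_self hr⟩), _, hK.image_of_continuousOn hcont, ?_⟩
      rintro q ⟨hqs, hqb⟩
      have hqs' : q.incl ∈ (tmChart q₀).source := (mem_tmChart_source _ _).2 hqs
      set w := (tmChart q₀ q.incl).2 with hw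
      have hw0 : w ≠ 0 := tmChart_snd_ne g _ _ hqs' (by rw [q.normSq_incl]; exact one_pos)
      have hc : 0 < ‖w‖⁻¹ := inv_pos.2 (norm_pos_iff.2 hw0)
      refine ⟨(e q.base, ‖w‖⁻¹ • w), ⟨Metric.ball_subset_closedBall hqb, ?_⟩, ?_⟩
      · rw [mem_sphere_zero_iff_norm, norm_smul, norm_inv, norm_norm,
          inv_mul_cancel₀ (norm_pos_iff.2 hw0).ne']
      · have h1 : (tmChart q₀).symm (e q.base, ‖w‖⁻¹ • w) = ⟨q.incl.1, ‖w‖⁻¹ • q.incl.2⟩ := by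
          rw [show (e q.base, ‖w‖⁻¹ • w) = tmChart q₀ ⟨q.incl.1, ‖w‖⁻¹ • q.incl.2⟩ from
            (tmChart_smul q₀ q.incl.1 q.incl.2 _).symm]
          exact (tmChart q₀).left_inv ((mem_tmChart_source _ _).2 hqs)
        simp only
        rw [h1]
        exact retract_smul p q hc)
  exact ⟨hC.of_isClosed_subset isClosed_univ fun q _ => hCs (Set.mem_univ _)⟩

/-- Required by the dominated convergence argument of `continuous_exp_average`. -/
instance [CompactSpace M] : FirstCountableTopology (UnitTangentBundle g) := by
  have : SecondCountableTopology (UnitTangentBundle g) :=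
    ChartedSpace.secondCountable_of_sigmaCompact (E2 × ℝ) (UnitTangentBundle g)
  infer_instance

end UnitTangentTopology

/-! ### The variational equations on the unit tangent bundle. -/

section Variation

variable {M : Type*} [TopologicalSpace M] [ChartedSpace E2 M] [IsManifold 𝓘(ℝ, E2) ∞ M]
variable {g : SurfaceMetric M} {o : SurfaceOrientation M}

open UnitTangentBundle

/-- At time zero the flow is the identity only propositionally, and the tangent space at `ψ q`
depends on `ψ`. Substituting for the whole map avoids transporting vectors between tangent spaces.
-/
theorem natVel_mfderiv_of_eq_id {ψ : UnitTangentBundle g → UnitTangentBundle g}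
    (hψ : ψ = id) (p q : UnitTangentBundle g) (ξ : TangentSpace 𝓘(ℝ, E2 × ℝ) q) :
    natVel p (ψ q) (mfderiv 𝓘(ℝ, E2 × ℝ) 𝓘(ℝ, E2 × ℝ) ψ q ξ) = natVel p q ξ := by
  subst hψ
  rw [mfderiv_id]
  rfl

theorem hasDerivAt_natCoord {F : ∀ q : UnitTangentBundle g, TangentSpace 𝓘(ℝ, E2 × ℝ) q}
    {φ : ℝ → UnitTangentBundle g → UnitTangentBundle g} (hφ : IsFlowOf 𝓘(ℝ, E2 × ℝ) F φ)
    {p q : UnitTangentBundle g} (h : q.base ∈ (chartAt E2 p.base).source) :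
    HasDerivAt (fun s => natCoord p (φ s q)) (natVel p q (F q)) 0 := by
  have h0 := hφ.map_zero q
  have h1 : HasMFDerivAt 𝓘(ℝ, E2 × ℝ) 𝓘(ℝ, E2 × E2) (natCoord p) (φ 0 q) (natVel p (φ 0 q)) :=
    hasMFDerivAt_natCoord p (by rw [h0]; exact h)
  have h2 : HasMFDerivAt 𝓘(ℝ, ℝ) 𝓘(ℝ, E2 × E2) (fun s => natCoord p (φ s q)) (0 : ℝ) _ :=
    HasMFDerivAt.comp (f := fun t => φ t q) (0 : ℝ) h1 (hφ.isMIntegralCurve q 0)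
  obtain ⟨A, hA, hA1⟩ : ∃ A : ℝ →L[ℝ] E2 × E2, HasFDerivAt (fun s => natCoord p (φ s q)) A 0 ∧
      A 1 = natVel p (φ 0 q) ((1 : ℝ) • F (φ 0 q)) :=
    ⟨_, h2.hasFDerivAt, rfl⟩
  refine hA.hasDerivAt.congr_deriv ?_
  have h3 : ∀ q', q' = q → natVel p q' (F q') = natVel p q (F q) := by
    rintro q' rfl
    rfl
  rw [← h3 _ h0, hA1, one_smul]

/-- The derivative of the natural components of the thermostat vector field. -/
theorem Adapted.mfderiv_natVel_thermostat {lam : UnitTangentBundle g → ℝ}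
    {p q : UnitTangentBundle g} (h : Adapted g o p q)
    (hlam : MDifferentiableAt 𝓘(ℝ, E2 × ℝ) 𝓘(ℝ, ℝ) lam q) (ξ : TangentSpace 𝓘(ℝ, E2 × ℝ) q)
    {y v n a b : E2} {dl : ℝ} (hy : (natCoord p q).1 = y) (hv : (natCoord p q).2 = v)
    (hn : natRot o p q = n) (ha : (natVel p q ξ).1 = a) (hb : (natVel p q ξ).2 = b)
    (hdl : mfderiv 𝓘(ℝ, E2 × ℝ) 𝓘(ℝ, ℝ) lam q ξ = dl) :
    mfderiv 𝓘(ℝ, E2 × ℝ) 𝓘(ℝ, E2 × E2) (fun q => natVel p q (thermostat g o lam q)) q ξ =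
      (b, -(fderiv ℝ (connForm g p.base) y a v v + connForm g p.base y b v +
        connForm g p.base y v b) + (dl • n + lam q •
          (fderiv ℝ (rotForm g o p.base) y a v + rotForm g o p.base y b))) := by
  set Ψ : (E2 × E2) × ℝ → E2 × E2 := fun z => (z.1.2,
    -connForm g p.base z.1.1 z.1.2 z.1.2 + z.2 • rotForm g o p.base z.1.1 z.1.2) with hΨ
  have hev : (fun q => natVel p q (thermostat g o lam q)) =ᶠ[𝓝 q]
      fun q => Ψ (natCoord p q, lam q) := by
    filter_upwards [h.eventually] with q' hq'
    exact hq'.natVel_thermostat lam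
  have h1 : HasMFDerivAt 𝓘(ℝ, E2 × ℝ) 𝓘(ℝ, (E2 × E2) × ℝ) (fun q => (natCoord p q, lam q)) q
      ((natVel p q).prod (mfderiv 𝓘(ℝ, E2 × ℝ) 𝓘(ℝ, ℝ) lam q)) := by
    rw [modelWithCornersSelf_prod, ← chartedSpaceSelf_prod]
    exact HasMFDerivAt.prodMk (hasMFDerivAt_natCoord p h.base_mem) hlam.hasMFDerivAt
  have d1 : HasFDerivAt (fun z : (E2 × E2) × ℝ => z.1) (ContinuousLinearMap.fst ℝ (E2 × E2) ℝ)
      (natCoord p q, lam q) := hasFDerivAt_fst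
  have dl' : HasFDerivAt (fun z : (E2 × E2) × ℝ => z.2) (ContinuousLinearMap.snd ℝ (E2 × E2) ℝ)
      (natCoord p q, lam q) := hasFDerivAt_snd
  have dv := d1.snd
  have dy := d1.fst
  have dΓ : HasFDerivAt (fun z : (E2 × E2) × ℝ => connForm g p.base z.1.1) _
      (natCoord p q, lam q) :=
    HasFDerivAt.comp (g := connForm g p.base) (f := fun z : (E2 × E2) × ℝ => z.1.1)
      (natCoord p q, lam q) h.leviCivita.differentiableAt_conn.hasFDerivAt dy
  have dJ : HasFDerivAt (fun z : (E2 × E2) × ℝ => rotForm g o p.base z.1.1) _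
      (natCoord p q, lam q) :=
    HasFDerivAt.comp (g := rotForm g o p.base) (f := fun z : (E2 × E2) × ℝ => z.1.1)
      (natCoord p q, lam q) h.rotation.differentiableAt.hasFDerivAt dy
  have dΨ : HasFDerivAt Ψ _ (natCoord p q, lam q) :=
    dv.prodMk (((dΓ.clm_apply dv).clm_apply dv).neg.add (dl'.smul (dJ.clm_apply dv)))
  obtain ⟨A, hA, hAe⟩ : ∃ A : (E2 × E2) × ℝ →L[ℝ] E2 × E2, HasFDerivAt Ψ A (natCoord p q, lam q) ∧
      A ((a, b), dl) = (b, -(fderiv ℝ (connForm g p.base) y a v v + connForm g p.base y b v +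
        connForm g p.base y v b) + (dl • n + lam q •
          (fderiv ℝ (rotForm g o p.base) y a v + rotForm g o p.base y b))) := by
    refine ⟨_, dΨ, ?_⟩
    have hn' : rotForm g o p.base y v = n := by
      rw [← hn, ← hy, ← hv]
      rfl
    simp [hy, hv, hn']
    abel
  have h2 := (hA.hasMFDerivAt.comp q h1).congr_of_eventuallyEq hev
  rw [h2.mfderiv, ← hAe, ← ha, ← hb, ← hdl]
  rfl

/-- The derivatives at time zero of the components of `dφ_s ξ` in the moving frame. -/
theorem Adapted.variation {lam : UnitTangentBundle g → ℝ}
    (hlam : ContMDiff 𝓘(ℝ, E2 × ℝ) 𝓘(ℝ, ℝ) ∞ lam)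
    {φ : ℝ → UnitTangentBundle g → UnitTangentBundle g}
    (hφ : IsSmoothFlow (thermostat g o lam) φ) {p q : UnitTangentBundle g} (h : Adapted g o p q)
    (ξ : TangentSpace 𝓘(ℝ, E2 × ℝ) q) {dl : ℝ}
    (hdl : mfderiv 𝓘(ℝ, E2 × ℝ) 𝓘(ℝ, ℝ) lam q ξ = dl) :
    HasDerivAt (fun s => compX p (φ s q) (mfderiv 𝓘(ℝ, E2 × ℝ) 𝓘(ℝ, E2 × ℝ) (φ s) q ξ))
      (lam q * compH o p q ξ) 0 ∧
    HasDerivAt (fun s => compH o p (φ s q) (mfderiv 𝓘(ℝ, E2 × ℝ) 𝓘(ℝ, E2 × ℝ) (φ s) q ξ))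
      (compV o p q ξ - lam q * compX p q ξ) 0 ∧
    HasDerivAt (fun s => compV o p (φ s q) (mfderiv 𝓘(ℝ, E2 × ℝ) 𝓘(ℝ, E2 × ℝ) (φ s) q ξ))
      (-(sectional (metricForm g p.base) (connForm g p.base) (stdVec 0) (stdVec 1)
        (natCoord p q).1 * compH o p q ξ) + dl) 0 := by
  set A : ℝ → E2 × E2 := fun s =>
    natVel p (φ s q) (mfderiv 𝓘(ℝ, E2 × ℝ) 𝓘(ℝ, E2 × ℝ) (φ s) q ξ) with hA
  have h0 : φ 0 q = q := hφ.isFlowOf.map_zero q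
  have hA0 : A 0 = natVel p q ξ :=
    natVel_mfderiv_of_eq_id (funext hφ.isFlowOf.map_zero) p q ξ
  have hc : HasDerivAt (fun s => natCoord p (φ s q)) _ 0 :=
    hasDerivAt_natCoord hφ.isFlowOf h.base_mem
  rw [h.natVel_thermostat] at hc
  -- The linearised equation is tested against the natural coordinates themselves: the components of
  -- the transported vector change at the rate given by the derivative of the components of the
  -- vector field.
  have hA' : HasDerivAt A _ 0 :=
    hφ.linearized (E2 × E2) q (natCoord p) (contMDiffAt_natCoord p h.base_mem) ξ
  have hW := h.mfderiv_natVel_thermostat ((hlam q).mdifferentiableAt (by simp)) ξ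
    (hy := rfl) (hv := rfl) (hn := rfl) (ha := rfl) (hb := rfl) (hdl := hdl)
  replace hA' := hA'.congr_deriv hW
  have hy := hasFDerivAt_fst.comp_hasDerivAt (0 : ℝ) hc
  have hv := hasFDerivAt_snd.comp_hasDerivAt (0 : ℝ) hc
  have ha := hasFDerivAt_fst.comp_hasDerivAt (0 : ℝ) hA'
  have hb := hasFDerivAt_snd.comp_hasDerivAt (0 : ℝ) hA'
  have n0 : natCoord p (φ 0 q) = natCoord p q := by rw [h0]
  have hnb : ∀ᶠ z in 𝓝 (natCoord p q).1, z ∈ (chartAt E2 p.base).target :=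
    (chartAt E2 p.base).open_target.mem_nhds (natCoord_mem p h.base_mem)
  have key := LeviCivita.variation (G := metricForm g p.base) (Γ := connForm g p.base)
    (J := rotForm g o p.base) (y := fun s => (natCoord p (φ s q)).1)
    (v := fun s => (natCoord p (φ s q)).2) (a := fun s => (A s).1) (b := fun s => (A s).2)
    (t := 0) (k := lam q) (dk := dl) (e₀ := stdVec 0) (e₁ := stdVec 1)
    (by
      rw [n0]
      filter_upwards [hnb] with z hz
      exact Thermostat.leviCivita g p.base hz)
    (by
      rw [n0]
      filter_upwards [hnb] with z hz
      exact rotation_rotForm g o p.base hz)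
    (fun w => ⟨_, _, eq_sum_stdVec w⟩)
    (by rw [n0]; exact hy)
    (by rw [n0]; exact hv)
    (by rw [hA0]; exact ha)
    (by rw [n0, hA0]; exact hb)
    (by rw [n0]; exact h.unit)
    (by rw [n0, hA0]; exact natVel_tangent p h.base_mem ξ)
  simp only [n0, hA0] at key
  exact key

end Variation

end Thermostat
end

noncomputable section
namespace Thermostat

/-! ### The Anosov criterion in terms of a frame. -/

section AnosovCriterion

/-- A solution of the linearised equation which starts in the invariant line stays in it. -/
theorem riccati_line {x y w u X a b l : ℝ → ℝ} (hu0 : ∀ t, 0 < u t) (huc : Continuous u)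
    (hb : Continuous b) (hx : ∀ t, HasDerivAt x (l t * y t) t)
    (hy : ∀ t, HasDerivAt y (a t * y t + w t) t) (hw : ∀ t, HasDerivAt w (b t * y t) t)
    (hu : ∀ t, HasDerivAt u (b t - a t * u t - u t ^ 2) t)
    (hX : ∀ t, HasDerivAt X ((l t - b t * X t) / u t) t)
    (hy0 : w 0 = u 0 * y 0) (hx0 : x 0 = X 0 * w 0) (t : ℝ) :
    w t = u t * y t ∧ x t = X t * w t ∧
      w t = w 0 * Real.exp (∫ s in (0 : ℝ)..t, b s / u s) := by
  -- The defect `w - u y` satisfies `p' = -u p`, so it stays zero.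
  have hp : ∀ t, w t - u t * y t = 0 := fun t => by
    have h := eq_mul_exp_integral (f := fun t => w t - u t * y t) (k := fun t => -u t)
      huc.neg (fun t => ((hw t).sub ((hu t).mul (hy t))).congr_deriv (by ring)) t
    rw [h, hy0, sub_self, zero_mul]
  have hyw : ∀ t, w t = u t * y t := fun t => sub_eq_zero.1 (hp t)
  -- Once `w = u y`, the defect `x - X w` has zero derivative.
  have hz : ∀ t, x t - X t * w t = 0 := fun t => by
    have h := eq_mul_exp_integral (f := fun t => x t - X t * w t) (k := fun _ => 0)
      continuous_const (fun t => ((hx t).sub ((hX t).mul (hw t))).congr_deriv (by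
        have := (hu0 t).ne'
        rw [hyw t]
        field_simp
        ring)) t
    rw [h, hx0, sub_self, zero_mul]
  refine ⟨hyw t, sub_eq_zero.1 (hz t), ?_⟩
  refine eq_mul_exp_integral (hb.div huc fun t => (hu0 t).ne') (fun t => ?_) t
  refine (hw t).congr_deriv ?_
  have := (hu0 t).ne'
  simp only [Pi.div_apply]
  rw [hyw t]
  field_simp

variable {E : Type*} [NormedAddCommGroup E] [NormedSpace ℝ E]
  {N : Type*} [TopologicalSpace N] [ChartedSpace E N] [IsManifold 𝓘(ℝ, E) ∞ N]

/-- `F`, `B`, `W` is a frame of `TN`, with dual coframe `cx`, `cy`, `cw`. -/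
structure IsFrame (F B W : ∀ p : N, TangentSpace 𝓘(ℝ, E) p)
    (cx cy cw : ∀ p : N, TangentSpace 𝓘(ℝ, E) p → ℝ) : Prop where
  expand : ∀ p ξ, ξ = cx p ξ • F p + cy p ξ • B p + cw p ξ • W p
  coeff : ∀ p a b c, cx p (a • F p + b • B p + c • W p) = a ∧
    cy p (a • F p + b • B p + c • W p) = b ∧ cw p (a • F p + b • B p + c • W p) = c

variable {F B W : ∀ p : N, TangentSpace 𝓘(ℝ, E) p}
  {cx cy cw : ∀ p : N, TangentSpace 𝓘(ℝ, E) p → ℝ}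

/-- Under time reversal together with `W ↦ -W`, the system `x' = l y`, `y' = a y + w`, `w' = b y`
keeps its form and the positive `b`, while `a` and `l` change sign. The stable line is thus an
instance of the unstable one. -/
theorem IsFrame.neg (h : IsFrame F B W cx cy cw) :
    IsFrame F B (fun p => -W p) cx cy (fun p ξ => -cw p ξ) where
  expand p ξ := by
    rw [neg_smul_neg]
    exact h.expand p ξ
  coeff p a b c := by
    have h1 := h.coeff p a b (-c)
    rw [neg_smul] at h1
    simp only [smul_neg]
    exact ⟨h1.1, h1.2.1, by rw [h1.2.2, neg_neg]⟩

/-- The Riccati equation yields an invariant line field for a linear cocycle. -/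
theorem IsFrame.exists_line [CompactSpace N] [FirstCountableTopology N]
    (hfr : IsFrame F B W cx cy cw) {ψ : ℝ → N → N} {a b l : N → ℝ}
    (hψ : Continuous fun z : ℝ × N => ψ z.1 z.2) (hadd : ∀ s t p, ψ (s + t) p = ψ s (ψ t p))
    (h0 : ∀ p, ψ 0 p = p)
    (ha : Continuous a) (hb : Continuous b) (hl : Continuous l) (hpos : ∀ p, 0 < b p)
    (D : ∀ (t : ℝ) (p : N), TangentSpace 𝓘(ℝ, E) p → TangentSpace 𝓘(ℝ, E) (ψ t p))
    (hD0 : ∀ p ξ, cx (ψ 0 p) (D 0 p ξ) = cx p ξ ∧ cy (ψ 0 p) (D 0 p ξ) = cy p ξ ∧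
      cw (ψ 0 p) (D 0 p ξ) = cw p ξ)
    (hx : ∀ p ξ t, HasDerivAt (fun t => cx (ψ t p) (D t p ξ))
      (l (ψ t p) * cy (ψ t p) (D t p ξ)) t)
    (hy : ∀ p ξ t, HasDerivAt (fun t => cy (ψ t p) (D t p ξ))
      (a (ψ t p) * cy (ψ t p) (D t p ξ) + cw (ψ t p) (D t p ξ)) t)
    (hw : ∀ p ξ t, HasDerivAt (fun t => cw (ψ t p) (D t p ξ))
      (b (ψ t p) * cy (ψ t p) (D t p ξ)) t) :
    ∃ (X Y : N → ℝ) (μ : ℝ) (r : ℝ → N → ℝ), Continuous X ∧ Continuous Y ∧ (∀ p, 0 < Y p) ∧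
      0 < μ ∧ (∀ t p, 0 < r t p) ∧ (∀ t ≥ 0, ∀ p, r (-t) p ≤ Real.exp (-μ * t)) ∧
      ∀ t p, D t p (X p • F p + Y p • B p + (1 : ℝ) • W p) =
        r t p • (X (ψ t p) • F (ψ t p) + Y (ψ t p) • B (ψ t p) + (1 : ℝ) • W (ψ t p)) := by
  obtain ⟨u, X, hu, hX, hu0, hu', hX'⟩ := exists_riccati_section hψ hadd ha hb hl hpos
  have hψt : ∀ p, Continuous fun t => ψ t p := fun p =>
    hψ.comp (continuous_id.prodMk continuous_const)
  have hbu : Continuous fun p => b p / u p := hb.div hu fun p => (hu0 p).ne'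
  obtain ⟨μ, hμ, hμb⟩ := isCompact_univ.exists_forall_le' hbu.continuousOn
    (a := 0) fun p _ => div_pos (hpos p) (hu0 p)
  -- The spanning vector is normalised to have `W`-component one, so `y = u⁻¹` and the factor `r` by
  -- which it is stretched is that of `w`, the exponential of the integral of `b / u`.
  refine ⟨X, fun p => (u p)⁻¹, μ, fun t p => Real.exp (∫ s in (0 : ℝ)..t, b (ψ s p) / u (ψ s p)),
    hX, hu.inv₀ fun p => (hu0 p).ne', fun p => inv_pos.2 (hu0 p), hμ, fun t p => Real.exp_pos _,
    fun t ht p => ?_, fun t p => ?_⟩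
  · refine Real.exp_le_exp.2 ?_
    rw [intervalIntegral.integral_symm, neg_mul]
    refine neg_le_neg ?_
    have h1 : ∫ _s in (-t)..(0 : ℝ), μ = μ * t := by
      rw [intervalIntegral.integral_const, smul_eq_mul]
      ring
    rw [← h1]
    refine intervalIntegral.integral_mono_on (by linarith) (by simp)
      ((hbu.comp (hψt p)).intervalIntegrable _ _) fun s _ => hμb _ (Set.mem_univ _)
  · set ξ := X p • F p + (u p)⁻¹ • B p + (1 : ℝ) • W p with hξ
    obtain ⟨c1, c2, c3⟩ := hfr.coeff p (X p) (u p)⁻¹ 1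
    obtain ⟨d1, d2, d3⟩ := hD0 p ξ
    rw [← hξ] at c1 c2 c3
    obtain ⟨e1, e2, e3⟩ := riccati_line (u := fun t => u (ψ t p)) (X := fun t => X (ψ t p))
      (fun t => hu0 _) (hu.comp (hψt p)) (hb.comp (hψt p)) (hx p ξ) (hy p ξ) (hw p ξ)
      (hu' p) (hX' p)
      (by rw [d3, c3, d2, c2, h0, mul_inv_cancel₀ (hu0 p).ne'])
      (by rw [d1, c1, d3, c3, h0, mul_one]) t
    rw [d3, c3, one_mul] at e3
    replace e3 : cw (ψ t p) (D t p ξ) = Real.exp (∫ s in (0 : ℝ)..t, b (ψ s p) / u (ψ s p)) := e3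
    rw [hfr.expand _ (D t p ξ), e2, smul_add, smul_add, smul_smul, smul_smul, smul_smul]
    beta_reduce
    rw [← e3, mul_one, mul_comm (X _), e1, mul_comm (u _), mul_inv_cancel_right₀ (hu0 _).ne']

theorem continuous_frame_section (hF : Continuous fun p => (⟨p, F p⟩ : TangentBundle 𝓘(ℝ, E) N))
    (hB : Continuous fun p => (⟨p, B p⟩ : TangentBundle 𝓘(ℝ, E) N))
    (hW : Continuous fun p => (⟨p, W p⟩ : TangentBundle 𝓘(ℝ, E) N)) {X Y Z : N → ℝ}
    (hX : Continuous X) (hY : Continuous Y) (hZ : Continuous Z) :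
    Continuous fun p => (⟨p, X p • F p + Y p • B p + Z p • W p⟩ : TangentBundle 𝓘(ℝ, E) N) := by
  have cf : ∀ {f : N → ℝ}, Continuous f → ContMDiff 𝓘(ℝ, E) 𝓘(ℝ, ℝ) 0 f := fun h =>
    contMDiff_zero_iff.2 h
  have cs : ∀ {G : ∀ p : N, TangentSpace 𝓘(ℝ, E) p},
      (Continuous fun p => (⟨p, G p⟩ : TangentBundle 𝓘(ℝ, E) N)) →
      ContMDiff 𝓘(ℝ, E) 𝓘(ℝ, E).tangent 0 fun p => (⟨p, G p⟩ : TangentBundle 𝓘(ℝ, E) N) := fun h =>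
    contMDiff_zero_iff.2 h
  exact contMDiff_zero_iff.1 ((((cf hX).smul_section (cs hF)).add_section
    ((cf hY).smul_section (cs hB))).add_section ((cf hZ).smul_section (cs hW)))

theorem map_span_singleton {p : N} {q : N} (D : TangentSpace 𝓘(ℝ, E) p →L[ℝ] TangentSpace 𝓘(ℝ, E) q)
    {ξ : TangentSpace 𝓘(ℝ, E) p} {η : TangentSpace 𝓘(ℝ, E) q} {r : ℝ} (hr : 0 < r)
    (h : D ξ = r • η) : (Submodule.span ℝ {ξ}).map D.toLinearMap = Submodule.span ℝ {η} := by
  rw [Submodule.map_span, Set.image_singleton]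
  change Submodule.span ℝ {D ξ} = _
  rw [h]
  exact Submodule.span_singleton_smul_eq (IsUnit.mk0 r hr.ne') η

/-- The bounds of a continuous nowhere vanishing vector field on a compact manifold. -/
theorem exists_bounds_inner [CompactSpace N] {σ : ∀ p : N, TangentSpace 𝓘(ℝ, E) p}
    (hσ : Continuous fun p => (⟨p, σ p⟩ : TangentBundle 𝓘(ℝ, E) N)) (h0 : ∀ p, σ p ≠ 0)
    (h : ContinuousRiemannianMetric E (fun p : N => TangentSpace 𝓘(ℝ, E) p)) :
    ∃ m > 0, ∃ K > 0, ∀ p, m ≤ Real.sqrt (h.inner p (σ p) (σ p)) ∧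
      Real.sqrt (h.inner p (σ p) (σ p)) ≤ K := by
  have hc : Continuous fun p => Real.sqrt (h.inner p (σ p) (σ p)) := by
    let _ : RiemannianBundle (fun p : N => TangentSpace 𝓘(ℝ, E) p) := ⟨h.toRiemannianMetric⟩
    exact (Continuous.inner_bundle (F := E) (E := fun p : N => TangentSpace 𝓘(ℝ, E) p)
      (b := fun p => p) (v := σ) (w := σ) hσ hσ).sqrt
  obtain ⟨m, hm, hmb⟩ := isCompact_univ.exists_forall_le' hc.continuousOn
    (a := 0) fun p _ => Real.sqrt_pos.2 (h.pos p _ (h0 p))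
  obtain ⟨K, hK⟩ := isCompact_univ.exists_bound_of_continuousOn hc.continuousOn
  refine ⟨m, hm, max K 1, lt_max_of_lt_right one_pos, fun p => ⟨hmb p (Set.mem_univ _), ?_⟩⟩
  exact (le_abs_self _).trans ((hK p (Set.mem_univ _)).trans (le_max_left _ _))

theorem sqrt_inner_smul (h : ContinuousRiemannianMetric E (fun p : N => TangentSpace 𝓘(ℝ, E) p))
    {p : N} (c : ℝ) (ξ : TangentSpace 𝓘(ℝ, E) p) :
    Real.sqrt (h.inner p (c • ξ) (c • ξ)) = |c| * Real.sqrt (h.inner p ξ ξ) := by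
  have h1 : h.inner p (c • ξ) (c • ξ) = c ^ 2 * h.inner p ξ ξ := by
    rw [map_smul, map_smul (h.inner p)]
    simp only [smul_apply, smul_eq_mul]
    ring
  rw [h1, Real.sqrt_mul (sq_nonneg c), Real.sqrt_sq_eq_abs]

/-- The ratio `K / m` accounts for the variation of the length of `σ` from point to point, whatever
the metric; the rate is that of `r`. -/
theorem contraction_of_section (h : ContinuousRiemannianMetric E
    (fun p : N => TangentSpace 𝓘(ℝ, E) p)) {p q : N} {σ : ∀ p : N, TangentSpace 𝓘(ℝ, E) p}
    (D : TangentSpace 𝓘(ℝ, E) p →L[ℝ] TangentSpace 𝓘(ℝ, E) q) {m K r e : ℝ} (hm : 0 < m)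
    (hK : 0 < K)
    (hσ : ∀ p, m ≤ Real.sqrt (h.inner p (σ p) (σ p)) ∧ Real.sqrt (h.inner p (σ p) (σ p)) ≤ K)
    (hr : 0 < r) (hre : r ≤ e) (hD : D (σ p) = r • σ q) {ξ : TangentSpace 𝓘(ℝ, E) p}
    (hξ : ξ ∈ Submodule.span ℝ {σ p}) :
    Real.sqrt (h.inner q (D ξ) (D ξ)) ≤ K / m * e * Real.sqrt (h.inner p ξ ξ) := by
  obtain ⟨c, rfl⟩ := Submodule.mem_span_singleton.1 hξ
  rw [map_smul, hD, sqrt_inner_smul, sqrt_inner_smul, sqrt_inner_smul, abs_of_pos hr]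
  have h1 : r * Real.sqrt (h.inner q (σ q) (σ q)) ≤
      e * (K / m * Real.sqrt (h.inner p (σ p) (σ p))) := by
    refine mul_le_mul hre ?_ (Real.sqrt_nonneg _) (hr.le.trans hre)
    refine (hσ q).2.trans ?_
    rw [div_mul_eq_mul_div, le_div_iff₀ hm]
    exact mul_le_mul_of_nonneg_left (hσ p).1 hK.le
  calc _ ≤ |c| * (e * (K / m * Real.sqrt (h.inner p (σ p) (σ p)))) :=
        mul_le_mul_of_nonneg_left h1 (abs_nonneg c)
    _ = _ := by ring

theorem isInternal_of_linearIndependent {T : Type*} [AddCommGroup T] [Module ℝ T]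
    (hT : Module.finrank ℝ T = 3) {v₀ v₁ v₂ : T} (h : LinearIndependent ℝ ![v₀, v₁, v₂]) :
    DirectSum.IsInternal (![Submodule.span ℝ {v₀}, Submodule.span ℝ {v₁}, Submodule.span ℝ {v₂}] :
      Fin 3 → Submodule ℝ T) := by
  have e : (![Submodule.span ℝ {v₀}, Submodule.span ℝ {v₁}, Submodule.span ℝ {v₂}] :
      Fin 3 → Submodule ℝ T) = fun i => Submodule.span ℝ {(![v₀, v₁, v₂] : Fin 3 → T) i} := by
    funext i
    fin_cases i <;> rfl
  rw [e]
  refine DirectSum.isInternal_submodule_of_iSupIndep_of_iSup_eq_top h.iSupIndep_span_singleton ?_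
  rw [← Submodule.span_range_eq_iSup]
  exact h.span_eq_top_of_card_eq_finrank (by rw [hT, Fintype.card_fin])

/-- Modulo `F` the two lines have `B`-components of the same sign and `W`-components of opposite
sign. -/
theorem IsFrame.linearIndependent (hfr : IsFrame F B W cx cy cw) (p : N) (x y x' y' : ℝ)
    (hy : 0 < y) (hy' : 0 < y') :
    LinearIndependent ℝ ![F p, x • F p + y • B p + (1 : ℝ) • -W p,
      x' • F p + y' • B p + (1 : ℝ) • W p] := by
  rw [Fintype.linearIndependent_iff]
  intro c hc
  simp only [Fin.sum_univ_three, Matrix.cons_val_zero, Matrix.cons_val_one, Matrix.cons_val] at hc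
  obtain ⟨e1, e2, e3⟩ := hfr.coeff p (c 0 + c 1 * x + c 2 * x') (c 1 * y + c 2 * y') (c 2 - c 1)
  obtain ⟨d1, d2, d3⟩ := hfr.coeff p 0 0 0
  have h0 : (c 0 + c 1 * x + c 2 * x') • F p + (c 1 * y + c 2 * y') • B p + (c 2 - c 1) • W p =
      (0 : ℝ) • F p + (0 : ℝ) • B p + (0 : ℝ) • W p := by
    rw [zero_smul, zero_smul, zero_smul, add_zero, add_zero, ← hc]
    module
  rw [h0, d1] at e1
  rw [h0, d2] at e2
  rw [h0, d3] at e3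
  have h21 : c 2 = c 1 := by linarith
  have h1 : c 1 = 0 := by
    rw [h21, ← mul_add] at e2
    exact (mul_eq_zero.1 e2.symm).resolve_right (add_pos hy hy').ne'
  have h2 : c 2 = 0 := h21.trans h1
  have h00 : c 0 = 0 := by
    rw [h1, h2] at e1
    linarith
  intro i
  fin_cases i
  exacts [h00, h1, h2]

theorem frame_comp_of_eq_id {c : ∀ p : N, TangentSpace 𝓘(ℝ, E) p → ℝ} {ψ : N → N} (hψ : ψ = id)
    (p : N) (ξ : TangentSpace 𝓘(ℝ, E) p) :
    c (ψ p) (mfderiv 𝓘(ℝ, E) 𝓘(ℝ, E) ψ p ξ) = c p ξ := by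
  subst hψ
  rw [mfderiv_id]
  rfl

/-- A criterion for a flow on a closed `3`-manifold to be Anosov, in terms of the linearised
equation in a frame. -/
theorem IsFrame.isAnosov [CompactSpace N] [FirstCountableTopology N]
    (hE : Module.finrank ℝ E = 3) (hfr : IsFrame F B W cx cy cw)
    (hF : Continuous fun p => (⟨p, F p⟩ : TangentBundle 𝓘(ℝ, E) N))
    (hB : Continuous fun p => (⟨p, B p⟩ : TangentBundle 𝓘(ℝ, E) N))
    (hW : Continuous fun p => (⟨p, W p⟩ : TangentBundle 𝓘(ℝ, E) N))
    {φ : ℝ → N → N} (hφ : IsSmoothFlow F φ) {a b l : N → ℝ}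
    (ha : Continuous a) (hb : Continuous b) (hl : Continuous l) (hpos : ∀ p, 0 < b p)
    (hx : ∀ p ξ t, HasDerivAt (fun t => cx (φ t p) (mfderiv 𝓘(ℝ, E) 𝓘(ℝ, E) (φ t) p ξ))
      (l (φ t p) * cy (φ t p) (mfderiv 𝓘(ℝ, E) 𝓘(ℝ, E) (φ t) p ξ)) t)
    (hy : ∀ p ξ t, HasDerivAt (fun t => cy (φ t p) (mfderiv 𝓘(ℝ, E) 𝓘(ℝ, E) (φ t) p ξ))
      (a (φ t p) * cy (φ t p) (mfderiv 𝓘(ℝ, E) 𝓘(ℝ, E) (φ t) p ξ) +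
        cw (φ t p) (mfderiv 𝓘(ℝ, E) 𝓘(ℝ, E) (φ t) p ξ)) t)
    (hw : ∀ p ξ t, HasDerivAt (fun t => cw (φ t p) (mfderiv 𝓘(ℝ, E) 𝓘(ℝ, E) (φ t) p ξ))
      (b (φ t p) * cy (φ t p) (mfderiv 𝓘(ℝ, E) 𝓘(ℝ, E) (φ t) p ξ)) t) :
    IsAnosov 𝓘(ℝ, E) F := by
  have hid : φ 0 = id := funext hφ.isFlowOf.map_zero
  have hid' : φ (-0) = id := by rw [neg_zero, hid]
  obtain ⟨X, Y, μ, r, hX, hY, hY0, hμ, hr, hre, hu⟩ := hfr.exists_line hφ.continuous hφ.map_add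
    hφ.isFlowOf.map_zero ha hb hl hpos (fun t p => mfderiv 𝓘(ℝ, E) 𝓘(ℝ, E) (φ t) p)
    (fun p ξ => ⟨frame_comp_of_eq_id hid p ξ, frame_comp_of_eq_id hid p ξ,
      frame_comp_of_eq_id hid p ξ⟩) hx hy hw
  -- The stable line is the unstable line of the reversed flow, in the frame with `W` replaced by
  -- `-W`.
  obtain ⟨X', Y', μ', r', hX', hY', hY0', hμ', hr', hre', hs⟩ := hfr.neg.exists_line
    (ψ := fun t => φ (-t)) (a := fun p => -a p) (b := b) (l := fun p => -l p)
    (hφ.continuous.comp ((continuous_neg.comp continuous_fst).prodMk continuous_snd))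
    (fun s t p => by
      rw [neg_add]
      exact hφ.map_add _ _ _)
    (fun p => by
      rw [neg_zero]
      exact hφ.isFlowOf.map_zero p)
    ha.neg hb hl.neg hpos (fun t p => mfderiv 𝓘(ℝ, E) 𝓘(ℝ, E) (φ (-t)) p)
    (fun p ξ => ⟨frame_comp_of_eq_id hid' p ξ, frame_comp_of_eq_id hid' p ξ,
      congrArg Neg.neg (frame_comp_of_eq_id hid' p ξ)⟩)
    (fun p ξ t => ((hx p ξ (-t)).scomp t (hasDerivAt_neg t)).congr_deriv (by
      rw [smul_eq_mul]
      ring))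
    (fun p ξ t => ((hy p ξ (-t)).scomp t (hasDerivAt_neg t)).congr_deriv (by
      rw [smul_eq_mul]
      ring))
    (fun p ξ t => ((hw p ξ (-t)).scomp t (hasDerivAt_neg t)).neg.congr_deriv (by
      rw [smul_eq_mul]
      ring))
  set σu : ∀ p : N, TangentSpace 𝓘(ℝ, E) p := fun p => X p • F p + Y p • B p + (1 : ℝ) • W p
    with hσu
  set σs : ∀ p : N, TangentSpace 𝓘(ℝ, E) p := fun p => X' p • F p + Y' p • B p + (1 : ℝ) • -W p
    with hσs
  have hli : ∀ p, LinearIndependent ℝ ![F p, σs p, σu p] := fun p =>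
    hfr.linearIndependent p (X' p) (Y' p) (X p) (Y p) (hY0' p) (hY0 p)
  have hs0 : ∀ p, σs p ≠ 0 := fun p => (hli p).ne_zero 1
  have hu0 : ∀ p, σu p ≠ 0 := fun p => (hli p).ne_zero 2
  have hcu : Continuous fun p => (⟨p, σu p⟩ : TangentBundle 𝓘(ℝ, E) N) :=
    continuous_frame_section hF hB hW hX hY continuous_const
  have hcs : Continuous fun p => (⟨p, σs p⟩ : TangentBundle 𝓘(ℝ, E) N) := by
    have h := continuous_frame_section hF hB hW hX' hY' (continuous_const (y := (-1 : ℝ)))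
    refine h.congr fun p => ?_
    simp only [hσs, one_smul, neg_smul, smul_neg]
  -- The invariance of the stable line was obtained for the flow at time `-(-t)`; it is restated at
  -- time `t` by generalising the double negation, since the types depend on it.
  have hst : ∀ t p, ∃ c, 0 < c ∧ (0 ≤ t → c ≤ Real.exp (-μ' * t)) ∧
      mfderiv 𝓘(ℝ, E) 𝓘(ℝ, E) (φ t) p (σs p) = c • σs (φ t p) := by
    intro t p
    have key : mfderiv 𝓘(ℝ, E) 𝓘(ℝ, E) (φ (-(-t))) p (σs p) = r' (-t) p • σs (φ (-(-t)) p) :=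
      hs (-t) p
    refine ⟨r' (-t) p, hr' _ _, fun ht => hre' t ht p, ?_⟩
    have e : -(-t) = t := neg_neg t
    generalize r' (-t) p = c at key
    generalize -(-t) = s at key e
    subst e
    exact key
  refine ⟨φ, hφ.isFlowOf, fun p => Submodule.span ℝ {σs p}, fun p => Submodule.span ℝ {σu p},
    fun p₀ => ⟨Set.univ, univ_mem, σs, hcs.continuousOn, fun p _ => ⟨hs0 p, rfl⟩⟩,
    fun p₀ => ⟨Set.univ, univ_mem, σu, hcu.continuousOn, fun p _ => ⟨hu0 p, rfl⟩⟩,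
    fun p => (hli p).ne_zero 0, fun p => isInternal_of_linearIndependent hE (hli p),
    fun t p => ?_, fun t p => map_span_singleton _ (hr t p) (hu t p), fun h => ?_⟩
  · obtain ⟨c, hc, -, hc'⟩ := hst t p
    exact map_span_singleton _ hc hc'
  · obtain ⟨m, hm, K, hK, hb1⟩ := exists_bounds_inner hcu hu0 h
    obtain ⟨m', hm', K', hK', hb2⟩ := exists_bounds_inner hcs hs0 h
    have hexp : ∀ ν, min μ μ' ≤ ν → ∀ t ≥ 0, Real.exp (-ν * t) ≤ Real.exp (-(min μ μ') * t) :=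
      fun ν hν t ht => Real.exp_le_exp.2 (mul_le_mul_of_nonneg_right (neg_le_neg hν) ht)
    have hC : ∀ {C e R : ℝ}, C ≤ max (K / m) (K' / m') → 0 ≤ e → 0 ≤ R →
        C * e * R ≤ max (K / m) (K' / m') * e * R := fun h1 h2 h3 =>
      mul_le_mul_of_nonneg_right (mul_le_mul_of_nonneg_right h1 h2) h3
    -- One pair of constants must serve both lines: the larger distortion and the smaller rate.
    refine ⟨max (K / m) (K' / m'), lt_max_of_lt_left (div_pos hK hm), min μ μ', lt_min hμ hμ',
      fun t ht p => ⟨fun ξ hξ => ?_, fun ξ hξ => ?_⟩⟩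
    · obtain ⟨c, hc, hce, hc'⟩ := hst t p
      exact (contraction_of_section h _ hm' hK' hb2 hc
        ((hce ht).trans (hexp _ (min_le_right _ _) t ht)) hc' hξ).trans
        (hC (le_max_right _ _) (Real.exp_pos _).le (Real.sqrt_nonneg _))
    · exact (contraction_of_section h _ hm hK hb1 (hr (-t) p)
        ((hre t ht p).trans (hexp _ (min_le_left _ _) t ht)) (hu (-t) p) hξ).trans
        (hC (le_max_left _ _) (Real.exp_pos _).le (Real.sqrt_nonneg _))

end AnosovCriterion

end Thermostat
end

noncomputable section
namespace Thermostat

/-! ### Derivatives along the flow, from time zero to all times. -/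

section FlowDerivative

variable {E : Type*} [NormedAddCommGroup E] [NormedSpace ℝ E]
  {N : Type*} [TopologicalSpace N] [ChartedSpace E N] [IsManifold 𝓘(ℝ, E) ∞ N]
  {F : ∀ p : N, TangentSpace 𝓘(ℝ, E) p} {φ : ℝ → N → N}

theorem IsFlowOf.hasDerivAt_comp (hφ : IsFlowOf 𝓘(ℝ, E) F φ) {f : N → ℝ} {p : N}
    (hf : MDifferentiableAt 𝓘(ℝ, E) 𝓘(ℝ, ℝ) f p) :
    HasDerivAt (fun s => f (φ s p)) (mfderiv 𝓘(ℝ, E) 𝓘(ℝ, ℝ) f p (F p)) 0 := by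
  have h0 := hφ.map_zero p
  have h1 : HasMFDerivAt 𝓘(ℝ, E) 𝓘(ℝ, ℝ) f (φ 0 p) (mfderiv 𝓘(ℝ, E) 𝓘(ℝ, ℝ) f (φ 0 p)) := by
    rw [← h0] at hf
    exact hf.hasMFDerivAt
  have h2 : HasMFDerivAt 𝓘(ℝ, ℝ) 𝓘(ℝ, ℝ) (fun s => f (φ s p)) (0 : ℝ) _ :=
    HasMFDerivAt.comp (f := fun t => φ t p) (0 : ℝ) h1 (hφ.isMIntegralCurve p 0)
  obtain ⟨A, hA, hA1⟩ : ∃ A : ℝ →L[ℝ] ℝ, HasFDerivAt (fun s => f (φ s p)) A 0 ∧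
      A 1 = mfderiv 𝓘(ℝ, E) 𝓘(ℝ, ℝ) f (φ 0 p) ((1 : ℝ) • F (φ 0 p)) :=
    ⟨_, h2.hasFDerivAt, rfl⟩
  refine hA.hasDerivAt.congr_deriv ?_
  have h3 : ∀ q', q' = p → (mfderiv 𝓘(ℝ, E) 𝓘(ℝ, ℝ) f q' (F q') : ℝ) =
      mfderiv 𝓘(ℝ, E) 𝓘(ℝ, ℝ) f p (F p) := by
    rintro q' rfl
    rfl
  rw [← h3 _ h0, hA1, one_smul]

/-- The chain rule for a splitting of the flow map that holds only propositionally; substitution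
keeps the dependent tangent spaces in step. -/
theorem apply_mfderiv_of_eq_comp {c : ∀ p : N, TangentSpace 𝓘(ℝ, E) p → ℝ} {ψ f k : N → N}
    (hψ : ψ = f ∘ k) (hf : MDifferentiable 𝓘(ℝ, E) 𝓘(ℝ, E) f)
    (hk : MDifferentiable 𝓘(ℝ, E) 𝓘(ℝ, E) k) (p : N) (ξ : TangentSpace 𝓘(ℝ, E) p) :
    c (ψ p) (mfderiv 𝓘(ℝ, E) 𝓘(ℝ, E) ψ p ξ) =
      c (f (k p)) (mfderiv 𝓘(ℝ, E) 𝓘(ℝ, E) f (k p) (mfderiv 𝓘(ℝ, E) 𝓘(ℝ, E) k p ξ)) := by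
  subst hψ
  rw [mfderiv_comp p (hf _) (hk p)]
  rfl

/-- By the group property, a linearised equation need only be checked at time zero. -/
theorem IsSmoothFlow.hasDerivAt_of_zero (hφ : IsSmoothFlow F φ)
    {c d : ∀ p : N, TangentSpace 𝓘(ℝ, E) p → ℝ}
    (h : ∀ p ξ, HasDerivAt (fun s => c (φ s p) (mfderiv 𝓘(ℝ, E) 𝓘(ℝ, E) (φ s) p ξ)) (d p ξ) 0)
    (p : N) (ξ : TangentSpace 𝓘(ℝ, E) p) (t : ℝ) :
    HasDerivAt (fun s => c (φ s p) (mfderiv 𝓘(ℝ, E) 𝓘(ℝ, E) (φ s) p ξ))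
      (d (φ t p) (mfderiv 𝓘(ℝ, E) 𝓘(ℝ, E) (φ t) p ξ)) t := by
  have h1 := h (φ t p) (mfderiv 𝓘(ℝ, E) 𝓘(ℝ, E) (φ t) p ξ)
  rw [← sub_self t] at h1
  refine (h1.comp_sub_const t t).congr_of_eventuallyEq (Eventually.of_forall fun s => ?_)
  refine apply_mfderiv_of_eq_comp (ψ := φ s) (f := φ (s - t)) (k := φ t) (funext fun q => ?_)
    (hφ.isFlowOf.mdifferentiable _) (hφ.isFlowOf.mdifferentiable _) p ξ
  rw [Function.comp, ← hφ.map_add, sub_add_cancel]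

end FlowDerivative

/-! ### Thermostats with negative 𝕂 are Anosov. -/

section ThermostatFlow

variable {M : Type*} [TopologicalSpace M] [ChartedSpace E2 M] [IsManifold 𝓘(ℝ, E2) ∞ M]
variable {g : SurfaceMetric M} {o : SurfaceOrientation M}

open UnitTangentBundle

/-- The Gaussian curvature in arbitrary natural coordinates. -/
theorem Adapted.sectional_eq [T2Space M] [CompactSpace M] {p q : UnitTangentBundle g}
    (h : Adapted g o p q) :
    sectional (metricForm g p.base) (connForm g p.base) (stdVec 0) (stdVec 1) (natCoord p q).1 =
      gaussCurvature g q.base := by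
  -- Instead of transforming the curvature tensor, the geodesic flow (the thermostat of the zero
  -- function) is linearised at `ξ = H` in the charts at `p` and at `q`. The vertical component of
  -- the transported vector is the same function of time in both, and its derivative at zero is
  -- minus the curvature computed in either chart.
  have hlam : ContMDiff 𝓘(ℝ, E2 × ℝ) 𝓘(ℝ, ℝ) ∞ (fun _ : UnitTangentBundle g => (0 : ℝ)) :=
    contMDiff_const
  obtain ⟨φ, hφ⟩ := exists_isSmoothFlow (contMDiff_thermostat (o := o) hlam)
  have hs := adapted_self (o := o) q
  set ξ : TangentSpace 𝓘(ℝ, E2 × ℝ) q := (0 : ℝ) • geodesicField g q +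
    (1 : ℝ) • horizontalField g o q + (0 : ℝ) • verticalField g o q with hξ
  have hd : mfderiv 𝓘(ℝ, E2 × ℝ) 𝓘(ℝ, ℝ) (fun _ : UnitTangentBundle g => (0 : ℝ)) q ξ =
      (0 : ℝ) := by
    rw [mfderiv_const]
    rfl
  have h1 := (h.variation hlam hφ ξ hd).2.2
  have h2 := (hs.variation hlam hφ ξ hd).2.2
  rw [(h.comp_frame 0 1 0).2.1] at h1
  rw [(hs.comp_frame 0 1 0).2.1] at h2
  have hc : ContinuousAt (fun s => φ s q) 0 :=
    (hφ.continuous.comp (continuous_id.prodMk continuous_const)).continuousAt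
  have h0 := hφ.isFlowOf.map_zero q
  have hev : ∀ᶠ q' in 𝓝 (φ 0 q), Adapted g o p q' ∧ Adapted g o q q' := by
    rw [h0]
    exact h.eventually.and hs.eventually
  have h3 := h1.unique (h2.congr_of_eventuallyEq (by
    filter_upwards [hc.eventually hev] with s hsev
    rw [(hsev.1.comp_eq _).2.2, (hsev.2.comp_eq _).2.2]))
  have h4 := sectional_eq_gaussCurvature g q.base
  have h5 : (natCoord q q).1 = chartAt E2 q.base q.base := rfl
  rw [h5, h4] at h3
  linarith

/-- The definition of `gaussCurvature` uses a chart that varies with the point. By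
`Adapted.sectional_eq` it may be computed in one fixed chart near `p`, where continuity is visible.
-/
theorem continuous_gaussCurvature_base [T2Space M] [CompactSpace M] (o : SurfaceOrientation M) :
    Continuous fun q : UnitTangentBundle g => gaussCurvature g q.base := by
  refine continuous_iff_continuousAt.2 fun p => ?_
  have h := adapted_self (o := o) p
  have hy := natCoord_mem p h.base_mem
  have hG := h.leviCivita.metric_smooth.continuousAt
  have hΓ := h.leviCivita.conn_smooth.continuousAt
  have hdΓ : ContinuousAt (fderiv ℝ (connForm g p.base)) (natCoord p p).1 :=
    (h.leviCivita.conn_smooth.fderiv_right (m := ∞) le_rfl).continuousAt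
  have hR : ∀ a b c, ContinuousAt (fun y => riemann (connForm g p.base) y a b c)
      (natCoord p p).1 := fun a b c =>
    ((((hdΓ.clm_apply continuousAt_const).clm_apply continuousAt_const).clm_apply
      continuousAt_const).sub (((hdΓ.clm_apply continuousAt_const).clm_apply
      continuousAt_const).clm_apply continuousAt_const)).add
    (((hΓ.clm_apply continuousAt_const).clm_apply ((hΓ.clm_apply continuousAt_const).clm_apply
      continuousAt_const)).sub ((hΓ.clm_apply continuousAt_const).clm_apply
      ((hΓ.clm_apply continuousAt_const).clm_apply continuousAt_const)))
  have hg : ∀ a b, ContinuousAt (fun y => metricForm g p.base y a b) (natCoord p p).1 := fun a b =>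
    (hG.clm_apply continuousAt_const).clm_apply continuousAt_const
  have hd := gram_det_pos g p.base hy
  rw [Matrix.det_fin_two, gram_eq, gram_eq, gram_eq, gram_eq] at hd
  have hK : ContinuousAt (sectional (metricForm g p.base) (connForm g p.base) (stdVec 0)
      (stdVec 1)) (natCoord p p).1 :=
    ((hG.clm_apply (hR _ _ _)).clm_apply continuousAt_const).div
      (((hg _ _).mul (hg _ _)).sub ((hg _ _).mul (hg _ _))) hd.ne'
  have hc : ContinuousAt (fun q => (natCoord p q).1) p :=
    (contMDiffAt_natCoord p h.base_mem).continuousAt.fst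
  refine (ContinuousAt.comp (f := fun q => (natCoord p q).1) hK hc).congr ?_
  filter_upwards [h.eventually] with q hq
  exact hq.sectional_eq

/-- The linearised thermostat flow in the frame `X`, `H`, `V`, at time zero. -/
theorem hasDerivAt_comp_zero [T2Space M] [CompactSpace M] {lam : UnitTangentBundle g → ℝ}
    (hlam : ContMDiff 𝓘(ℝ, E2 × ℝ) 𝓘(ℝ, ℝ) ∞ lam)
    {φ : ℝ → UnitTangentBundle g → UnitTangentBundle g}
    (hφ : IsSmoothFlow (thermostat g o lam) φ) (q : UnitTangentBundle g)
    (ξ : TangentSpace 𝓘(ℝ, E2 × ℝ) q) {dl : ℝ}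
    (hdl : mfderiv 𝓘(ℝ, E2 × ℝ) 𝓘(ℝ, ℝ) lam q ξ = dl) :
    HasDerivAt (fun s => compX (φ s q) (φ s q) (mfderiv 𝓘(ℝ, E2 × ℝ) 𝓘(ℝ, E2 × ℝ) (φ s) q ξ))
      (lam q * compH o q q ξ) 0 ∧
    HasDerivAt (fun s => compH o (φ s q) (φ s q) (mfderiv 𝓘(ℝ, E2 × ℝ) 𝓘(ℝ, E2 × ℝ) (φ s) q ξ))
      (compV o q q ξ - lam q * compX q q ξ) 0 ∧
    HasDerivAt (fun s => compV o (φ s q) (φ s q) (mfderiv 𝓘(ℝ, E2 × ℝ) 𝓘(ℝ, E2 × ℝ) (φ s) q ξ))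
      (-(gaussCurvature g q.base * compH o q q ξ) + dl) 0 := by
  have hs := adapted_self (o := o) q
  have hc : ContinuousAt (fun s => φ s q) 0 :=
    (hφ.continuous.comp (continuous_id.prodMk continuous_const)).continuousAt
  have h0 := hφ.isFlowOf.map_zero q
  have hev : ∀ᶠ s in 𝓝 (0 : ℝ), Adapted g o q (φ s q) := by
    refine hc.eventually (p := Adapted g o q) ?_
    simp only [h0]
    exact hs.eventually
  obtain ⟨h1, h2, h3⟩ := hs.variation hlam hφ ξ hdl
  rw [hs.sectional_eq] at h3
  refine ⟨h1.congr_of_eventuallyEq ?_, h2.congr_of_eventuallyEq ?_, h3.congr_of_eventuallyEq ?_⟩ <;>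
    filter_upwards [hev] with s hsev
  exacts [(hsev.comp_eq _).1.symm, (hsev.comp_eq _).2.1.symm, (hsev.comp_eq _).2.2.symm]

theorem contMDiff_lieDeriv_verticalField {f : UnitTangentBundle g → ℝ}
    (hf : ContMDiff 𝓘(ℝ, E2 × ℝ) 𝓘(ℝ, ℝ) ∞ f) :
    ContMDiff 𝓘(ℝ, E2 × ℝ) 𝓘(ℝ, ℝ) ∞ (lieDeriv (verticalField g o) f) :=
  contMDiff_lieDeriv contMDiff_verticalField hf

/-- The frame `F`, `H + (V lam) V`, `V`. -/
theorem isFrame_thermostat (lam k : UnitTangentBundle g → ℝ) :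
    IsFrame (thermostat g o lam) (fun q => horizontalField g o q + k q • verticalField g o q)
      (verticalField g o) (fun q ξ => compX q q ξ) (fun q ξ => compH o q q ξ)
      (fun q ξ => compV o q q ξ - lam q * compX q q ξ - k q * compH o q q ξ) where
  expand q ξ := by
    conv_lhs => rw [(adapted_self q).eq_frame (o := o) ξ]
    simp only [thermostat]
    module
  coeff q a b c := by
    have e : a • thermostat g o lam q + b • (horizontalField g o q + k q • verticalField g o q) +
        c • verticalField g o q = a • geodesicField g q + b • horizontalField g o q +
        (c + a * lam q + b * k q) • verticalField g o q := by
      simp only [thermostat]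
      module
    rw [e]
    obtain ⟨h1, h2, h3⟩ := (adapted_self (o := o) q).comp_frame a b (c + a * lam q + b * k q)
    rw [h1, h2, h3]
    exact ⟨rfl, rfl, by ring⟩

/-- A thermostat with negative `𝕂` generates an Anosov flow. -/
theorem isAnosov_thermostat [T2Space M] [CompactSpace M] {lam : UnitTangentBundle g → ℝ}
    (hlam : ContMDiff 𝓘(ℝ, E2 × ℝ) 𝓘(ℝ, ℝ) ∞ lam) (hK : ∀ p, bbK g o lam p < 0) :
    IsAnosov 𝓘(ℝ, E2 × ℝ) (thermostat g o lam) := by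
  have hF := contMDiff_thermostat (o := o) hlam
  have hk := contMDiff_lieDeriv_verticalField (o := o) hlam
  set k := lieDeriv (verticalField g o) lam with hkdef
  have hFk := contMDiff_lieDeriv hF hk
  have hHl := contMDiff_lieDeriv (contMDiff_horizontalField (o := o)) hlam
  obtain ⟨φ, hφ⟩ := exists_isSmoothFlow hF
  have hbK : Continuous (bbK g o lam) :=
    (((continuous_gaussCurvature_base o).sub hHl.continuous).add (hlam.continuous.pow 2)).add
      hFk.continuous
  have hB : ContMDiff 𝓘(ℝ, E2 × ℝ) 𝓘(ℝ, E2 × ℝ).tangent ∞ (fun q =>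
      (⟨q, horizontalField g o q + k q • verticalField g o q⟩ :
        TangentBundle 𝓘(ℝ, E2 × ℝ) (UnitTangentBundle g))) :=
    contMDiff_horizontalField.add_section (hk.smul_section contMDiff_verticalField)
  have hE : Module.finrank ℝ (E2 × ℝ) = 3 := by
    rw [Module.finrank_prod, finrank_euclideanSpace_fin, Module.finrank_self]
  -- The coefficients of the criterion are `a = V lam`, `b = -𝕂` and `l = lam`, so the hypothesis on
  -- `𝕂` is the positivity of `b`.
  refine (isFrame_thermostat lam k).isAnosov hE hF.continuous hB.continuous
    contMDiff_verticalField.continuous hφ (a := k) (b := fun q => -bbK g o lam q) (l := lam)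
    hk.continuous hbK.neg hlam.continuous (fun p => neg_pos.2 (hK p)) ?_ ?_ ?_
  · exact hφ.hasDerivAt_of_zero (c := fun q ξ => compX q q ξ)
      (d := fun q ξ => lam q * compH o q q ξ) fun q ξ => (hasDerivAt_comp_zero hlam hφ q ξ rfl).1
  · refine hφ.hasDerivAt_of_zero (c := fun q ξ => compH o q q ξ)
      (d := fun q ξ => k q * compH o q q ξ +
        (compV o q q ξ - lam q * compX q q ξ - k q * compH o q q ξ)) fun q ξ => ?_
    exact (hasDerivAt_comp_zero hlam hφ q ξ rfl).2.1.congr_deriv (by ring)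
  · refine hφ.hasDerivAt_of_zero
      (c := fun q ξ => compV o q q ξ - lam q * compX q q ξ - k q * compH o q q ξ)
      (d := fun q ξ => -bbK g o lam q * compH o q q ξ) fun q ξ => ?_
    obtain ⟨h1, h2, h3⟩ := hasDerivAt_comp_zero hlam hφ q ξ rfl
    have hl' := hφ.isFlowOf.hasDerivAt_comp ((hlam q).mdifferentiableAt (by simp))
    have hk' := hφ.isFlowOf.hasDerivAt_comp ((hk q).mdifferentiableAt (by simp))
    have e0 : φ 0 q = q := hφ.isFlowOf.map_zero q
    have hid : φ 0 = id := funext hφ.isFlowOf.map_zero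
    refine ((h3.sub (hl'.mul h1)).sub (hk'.mul h2)).congr_deriv ?_
    rw [frame_comp_of_eq_id (c := fun q ξ => compX q q ξ) hid q ξ,
      frame_comp_of_eq_id (c := fun q ξ => compH o q q ξ) hid q ξ, e0]
    -- The derivative of `lam` along `ξ` is expanded in the frame: its part along `X` cancels
    -- against the derivative of the coefficient `lam`, and its part along `H` supplies the term `-H
    -- lam` of `kappa`.
    have e1 : (mfderiv 𝓘(ℝ, E2 × ℝ) 𝓘(ℝ, ℝ) lam q ξ : ℝ) =
        compX q q ξ * lieDeriv (geodesicField g) lam q +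
          compH o q q ξ * lieDeriv (horizontalField g o) lam q + compV o q q ξ * k q := by
      conv_lhs => rw [(adapted_self q).eq_frame (o := o) ξ, map_add, map_add, map_smul, map_smul,
        map_smul]
      rfl
    have e2 : (mfderiv 𝓘(ℝ, E2 × ℝ) 𝓘(ℝ, ℝ) lam q (thermostat g o lam q) : ℝ) =
        lieDeriv (geodesicField g) lam q + lam q * k q := by
      rw [thermostat, map_add, map_smul]
      rfl
    have e3 : (mfderiv 𝓘(ℝ, E2 × ℝ) 𝓘(ℝ, ℝ) k q (thermostat g o lam q) : ℝ) =
        lieDeriv (thermostat g o lam) k q := rfl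
    rw [e1, e2, e3, bbK, kappa]
    ring

end ThermostatFlow

end Thermostat
end

noncomputable section
namespace Thermostat

/-! ### W-flows: the identity between 𝕂 and the curvature minus the co-differential. -/

section WFlow

variable {M : Type*} [TopologicalSpace M] [ChartedSpace E2 M] [IsManifold 𝓘(ℝ, E2) ∞ M]
variable {g : SurfaceMetric M} {o : SurfaceOrientation M}

open UnitTangentBundle

/-- A smooth `1`-form is a smooth function on `TM`. -/
theorem SmoothOneForm.contMDiff {θ : ∀ x : M, TangentSpace 𝓘(ℝ, E2) x →L[ℝ] ℝ}
    (hθ : SmoothOneForm θ) : ContMDiff (𝓘(ℝ, E2).prod 𝓘(ℝ, E2)) 𝓘(ℝ, ℝ) ∞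
      (fun q : TangentBundle 𝓘(ℝ, E2) M => θ q.1 q.2) := by
  intro q
  have hid : ContMDiffAt (𝓘(ℝ, E2).prod 𝓘(ℝ, E2)) (𝓘(ℝ, E2).prod 𝓘(ℝ, E2)) ∞
      (fun q : TangentBundle 𝓘(ℝ, E2) M => q) q := contMDiffAt_id
  have hb : ContMDiffAt (𝓘(ℝ, E2).prod 𝓘(ℝ, E2)) 𝓘(ℝ, E2) ∞
      (fun q : TangentBundle 𝓘(ℝ, E2) M => q.1) q := (contMDiffAt_totalSpace.1 hid).1
  have h : ContMDiffAt (𝓘(ℝ, E2).prod 𝓘(ℝ, E2)) (𝓘(ℝ, E2).prod 𝓘(ℝ, ℝ)) ∞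
      (fun q : TangentBundle 𝓘(ℝ, E2) M =>
        TotalSpace.mk' ℝ (E := Bundle.Trivial M ℝ) q.1 (θ q.1 q.2)) q :=
    ContMDiffAt.clm_bundle_apply (F₁ := E2) (F₂ := ℝ)
      (E₁ := fun x : M => TangentSpace 𝓘(ℝ, E2) x) (E₂ := Bundle.Trivial M ℝ)
      (b := fun q : TangentBundle 𝓘(ℝ, E2) M => q.1) (ϕ := fun q => θ q.1) (v := fun q => q.2)
      (ContMDiffAt.comp q (hθ q.1) hb) hid
  simp only [contMDiffAt_totalSpace] at h
  exact h.2

theorem SmoothOneForm.contDiffAt_formComp {θ : ∀ x : M, TangentSpace 𝓘(ℝ, E2) x →L[ℝ] ℝ}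
    (hθ : SmoothOneForm θ) (x₀ : M) {y : E2} (hy : y ∈ (chartAt E2 x₀).target) (j : Fin 2) :
    ContDiffAt ℝ ∞ (formComp θ x₀ j) y := by
  set q : TangentBundle 𝓘(ℝ, E2) M := ⟨x₀, 0⟩
  have h2 : ContMDiffAt 𝓘(ℝ, E2 × E2) 𝓘(ℝ, ℝ) ∞
      (fun z => θ ((tmChart q).symm z).1 ((tmChart q).symm z).2) (y, stdVec j) :=
    hθ.contMDiff.contMDiffAt.comp (y, stdVec j) (contMDiffAt_tmChart_symm q hy)
  have h4 : ContDiffAt ℝ ∞ (fun z : E2 => θ ((tmChart q).symm (z, stdVec j)).1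
      ((tmChart q).symm (z, stdVec j)).2) y :=
    ContDiffAt.comp (g := fun z : E2 × E2 => θ ((tmChart q).symm z).1 ((tmChart q).symm z).2) y
      h2.contDiffAt (contDiffAt_id.prodMk contDiffAt_const)
  refine h4.congr_of_eventuallyEq ?_
  filter_upwards [(chartAt E2 x₀).open_target.mem_nhds hy] with z hz
  rw [tmChart_symm_apply q (z := (z, stdVec j)) hz]
  rfl

theorem SmoothOneForm.contMDiff_formFun {θ : ∀ x : M, TangentSpace 𝓘(ℝ, E2) x →L[ℝ] ℝ}
    (hθ : SmoothOneForm θ) : ContMDiff 𝓘(ℝ, E2 × ℝ) 𝓘(ℝ, ℝ) ∞ (formFun g θ) :=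
  ContMDiff.comp (g := fun q : TangentBundle 𝓘(ℝ, E2) M => θ q.1 q.2) hθ.contMDiff contMDiff_incl

theorem SmoothOneForm.contMDiff_wFun {θ : ∀ x : M, TangentSpace 𝓘(ℝ, E2) x →L[ℝ] ℝ}
    (hθ : SmoothOneForm θ) : ContMDiff 𝓘(ℝ, E2 × ℝ) 𝓘(ℝ, ℝ) ∞ (wFun g o θ) :=
  (contMDiff_lieDeriv_verticalField hθ.contMDiff_formFun).neg

/-- The `1`-form `θ` in the preferred chart at `x₀`. -/
def formVec (θ : ∀ x : M, TangentSpace 𝓘(ℝ, E2) x →L[ℝ] ℝ) (x₀ : M) (y : E2) : E2 →L[ℝ] ℝ :=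
  ∑ j, formComp θ x₀ j y • (EuclideanSpace.proj j : E2 →L[ℝ] ℝ)

theorem formVec_apply (θ : ∀ x : M, TangentSpace 𝓘(ℝ, E2) x →L[ℝ] ℝ) (x₀ : M) (y w : E2) :
    formVec θ x₀ y w = formComp θ x₀ 0 y * w 0 + formComp θ x₀ 1 y * w 1 := by
  simp [formVec]

theorem formVec_stdVec (θ : ∀ x : M, TangentSpace 𝓘(ℝ, E2) x →L[ℝ] ℝ) (x₀ : M) (y : E2)
    (j : Fin 2) : formVec θ x₀ y (stdVec j) = formComp θ x₀ j y := by
  rw [formVec_apply]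
  fin_cases j <;> simp [stdVec]

theorem formVec_coordVec (θ : ∀ x : M, TangentSpace 𝓘(ℝ, E2) x →L[ℝ] ℝ) (x₀ : M) {x : M}
    (hx : x ∈ (chartAt E2 x₀).source) (v : TangentSpace 𝓘(ℝ, E2) x) :
    formVec θ x₀ (chartAt E2 x₀ x) (coordVec x₀ x v) = θ x v := by
  set w := coordVec x₀ x v with hw
  have h : v = w 0 • frameVec x₀ x (stdVec 0) + w 1 • frameVec x₀ x (stdVec 1) := by
    rw [← frameVec_smul x₀ hx, ← frameVec_smul x₀ hx, ← frameVec_add x₀ hx, ← eq_sum_stdVec, hw,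
      frameVec_coordVec x₀ hx]
  rw [formVec_apply, h, map_add, map_smul, map_smul, formComp, formComp,
    (chartAt E2 x₀).left_inv hx, smul_eq_mul, smul_eq_mul, mul_comm, mul_comm (w 1)]

theorem SmoothOneForm.contDiffAt_formVec {θ : ∀ x : M, TangentSpace 𝓘(ℝ, E2) x →L[ℝ] ℝ}
    (hθ : SmoothOneForm θ) (x₀ : M) {y : E2} (hy : y ∈ (chartAt E2 x₀).target) :
    ContDiffAt ℝ ∞ (formVec θ x₀) y :=
  ContDiffAt.sum fun j _ => (hθ.contDiffAt_formComp x₀ hy j).smul contDiffAt_const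

theorem Adapted.formFun_eq {p q : UnitTangentBundle g} (h : Adapted g o p q)
    (θ : ∀ x : M, TangentSpace 𝓘(ℝ, E2) x →L[ℝ] ℝ) :
    formFun g θ q = formVec θ p.base (natCoord p q).1 (natCoord p q).2 := by
  have h1 := formVec_coordVec θ p.base h.base_mem q.vec
  rw [h.coordVec_vec] at h1
  exact h1.symm

/-- The derivative along a vector field of a function given in natural coordinates. -/
theorem lieDeriv_eq_of_natCoord {p q : UnitTangentBundle g}
    (h : q.base ∈ (chartAt E2 p.base).source)
    (F : ∀ q : UnitTangentBundle g, TangentSpace 𝓘(ℝ, E2 × ℝ) q) {f : UnitTangentBundle g → ℝ}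
    {Φ : E2 × E2 → ℝ} {A : E2 × E2 →L[ℝ] ℝ} (hΦ : HasFDerivAt Φ A (natCoord p q))
    (hf : f =ᶠ[𝓝 q] fun q => Φ (natCoord p q)) : lieDeriv F f q = A (natVel p q (F q)) := by
  have h1 : HasMFDerivAt 𝓘(ℝ, E2 × ℝ) 𝓘(ℝ, ℝ) (fun q => Φ (natCoord p q)) q _ :=
    hΦ.hasMFDerivAt.comp q (hasMFDerivAt_natCoord p h)
  rw [lieDeriv, (h1.congr_of_eventuallyEq hf).mfderiv]
  rfl

/-- The derivative of the function `θ`. -/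
theorem Adapted.lieDeriv_formFun {p q : UnitTangentBundle g} (h : Adapted g o p q)
    {θ : ∀ x : M, TangentSpace 𝓘(ℝ, E2) x →L[ℝ] ℝ} (hθ : SmoothOneForm θ)
    (F : ∀ q : UnitTangentBundle g, TangentSpace 𝓘(ℝ, E2 × ℝ) q) {a b : E2}
    (hF : natVel p q (F q) = (a, b)) : lieDeriv F (formFun g θ) q =
      fderiv ℝ (formVec θ p.base) (natCoord p q).1 a (natCoord p q).2 +
        formVec θ p.base (natCoord p q).1 b := by
  have hT := ((hθ.contDiffAt_formVec p.base (natCoord_mem p h.base_mem)).differentiableAt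
    (by simp)).hasFDerivAt
  have h1 : HasFDerivAt (fun z : E2 × E2 => formVec θ p.base z.1) _ (natCoord p q) :=
    HasFDerivAt.comp (g := formVec θ p.base) (f := Prod.fst) (natCoord p q) hT hasFDerivAt_fst
  have hΦ : HasFDerivAt (fun z : E2 × E2 => formVec θ p.base z.1 z.2) _ (natCoord p q) :=
    h1.clm_apply hasFDerivAt_snd
  rw [lieDeriv_eq_of_natCoord h.base_mem F hΦ (by
    filter_upwards [h.eventually] with q' hq'
    exact hq'.formFun_eq θ), hF]
  simp [add_comm]

/-- On a fibre `θ` is linear and `V` moves `v` in the direction `J v`, so `V θ` is `θ(J v)`. -/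
theorem Adapted.wFun_eq {p q : UnitTangentBundle g} (h : Adapted g o p q)
    {θ : ∀ x : M, TangentSpace 𝓘(ℝ, E2) x →L[ℝ] ℝ} (hθ : SmoothOneForm θ) :
    wFun g o θ q = -formVec θ p.base (natCoord p q).1
      (rotForm g o p.base (natCoord p q).1 (natCoord p q).2) := by
  rw [wFun, h.lieDeriv_formFun hθ _ h.natVel_verticalField, map_zero, zero_apply, zero_add]
  rfl

/-- The derivative of the function `-V θ`. -/
theorem Adapted.lieDeriv_wFun {p q : UnitTangentBundle g} (h : Adapted g o p q)
    {θ : ∀ x : M, TangentSpace 𝓘(ℝ, E2) x →L[ℝ] ℝ} (hθ : SmoothOneForm θ)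
    (F : ∀ q : UnitTangentBundle g, TangentSpace 𝓘(ℝ, E2 × ℝ) q) {a b : E2}
    (hF : natVel p q (F q) = (a, b)) : lieDeriv F (wFun g o θ) q =
      -(fderiv ℝ (formVec θ p.base) (natCoord p q).1 a (natRot o p q) +
        formVec θ p.base (natCoord p q).1
          (fderiv ℝ (rotForm g o p.base) (natCoord p q).1 a (natCoord p q).2 +
            rotForm g o p.base (natCoord p q).1 b)) := by
  have hT := ((hθ.contDiffAt_formVec p.base (natCoord_mem p h.base_mem)).differentiableAt
    (by simp)).hasFDerivAt
  have h1 : HasFDerivAt (fun z : E2 × E2 => formVec θ p.base z.1) _ (natCoord p q) :=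
    HasFDerivAt.comp (g := formVec θ p.base) (f := Prod.fst) (natCoord p q) hT hasFDerivAt_fst
  have h2 : HasFDerivAt (fun z : E2 × E2 => rotForm g o p.base z.1) _ (natCoord p q) :=
    HasFDerivAt.comp (g := rotForm g o p.base) (f := Prod.fst) (natCoord p q)
      h.rotation.differentiableAt.hasFDerivAt hasFDerivAt_fst
  have hΦ : HasFDerivAt
      (fun z : E2 × E2 => -formVec θ p.base z.1 (rotForm g o p.base z.1 z.2)) _ (natCoord p q) :=
    (h1.clm_apply (h2.clm_apply hasFDerivAt_snd)).neg
  rw [lieDeriv_eq_of_natCoord h.base_mem F hΦ (by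
    filter_upwards [h.eventually] with q' hq'
    exact hq'.wFun_eq hθ), hF]
  simp [natRot]
  abel

/-- Since `J² = -1`, applying `V` twice to `θ` gives `-θ`. -/
theorem lieDeriv_verticalField_wFun {θ : ∀ x : M, TangentSpace 𝓘(ℝ, E2) x →L[ℝ] ℝ}
    (hθ : SmoothOneForm θ) : lieDeriv (verticalField g o) (wFun g o θ) = formFun g θ := by
  funext q
  have h := adapted_self (o := o) q
  have hJ : rotForm g o q.base (natCoord q q).1 (natRot o q q) = -(natCoord q q).2 :=
    h.rotation.sq _
  rw [h.lieDeriv_wFun hθ _ h.natVel_verticalField, h.formFun_eq, hJ]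
  simp

/-- The inverse metric in an orthonormal frame. -/
theorem Adapted.gram_inv {p q : UnitTangentBundle g} (h : Adapted g o p q) (i j : Fin 2) :
    (gram g p.base (natCoord p q).1)⁻¹ i j =
      (natCoord p q).2 i * (natCoord p q).2 j + natRot o p q i * natRot o p q j := by
  set y := (natCoord p q).1
  set v := (natCoord p q).2
  set n := natRot o p q
  have e : ∀ w b : E2, metricForm g p.base y w b =
      w 0 * metricForm g p.base y (stdVec 0) b + w 1 * metricForm g p.base y (stdVec 1) b := by
    intro w b
    conv_lhs => rw [eq_sum_stdVec w]
    simp only [map_add, map_smul, add_apply, smul_apply, smul_eq_mul]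
  have key : (Matrix.of fun i j => v i * v j + n i * n j) * gram g p.base y = 1 := by
    ext i k
    have h1 := congrArg (fun w : E2 => w i) (h.expand (stdVec k))
    simp only [PiLp.add_apply, PiLp.smul_apply, smul_eq_mul] at h1
    rw [e, e n] at h1
    rw [Matrix.mul_apply, Fin.sum_univ_two, Matrix.of_apply, Matrix.of_apply, gram_eq, gram_eq]
    have h2 : (1 : Matrix (Fin 2) (Fin 2) ℝ) i k = stdVec k i := by
      simp [stdVec, Matrix.one_apply]
    rw [h2, h1]
    ring
  rw [Matrix.inv_eq_left_inv key]
  rfl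

/-- The covariant derivative of a `1`-form. -/
def covDerivForm (T : E2 → E2 →L[ℝ] ℝ) (Γ : E2 → (E2 →L[ℝ] E2 →L[ℝ] E2)) (y a b : E2) : ℝ :=
  fderiv ℝ T y a b - T y (Γ y a b)

theorem covDerivForm_expand (T : E2 → E2 →L[ℝ] ℝ) (Γ : E2 → (E2 →L[ℝ] E2 →L[ℝ] E2))
    (y a b : E2) : covDerivForm T Γ y a b =
      ∑ i, ∑ j, a i * b j * covDerivForm T Γ y (stdVec i) (stdVec j) := by
  conv_lhs => rw [eq_sum_stdVec a, eq_sum_stdVec b]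
  simp only [covDerivForm, map_add, map_smul, add_apply, smul_apply, smul_eq_mul,
    Fin.sum_univ_two]
  ring

/-- By `Adapted.gram_inv` the inverse metric is `v ⊗ v + Jv ⊗ Jv`, so the contraction defining the
co-differential is the trace of `∇θ` in this frame. -/
theorem codifferential_eq {θ : ∀ x : M, TangentSpace 𝓘(ℝ, E2) x →L[ℝ] ℝ} (hθ : SmoothOneForm θ)
    (o : SurfaceOrientation M) (p : UnitTangentBundle g) : -codifferential g θ p.base =
      covDerivForm (formVec θ p.base) (connForm g p.base) (natCoord p p).1 (natCoord p p).2
        (natCoord p p).2 +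
      covDerivForm (formVec θ p.base) (connForm g p.base) (natCoord p p).1 (natRot o p p)
        (natRot o p p) := by
  have h := adapted_self (o := o) p
  have hy := natCoord_mem p h.base_mem
  have e : chartAt E2 p.base p.base = (natCoord p p).1 := rfl
  rw [covDerivForm_expand _ _ _ (natCoord p p).2, covDerivForm_expand _ _ _ (natRot o p p),
    codifferential, neg_neg, e, ← Finset.sum_add_distrib]
  refine Finset.sum_congr rfl fun i _ => ?_
  rw [← Finset.sum_add_distrib]
  refine Finset.sum_congr rfl fun j _ => ?_
  rw [h.gram_inv, ← add_mul]
  congr 1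
  have hT := ((hθ.contDiffAt_formVec p.base hy).differentiableAt (by simp)).hasFDerivAt
  have h1 : pd i (formComp θ p.base j) (natCoord p p).1 =
      fderiv ℝ (formVec θ p.base) (natCoord p p).1 (stdVec i) (stdVec j) := by
    have h2 := hT.clm_apply (hasFDerivAt_const (stdVec j) (natCoord p p).1)
    simp only [formVec_stdVec] at h2
    rw [pd, HasFDerivAt.fderiv h2]
    simp
  rw [h1, covDerivForm, connForm, bilinForm_stdVec, map_sum]
  simp only [map_smul, formVec_stdVec, smul_eq_mul]

/-- The quantity `𝕂` of a W-flow is `K - δθ`. -/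
theorem bbK_wFun {θ : ∀ x : M, TangentSpace 𝓘(ℝ, E2) x →L[ℝ] ℝ}
    (hθ : SmoothOneForm θ) (p : UnitTangentBundle g) : bbK g o (wFun g o θ) p =
      gaussCurvature g p.base - codifferential g θ p.base := by
  have h := adapted_self (o := o) p
  have hL : LeviCivita (metricForm g p.base) (connForm g p.base) (natCoord p p).1 := h.leviCivita
  have hJ : ∀ᶠ z in 𝓝 (natCoord p p).1, Rotation (metricForm g p.base) (rotForm g o p.base) z := by
    filter_upwards [(chartAt E2 p.base).open_target.mem_nhds (natCoord_mem p h.base_mem)] with z hz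
    exact rotation_rotForm g o p.base hz
  have hn : rotForm g o p.base (natCoord p p).1 (natCoord p p).2 = natRot o p p := rfl
  -- With `J` parallel, `-H lam` becomes `(∇θ)(Jv, Jv)`, and `F θ` becomes `(∇θ)(v, v) + lam θ(Jv)`.
  -- As `lam = -θ(Jv)`, the last product cancels `lam²`.
  rw [sub_eq_add_neg, codifferential_eq hθ o p, bbK, kappa, lieDeriv_verticalField_wFun hθ,
    h.lieDeriv_wFun hθ _ h.natVel_horizontalField, h.lieDeriv_formFun hθ _ (h.natVel_thermostat _),
    Rotation.parallel hL hJ, hn, covDerivForm, covDerivForm, h.wFun_eq hθ, hn]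
  simp only [map_add, map_sub, map_neg, map_smul, smul_eq_mul]
  ring

end WFlow

end Thermostat
end

theorem mainTheorem8 {M : Type*} [TopologicalSpace M] [T2Space M] [CompactSpace M]
    [ChartedSpace E2 M] [IsManifold 𝓘(ℝ, E2) ∞ M]
    (g : SurfaceMetric M) (o : SurfaceOrientation M) :
    (∀ lam : UnitTangentBundle g → ℝ, ContMDiff 𝓘(ℝ, E2 × ℝ) 𝓘(ℝ, ℝ) ∞ lam →
      (∀ p, bbK g o lam p < 0) → IsAnosov 𝓘(ℝ, E2 × ℝ) (thermostat g o lam)) ∧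
    (∀ θ : ∀ x : M, TangentSpace 𝓘(ℝ, E2) x →L[ℝ] ℝ, SmoothOneForm θ →
      (∀ p : UnitTangentBundle g, bbK g o (wFun g o θ) p =
        gaussCurvature g p.base - codifferential g θ p.base) ∧
      ((∀ x : M, gaussCurvature g x - codifferential g θ x < 0) →
        IsAnosov 𝓘(ℝ, E2 × ℝ) (thermostat g o (wFun g o θ)))) := by
  refine ⟨fun lam hlam hK => isAnosov_thermostat hlam hK, fun θ hθ =>
    ⟨fun p => bbK_wFun hθ p, fun hK => isAnosov_thermostat hθ.contMDiff_wFun fun p => ?_⟩⟩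
  rw [bbK_wFun hθ p]
  exact hK p.base
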